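/- Let $\ell$ be a prime number and let $K$ be a field that is complete for a discrete valuation $v$ (normalized by $v(K^\times)=\mathbb{Z}$), with perfect residue field of characteristic $\ell$ and with finite absolute ramification index $e=v(\ell)$ (so that $K$ has characteristic $0$). Let $K_\infty/K$ be a totally ramified Galois extension with an isomorphism of topological groups $\mathscr{C}:=\mathrm{Gal}(K_\infty/K)\simeq\mathbb{Z}_\ell$, let $\mathscr{C}(n)$ be the subgroup of $\mathscr{C}$ corresponding to $\ell^n\mathbb{Z}_\ell$, and let $\mathscr{C}^x$ ($x\ge -1$ real) be the ramification groups of $K_\infty/K$ in upper numbering. Define the sequence of upper ramification jumps by $\nu_0=-1$ and $\nu_{i+1}=\sup\{x\ge -1:\mathscr{C}(i)\subseteq\mathscr{C}^x\}$ for $i\ge 0$. Then $(\nu_i)_{i\ge0}$ is strictly increasing, with $\mathscr{C}^x=\mathscr{C}(i)$ whenever $\nu_i<x\le\nu_{i+1}$, and there is an integer $\kappa\ge 0$ such that $$\nu_{i+1}-\nu_i=e\quad\text{for all } i\ge\kappa+1,\qquad \max\{\nu_{\kappa+1},\,\ell^{\kappa}\}\le\frac{e\ell}{\ell-1},$$ and,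 except when $e=1$ and $\ell$ is odd, moreover $$\max\{\nu_{\kappa+1},\,\ell^{\kappa}+1\}\le\frac{e\ell}{\ell-1}.$$ -/

import Mathlib

open IsLocalRing

noncomputable section

namespace Ramification

/-- The ideal `𝔪_F` of the ring of integers `𝒪_F = integralClosure R F` of an extension `F` of the
fraction field of `R`: the intersection of the maximal ideals of `𝒪_F`. When `R` is a complete
discrete valuation ring and `F` is algebraic over its fraction field, `𝒪_F` is local and `𝔪_F` is
its unique maximal ideal. -/
def integersMaxIdeal (R F : Type*) [CommRing R] [Field F] [Algebra R F] :
    Ideal (integralClosure R F) :=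
  Ring.jacobson (integralClosure R F)

/-- The algebraic extension `L / K`, where `K` is the fraction field of the complete discrete
valuation ring `R` with perfect residue field, is totally ramified: every finite subextension `F`
has ramification index `[F : K]`, that is, `𝔪_K 𝒪_F = 𝔪_F ^ [F : K]`. -/
def IsTotallyRamified (R K L : Type*) [CommRing R] [IsLocalRing R] [Field K] [Field L]
    [Algebra R K] [Algebra K L] [Algebra R L] [IsScalarTower R K L] : Prop :=
  ∀ F : IntermediateField K L, FiniteDimensional K F →
    (maximalIdeal R).map (algebraMap R (integralClosure R F)) =
      integersMaxIdeal R F ^ Module.finrank K F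

section Finite

variable (R K F : Type*) [CommRing R] [Field K] [Field F]
  [Algebra R K] [Algebra K F] [Algebra R F] [IsScalarTower R K F]

/-- The ramification group `G_i` in lower numbering (`i ≥ -1` an integer) of a finite Galois
extension `F / K` with group `G`: all `σ` with `σ b - b ∈ 𝔪_F ^ (i + 1)` for every `b ∈ 𝒪_F`. -/
def lowerGroup (i : ℤ) : Subgroup Gal(F/K) where
  carrier := {σ | ∀ b : integralClosure R F, ∃ c ∈ integersMaxIdeal R F ^ (i + 1).toNat,
    (c : F) = σ b - b}
  one_mem' b := ⟨0, Ideal.zero_mem _, by simp⟩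
  mul_mem' := by
    intro σ τ hσ hτ b
    have hb : IsIntegral R (τ (b : F)) :=
      IsIntegral.map ((τ : F →ₐ[K] F).restrictScalars R) b.2
    obtain ⟨c, hc, h⟩ := hσ ⟨τ b, hb⟩
    obtain ⟨d, hd, h2⟩ := hτ b
    refine ⟨c + d, Ideal.add_mem _ hc hd, ?_⟩
    simp [h, h2]
  inv_mem' := by
    intro σ hσ b
    have hb : IsIntegral R (σ⁻¹ (b : F)) :=
      IsIntegral.map (((σ⁻¹ : Gal(F/K)) : F →ₐ[K] F).restrictScalars R) b.2
    obtain ⟨c, hc, h⟩ := hσ ⟨σ⁻¹ b, hb⟩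
    refine ⟨-c, neg_mem hc, ?_⟩
    simp [h]

/-- Herbrand's function `φ(u) = ∫₀ᵘ dt / (G_0 : G_t)`, where `G_t = G_⌈t⌉`. (For `-1 < t ≤ 0` one has
`G_t = G_0`, so that `φ(u) = u` on `[-1, 0]`.) -/
def herbrandPhi (u : ℝ) : ℝ :=
  ∫ t in (0 : ℝ)..u,
    (Nat.card (lowerGroup R K F ⌈t⌉) : ℝ) / (Nat.card (lowerGroup R K F 0) : ℝ)

/-- The inverse `ψ` of the bijection `φ : [-1, ∞) → [-1, ∞)`. -/
def herbrandPsi : ℝ → ℝ :=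
  Function.invFunOn (herbrandPhi R K F) (Set.Ici (-1))

/-- The ramification group `G^x = G_{ψ(x)}` in upper numbering, for real `x ≥ -1`. -/
def upperGroup (x : ℝ) : Subgroup Gal(F/K) :=
  lowerGroup R K F ⌈herbrandPsi R K F x⌉

end Finite

section Infinite

variable (R K L : Type*) [CommRing R] [Field K] [Field L]
  [Algebra R K] [Algebra K L] [Algebra R L] [IsScalarTower R K L]

/-- The ramification group in upper numbering (`x ≥ -1`) of a possibly infinite Galois extension
`L / K`: the projective limit of the groups `Gal(F/K)^x`, for `F / K` finite Galois in `L`. -/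
def profiniteUpperGroup (x : ℝ) : Subgroup Gal(L/K) :=
  ⨅ F : FiniteGaloisIntermediateField K L,
    (upperGroup R K F x).comap (AlgEquiv.restrictNormalHom F)

end Infinite

section Procyclic

variable {K L : Type*} [Field K] [Field L] [Algebra K L] {ℓ : ℕ} [Fact ℓ.Prime]

/-- The subgroup `C(n)` of `C = Gal(L/K)` that corresponds to `ℓ ^ n ℤ_ℓ` under an isomorphism
`ℤ_ℓ ≃ C`. -/
def levelSubgroup (Φ : Multiplicative ℤ_[ℓ] ≃ₜ* Gal(L/K)) (n : ℕ) : Subgroup Gal(L/K) :=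
  (Submodule.toAddSubgroup (Ideal.span {(ℓ : ℤ_[ℓ]) ^ n})).toSubgroup.map
    Φ.toMulEquiv.toMonoidHom

/-- The upper ramification jumps of a totally ramified `ℤ_ℓ`-extension `L / K`: `ν_0 = -1`, and
`ν_{i+1}` is the largest `x ≥ -1` for which `C^x` contains `C(i)`. -/
def upperJump (R : Type*) [CommRing R] [Algebra R K] [Algebra R L] [IsScalarTower R K L]
    (Φ : Multiplicative ℤ_[ℓ] ≃ₜ* Gal(L/K)) : ℕ → ℝ
  | 0 => -1
  | i + 1 => sSup {x : ℝ | -1 ≤ x ∧ levelSubgroup Φ i ≤ profiniteUpperGroup R K L x}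

end Procyclic

end Ramification

end

/-!
The upper jumps of a totally ramified cyclic extension of degree `ℓ ^ n` are read off from its
norm groups. Let `U ^ m` be the group of units of the base field that are congruent to `1` at
level `m`, and let `μ j` be the largest `m` for which some element of `U ^ m` is not a limit of
norms from the layer of degree `ℓ ^ (j + 1)`. How `μ` grows is governed by `ℓ`-th powers: an
element `a` is a limit of norms from one layer if and only if `a ^ ℓ` is a limit of norms from the
next one (`CyclicTower.isNormLimit_pow` and, by an approximate form of Hilbert's Theorem 90,
`CyclicTower.isNormLimit_of_pow`). Since `U ^ m` to the power `ℓ` is `U ^ (m + e)` up to higher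
order if `m > e / (ℓ - 1)`, and lies in `U ^ min (ℓ m, m + e)` always, one gets
`μ (j + 1) = μ j + e` as soon as `μ j ≥ e / (ℓ - 1)`, and `ℓ μ j ≤ μ (j + 1) ≤ e ℓ / (ℓ - 1)`
before (`CyclicTower.exists_isUpperJumps`). The index `κ` is the first one with
`μ κ ≥ e / (ℓ - 1)`; the bound on `ℓ ^ κ` follows from `μ 0 ≥ 1` (`exists_stable_index`).

That the `μ j` are the upper jumps in the sense of Herbrand's function follows from the behaviour
of the norm on the filtration by the `U ^ m`: in a step of degree `ℓ` it is
`1 + x ↦ 1 + Tr x + N x + ⋯` (`PrimeStep.exists_normProd_one_add`), hence surjective on the graded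
pieces away from the jump. So each `μ j` is a jump, and as the `μ j` increase, they are the jumps
in their order (`CyclicTower.gradedUnitsAreNorms`). In particular the upper jumps are integers,
without an appeal to the theorem of Hasse and Arf.

The argument needs that `μ 0` exists, that is, that not all units in `U ^ 1` are limits of norms.
This fails for instance over an algebraically closed residue field. At the first jump the norm
induces a map `c ↦ c ^ ℓ + β c` on the residue field, which is not surjective if the residue field
is large enough. Therefore the ring of integers `B` of the extension is replaced by the
localization of the monoid algebra `B[ℚ≥0]` at its uniformizer, with the Galois group acting on
the coefficients. This changes neither the jumps nor `e`; the residue field remains perfect, as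
the exponents are divisible, and the monomial of exponent `1` is not in the image of the map
(`TotallyRamifiedAut.cyclicTower`, `TotallyRamifiedAut.not_unitsAreNormLimits_one`).

Finally, `upperGroup_eq_zpowers` computes Herbrand's function of a finite layer from its jumps,
`mem_lowerGroup_algHom_iff` shows that the jumps of the finite layers are compatible, and
`profiniteUpperGroup_eq_levelSubgroup` passes to the limit.
-/

namespace Ramification

/-! ### Integer-valued valuations -/

section Valuation

variable {F : Type*} [Field F] (w : AddValuation F (WithTop ℤ))

/-- `x` lies in the fractional ideal of all elements of valuation at least `m`. -/
def ValGE (m : ℤ) (x : F) : Prop := (m : WithTop ℤ) ≤ w x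

variable {w}

theorem ValGE.mono {m k : ℤ} {x : F} (h : ValGE w m x) (hk : k ≤ m) : ValGE w k x :=
  le_trans (by exact_mod_cast hk) h

theorem valGE_zero (m : ℤ) : ValGE w m 0 := by simp [ValGE]

theorem valGE_one : ValGE w 0 1 := by simp [ValGE]

theorem ValGE.add {m : ℤ} {x y : F} (hx : ValGE w m x) (hy : ValGE w m y) : ValGE w m (x + y) :=
  w.map_le_add hx hy

theorem ValGE.neg {m : ℤ} {x : F} (hx : ValGE w m x) : ValGE w m (-x) := by
  simpa [ValGE, w.map_neg] using hx

theorem ValGE.sub {m : ℤ} {x y : F} (hx : ValGE w m x) (hy : ValGE w m y) : ValGE w m (x - y) :=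
  w.map_le_sub hx hy

theorem ValGE.sub_comm {m : ℤ} {x y : F} (hx : ValGE w m (x - y)) : ValGE w m (y - x) := by
  simpa using hx.neg

theorem ValGE.trans {m : ℤ} {x y z : F} (hx : ValGE w m (x - y)) (hy : ValGE w m (y - z)) :
    ValGE w m (x - z) := by
  simpa using hx.add hy

theorem ValGE.mul {m k : ℤ} {x y : F} (hx : ValGE w m x) (hy : ValGE w k y) :
    ValGE w (m + k) (x * y) := by
  simp only [ValGE, w.map_mul] at *
  push_cast
  exact add_le_add hx hy

theorem ValGE.mul_right {m : ℤ} {x y : F} (hx : ValGE w m x) (hy : ValGE w 0 y) :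
    ValGE w m (x * y) := by
  simpa using hx.mul hy

theorem ValGE.mul_left {m : ℤ} {x y : F} (hx : ValGE w 0 x) (hy : ValGE w m y) :
    ValGE w m (x * y) := by
  simpa using hx.mul hy

theorem ValGE.sum {ι : Type*} {s : Finset ι} {f : ι → F} {m : ℤ}
    (h : ∀ i ∈ s, ValGE w m (f i)) : ValGE w m (∑ i ∈ s, f i) :=
  w.map_le_sum h

theorem ValGE.prod {ι : Type*} {s : Finset ι} {f : ι → F}
    (h : ∀ i ∈ s, ValGE w 0 (f i)) : ValGE w 0 (∏ i ∈ s, f i) :=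
  Finset.prod_induction f (ValGE w 0) (fun _ _ => ValGE.mul_right) valGE_one h

theorem ValGE.pow {m : ℤ} {x : F} (hx : ValGE w m x) (n : ℕ) : ValGE w (n * m) (x ^ n) := by
  induction n with
  | zero => simpa using valGE_one
  | succ n ih =>
    rw [pow_succ]
    convert ih.mul hx using 1
    push_cast
    ring

theorem ValGE.pow_zero {x : F} (hx : ValGE w 0 x) (n : ℕ) : ValGE w 0 (x ^ n) := by
  simpa using hx.pow n

theorem valGE_natCast (n : ℕ) : ValGE w 0 (n : F) := by
  induction n with
  | zero => simpa using valGE_zero 0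
  | succ n ih => simpa using ih.add valGE_one

theorem valGE_intCast (n : ℤ) : ValGE w 0 (n : F) := by
  obtain ⟨n, rfl | rfl⟩ := n.eq_nat_or_neg
  · simpa using valGE_natCast n
  · simpa using (valGE_natCast (w := w) n).neg

theorem valGE_of_eq {a : ℤ} {x : F} (hx : w x = a) : ValGE w a x := hx.ge

theorem valGE_le {a b : ℤ} {x : F} (hx : w x = a) (h : ValGE w b x) : b ≤ a := by
  rw [ValGE, hx] at h
  exact_mod_cast h

theorem exists_val_eq (w : AddValuation F (WithTop ℤ)) {x : F} (hx : x ≠ 0) :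
    ∃ a : ℤ, w x = a := by
  obtain ⟨a, ha⟩ := WithTop.ne_top_iff_exists.1 ((w.ne_top_iff).2 hx)
  exact ⟨a, ha.symm⟩

theorem ne_zero_of_val_eq {a : ℤ} {x : F} (hx : w x = a) : x ≠ 0 := by
  rintro rfl
  simp at hx

theorem val_unique {a b : ℤ} {x : F} (ha : w x = a) (hb : w x = b) : a = b := by
  rw [ha] at hb
  exact_mod_cast hb

theorem val_mul_eq {a b : ℤ} {x y : F} (hx : w x = a) (hy : w y = b) :
    w (x * y) = ((a + b : ℤ) : WithTop ℤ) := by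
  rw [w.map_mul, hx, hy]; push_cast; rfl

theorem val_pow_eq {a : ℤ} {x : F} (hx : w x = a) (n : ℕ) :
    w (x ^ n) = ((n * a : ℤ) : WithTop ℤ) := by
  induction n with
  | zero => simp
  | succ n ih =>
    rw [pow_succ, val_mul_eq ih hx]
    congr 1
    push_cast
    ring

theorem val_one_eq (w : AddValuation F (WithTop ℤ)) : w 1 = ((0 : ℤ) : WithTop ℤ) := by simp

theorem val_inv_eq {a : ℤ} {x : F} (hx : w x = a) : w x⁻¹ = ((-a : ℤ) : WithTop ℤ) := by
  have h0 := ne_zero_of_val_eq hx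
  obtain ⟨b, hb⟩ := exists_val_eq w (inv_ne_zero h0)
  have h1 := val_mul_eq hx hb
  rw [mul_inv_cancel₀ h0] at h1
  have := val_unique h1 (val_one_eq w)
  rw [hb]
  congr 1
  omega

theorem val_div_eq {a b : ℤ} {x y : F} (hx : w x = a) (hy : w y = b) :
    w (x / y) = ((a - b : ℤ) : WithTop ℤ) := by
  rw [div_eq_mul_inv, val_mul_eq hx (val_inv_eq hy), sub_eq_add_neg]

theorem val_zpow_eq {a : ℤ} {x : F} (hx : w x = a) (n : ℤ) :
    w (x ^ n) = ((n * a : ℤ) : WithTop ℤ) := by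
  obtain ⟨n, rfl | rfl⟩ := n.eq_nat_or_neg
  · simpa using val_pow_eq hx n
  · rw [zpow_neg, zpow_natCast, val_inv_eq (val_pow_eq hx n)]
    simp

theorem val_prod_eq {ι : Type*} (s : Finset ι) {f : ι → F} {a : ℤ}
    (h : ∀ i ∈ s, w (f i) = a) : w (∏ i ∈ s, f i) = ((s.card * a : ℤ) : WithTop ℤ) := by
  classical
  induction s using Finset.induction_on with
  | empty => simp
  | insert i s hi ih =>
    rw [Finset.prod_insert hi, val_mul_eq (h i (by simp))
      (ih fun j hj => h j (by simp [hj])), Finset.card_insert_of_notMem hi]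
    congr 1
    push_cast
    ring

theorem ValGE.div {m b : ℤ} {x y : F} (hx : ValGE w m x) (hy : w y = b) :
    ValGE w (m - b) (x / y) := by
  rw [div_eq_mul_inv, sub_eq_add_neg]
  exact hx.mul (valGE_of_eq (val_inv_eq hy))

theorem val_add_eq {a b : ℤ} {x y : F} (hx : w x = a) (hy : ValGE w b y) (hab : a < b) :
    w (x + y) = a := by
  rw [← hx]
  refine w.map_add_eq_of_lt_left (lt_of_lt_of_le ?_ hy)
  rw [hx]
  exact_mod_cast hab

theorem val_eq_of_sub {a b : ℤ} {x y : F} (hx : w x = a) (hy : ValGE w b (y - x)) (hab : a < b) :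
    w y = a := by
  simpa using val_add_eq hx hy hab

/-- An element of the fractional ideal of valuation `≥ m` that misses the next one has
valuation `m`. -/
theorem val_eq_of_not_valGE {m : ℤ} {x : F} (h : ValGE w m x) (h' : ¬ ValGE w (m + 1) x) :
    w x = m := by
  have h0 : x ≠ 0 := by
    rintro rfl
    exact h' (valGE_zero _)
  obtain ⟨a, ha⟩ := exists_val_eq w h0
  have h1 := valGE_le ha h
  have h2 : ¬ (m + 1 ≤ a) := fun hle => h' ((valGE_of_eq ha).mono hle)
  rw [ha]
  congr 1
  omega

/-- An element all of whose valuations lie in `c ℤ` has its valuation rounded up to the next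
multiple of `c`. -/
theorem ValGE.round {c m k : ℤ} {x : F} (h : ValGE w m x) (hc : ∀ a : ℤ, w x = a → c ∣ a)
    (hk : c ∣ k) (hlt : k - c < m) : ValGE w k x := by
  by_cases h0 : x = 0
  · rw [h0]; exact valGE_zero _
  obtain ⟨a, ha⟩ := exists_val_eq w h0
  refine (valGE_of_eq ha).mono ?_
  have h1 := valGE_le ha h
  obtain ⟨s, hs⟩ := hc a ha
  obtain ⟨r, rfl⟩ := hk
  subst hs
  by_contra! hcon
  by_cases hc0 : 0 < c
  · have : s ≤ r - 1 := by nlinarith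
    nlinarith
  · have hc1 : c ≤ 0 := by omega
    have : r - 1 ≤ s - 1 := by nlinarith
    by_cases h2 : s ≤ r - 1
    · nlinarith
    · nlinarith

end Valuation


/-! ### Norms and traces along a cyclic group of automorphisms -/

section NormTrace

variable {F : Type*} [Field F]

/-- The norm `x * τ x * ⋯ * τ ^ (m - 1) x`. -/
def normProd (τ : RingAut F) (m : ℕ) (x : F) : F := ∏ s ∈ Finset.range m, (τ ^ s) x

/-- The trace `x + τ x + ⋯ + τ ^ (m - 1) x`. -/
def traceSum (τ : RingAut F) (m : ℕ) (x : F) : F := ∑ s ∈ Finset.range m, (τ ^ s) x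

variable (τ : RingAut F) (m : ℕ)

theorem normProd_mul (x y : F) : normProd τ m (x * y) = normProd τ m x * normProd τ m y := by
  simp [normProd, Finset.prod_mul_distrib]

theorem normProd_one : normProd τ m 1 = 1 := by simp [normProd]

theorem normProd_div (x y : F) : normProd τ m (x / y) = normProd τ m x / normProd τ m y := by
  simp [normProd]

theorem normProd_ne_zero {x : F} (hx : x ≠ 0) : normProd τ m x ≠ 0 := by
  exact Finset.prod_ne_zero_iff.2 fun s _ => (map_ne_zero _).2 hx

theorem normProd_succ (x : F) : normProd τ (m + 1) x = normProd τ m x * (τ ^ m) x := by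
  simp [normProd, Finset.prod_range_succ]

theorem map_normProd_mul (x : F) : τ (normProd τ m x) * x = normProd τ m x * (τ ^ m) x := by
  rw [← normProd_succ, normProd, normProd, Finset.prod_range_succ', map_prod]
  simp only [pow_zero, RingAut.one_apply]
  congr 1
  refine Finset.prod_congr rfl fun s _ => ?_
  rw [pow_succ', RingAut.mul_apply]

theorem map_traceSum_add (x : F) : τ (traceSum τ m x) + x = traceSum τ m x + (τ ^ m) x := by
  rw [traceSum, ← Finset.sum_range_succ (fun s => (τ ^ s) x), Finset.sum_range_succ', map_sum]
  simp only [pow_zero, RingAut.one_apply]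
  congr 1
  refine Finset.sum_congr rfl fun s _ => ?_
  rw [pow_succ', RingAut.mul_apply]

variable {τ m}

theorem map_normProd {x : F} (hx : (τ ^ m) x = x) : τ (normProd τ m x) = normProd τ m x := by
  by_cases h0 : x = 0
  · subst h0
    rcases Nat.eq_zero_or_pos m with rfl | hm
    · simp [normProd]
    · have : normProd τ m 0 = 0 := by
        rw [normProd]
        exact Finset.prod_eq_zero (Finset.mem_range.2 hm) (map_zero _)
      rw [this, map_zero]
  · have := map_normProd_mul τ m x
    rw [hx] at this
    exact mul_right_cancel₀ h0 this

theorem map_traceSum {x : F} (hx : (τ ^ m) x = x) : τ (traceSum τ m x) = traceSum τ m x := by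
  have := map_traceSum_add τ m x
  rw [hx] at this
  exact add_right_cancel this

theorem pow_apply_of_fixed {x : F} (hx : τ x = x) (s : ℕ) : (τ ^ s) x = x := by
  induction s with
  | zero => simp
  | succ s ih => rw [pow_succ', RingAut.mul_apply, ih, hx]

theorem normProd_of_fixed {x : F} (hx : τ x = x) : normProd τ m x = x ^ m := by
  simp [normProd, pow_apply_of_fixed hx]

theorem traceSum_mul_of_fixed {c : F} (hc : τ c = c) (x : F) :
    traceSum τ m (c * x) = c * traceSum τ m x := by
  simp only [traceSum, map_mul, pow_apply_of_fixed hc, Finset.mul_sum]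

theorem pow_apply_comm (a b : ℕ) (x : F) : (τ ^ a) ((τ ^ b) x) = (τ ^ b) ((τ ^ a) x) := by
  rw [← RingAut.mul_apply, ← RingAut.mul_apply, ← pow_add, ← pow_add, add_comm]

theorem pow_apply_map_of_fixed {x : F} (hx : (τ ^ m) x = x) : (τ ^ m) (τ x) = τ x := by
  have := pow_apply_comm (τ := τ) m 1 x
  rwa [pow_one, hx] at this

/-- The norm of a norm in a tower of cyclic groups. -/
theorem normProd_normProd (τ : RingAut F) (a b : ℕ) (x : F) :
    normProd τ a (normProd (τ ^ a) b x) = normProd τ (a * b) x := by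
  induction b with
  | zero => simp [normProd]
  | succ b ih =>
    rw [normProd_succ, normProd_mul, ih, normProd, normProd, normProd, Nat.mul_succ,
      Finset.prod_range_add]
    congr 1
    refine Finset.prod_congr rfl fun s _ => ?_
    rw [← pow_mul, ← RingAut.mul_apply, ← pow_add, add_comm]

theorem normProd_comm (τ : RingAut F) (a b c : ℕ) (x : F) :
    (τ ^ c) (normProd (τ ^ a) b x) = normProd (τ ^ a) b ((τ ^ c) x) := by
  simp only [normProd, map_prod, ← pow_mul]
  exact Finset.prod_congr rfl fun s _ => pow_apply_comm _ _ _

end NormTrace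

/-! ### Ramification in a step of prime degree -/

section PrimeStep

open Polynomial in
/-- In `ℤ[X]` one has `∑_{s < ℓ} (1 + X) ^ s = X ^ (ℓ - 1) + ℓ (1 + X r)`. -/
theorem exists_geom_sum_one_add_X {ℓ : ℕ} (hℓ : ℓ.Prime) :
    ∃ r : ℤ[X], ∑ s ∈ Finset.range ℓ, (X + 1 : ℤ[X]) ^ s =
      X ^ (ℓ - 1) + (ℓ : ℤ[X]) * (1 + X * r) := by
  obtain ⟨q, hq⟩ := exists_add_pow_prime_eq hℓ (X : ℤ[X]) 1
  have h1 := geom_sum_mul (X + 1 : ℤ[X]) ℓ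
  have hS : ∑ s ∈ Finset.range ℓ, (X + 1 : ℤ[X]) ^ s = X ^ (ℓ - 1) + (ℓ : ℤ[X]) * q := by
    refine mul_right_cancel₀ (b := (X : ℤ[X])) X_ne_zero ?_
    rw [add_sub_cancel_right] at h1
    have h2 : (X : ℤ[X]) ^ (ℓ - 1) * X = X ^ ℓ := by
      rw [← pow_succ, Nat.sub_add_cancel hℓ.one_le]
    rw [h1, hq, add_mul, h2]
    ring
  have hq0 : q.eval 0 = 1 := by
    have h3 := congrArg (Polynomial.eval 0) hS
    have h4 : (ℓ - 1) ≠ 0 := by have := hℓ.two_le; omega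
    simp [eval_finsetSum, h4] at h3
    have h5 : (ℓ : ℤ) ≠ 0 := by exact_mod_cast hℓ.ne_zero
    exact mul_left_cancel₀ h5 (by rw [← h3, mul_one])
  refine ⟨q.divX, ?_⟩
  rw [hS]
  congr 2
  conv_lhs => rw [← divX_mul_X_add q, coeff_zero_eq_eval_zero, hq0]
  simp
  ring

variable {F : Type*} [Field F]

/-- `τ` generates the Galois group of a totally ramified extension `E / E₀` of prime degree `ℓ`,
with `E = {x | τ ^ ℓ x = x}` and `E₀ = {x | τ x = x}` inside a field `F`. The valuation `w` of `F`
has value group `d ℤ` on `E` and `ℓ d ℤ` on `E₀`; `p` is a uniformizer of `E`, and `T / d` is the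
ramification jump of `E / E₀`. -/
structure PrimeStep (w : AddValuation F (WithTop ℤ)) (τ : RingAut F) (ℓ : ℕ) (d : ℤ) (p : F)
    (T ε : ℤ) : Prop where
  prime : ℓ.Prime
  map_val : ∀ x, w (τ x) = w x
  d_pos : 0 < d
  unif_fixed : (τ ^ ℓ) p = p
  unif_val : w p = d
  base_dvd : ∀ x (a : ℤ), τ x = x → w x = a → (ℓ * d : ℤ) ∣ a
  top_dvd : ∀ x (a : ℤ), (τ ^ ℓ) x = x → w x = a → d ∣ a
  residue : ∀ x, (τ ^ ℓ) x = x → ValGE w 0 x → ∃ y, τ y = y ∧ ValGE w d (x - y)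
  jump : w (τ p - p) = ((d + T : ℤ) : WithTop ℤ)
  T_pos : 0 < T
  val_ell : w (ℓ : F) = ε
  ε_pos : 0 < ε

end PrimeStep

namespace PrimeStep

variable {F : Type*} [Field F] {w : AddValuation F (WithTop ℤ)} {τ : RingAut F} {ℓ : ℕ}
  {d : ℤ} {p : F} {T ε : ℤ} (S : PrimeStep w τ ℓ d p T ε)

include S

theorem map_val_pow (s : ℕ) (x : F) : w ((τ ^ s) x) = w x := by
  induction s with
  | zero => rfl
  | succ s ih => rw [pow_succ', RingAut.mul_apply, S.map_val, ih]

theorem valGE_pow {m : ℤ} {x : F} (h : ValGE w m x) (s : ℕ) : ValGE w m ((τ ^ s) x) := by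
  rwa [ValGE, S.map_val_pow]

theorem ell_pos : (0 : ℤ) < ℓ := by exact_mod_cast S.prime.pos

theorem val_normProd {x : F} {a : ℤ} (hx : w x = a) :
    w (normProd τ ℓ x) = ((ℓ * a : ℤ) : WithTop ℤ) := by
  rw [normProd, val_prod_eq _ fun s _ => (S.map_val_pow s x).trans hx, Finset.card_range]

theorem valGE_normProd {x : F} {m : ℤ} (hx : ValGE w m x) : ValGE w (ℓ * m) (normProd τ ℓ x) := by
  by_cases h0 : x = 0
  · have : normProd τ ℓ x = 0 := by
      rw [h0, normProd]
      exact Finset.prod_eq_zero (Finset.mem_range.2 S.prime.pos) (map_zero _)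
    rw [this]
    exact valGE_zero _
  obtain ⟨a, ha⟩ := exists_val_eq w h0
  refine (valGE_of_eq (S.val_normProd ha)).mono ?_
  have := valGE_le ha hx
  have := S.ell_pos
  gcongr

/-- Up to higher order, an element of `E` is a power `p ^ b` with `b < ℓ` times an element of
`E₀`. -/
theorem exists_leading {x : F} {a : ℤ} (hx : (τ ^ ℓ) x = x) (ha : w x = a) :
    ∃ (c : F) (b : ℕ), τ c = c ∧ b < ℓ ∧ w c = ((a - b * d : ℤ) : WithTop ℤ) ∧
      ValGE w (a + d) (x - c * p ^ b) := by
  have hℓ := S.ell_pos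
  obtain ⟨m, rfl⟩ := S.top_dvd x a hx ha
  obtain ⟨b, hb⟩ := Int.eq_ofNat_of_zero_le (Int.emod_nonneg m hℓ.ne')
  have hbl := Int.emod_lt_of_pos m hℓ
  have hm := Int.emod_add_mul_ediv m ℓ
  rw [hb] at hm hbl
  set q := m / ℓ
  set P := normProd τ ℓ p with hP
  have hPv : w P = ((ℓ * d : ℤ) : WithTop ℤ) := S.val_normProd S.unif_val
  have hPf : τ P = P := map_normProd S.unif_fixed
  have hqf : τ (P ^ q) = P ^ q := by rw [map_zpow₀, hPf]
  have hqv : w (P ^ q) = ((q * (ℓ * d) : ℤ) : WithTop ℤ) := val_zpow_eq hPv q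
  have hbv : w (p ^ b) = ((b * d : ℤ) : WithTop ℤ) := val_pow_eq S.unif_val b
  have hzv := val_mul_eq hqv hbv
  have hz0 := ne_zero_of_val_eq hzv
  have hzf : (τ ^ ℓ) (P ^ q * p ^ b) = P ^ q * p ^ b := by
    rw [map_mul, pow_apply_of_fixed hqf ℓ, map_pow, S.unif_fixed]
  have huf : (τ ^ ℓ) (x / (P ^ q * p ^ b)) = x / (P ^ q * p ^ b) := by
    rw [map_div₀, hzf, hx]
  have huv : w (x / (P ^ q * p ^ b)) = ((0 : ℤ) : WithTop ℤ) := by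
    rw [val_div_eq ha hzv]
    congr 1
    rw [← hm]
    ring
  obtain ⟨y, hy, hyx⟩ := S.residue _ huf (valGE_of_eq huv)
  have hyv : w y = ((0 : ℤ) : WithTop ℤ) := val_eq_of_sub huv hyx.sub_comm S.d_pos
  refine ⟨y * P ^ q, b, by rw [map_mul, hy, hqf], by exact_mod_cast hbl, ?_, ?_⟩
  · rw [val_mul_eq hyv hqv]
    congr 1
    rw [← hm]
    ring
  · have h2 := hyx.mul (valGE_of_eq hzv)
    have h3 : (x / (P ^ q * p ^ b) - y) * (P ^ q * p ^ b) = x - y * P ^ q * p ^ b := by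
      rw [sub_mul, div_mul_cancel₀ _ hz0, mul_assoc]
    rw [h3] at h2
    refine h2.mono (le_of_eq ?_)
    rw [← hm]
    ring

/-- The unit `τ p / p - 1` generates the ideal of valuation `T`. -/
theorem val_ratio : w (τ p / p - 1) = (T : WithTop ℤ) := by
  have h0 := ne_zero_of_val_eq S.unif_val
  have : τ p / p - 1 = (τ p - p) / p := by field_simp
  rw [this, val_div_eq S.jump S.unif_val]
  congr 1
  ring

theorem sub_unif_pow (b : ℕ) : τ (p ^ b) - p ^ b =
    p ^ b * ((τ p / p - 1) * ∑ i ∈ Finset.range b, (τ p / p) ^ i) := by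
  have h0 := ne_zero_of_val_eq S.unif_val
  rw [mul_comm (τ p / p - 1), geom_sum_mul, div_pow, map_pow]
  field_simp

theorem valGE_sub_unif_pow (b : ℕ) : ValGE w (b * d + T) (τ (p ^ b) - p ^ b) := by
  rw [S.sub_unif_pow]
  refine (valGE_of_eq (val_pow_eq S.unif_val b)).mul
    ((valGE_of_eq S.val_ratio).mul_right (ValGE.sum fun i _ => ValGE.pow_zero ?_ i))
  have := (valGE_of_eq S.val_ratio).mono S.T_pos.le
  simpa using this.add valGE_one

theorem val_natCast_eq_zero {b : ℕ} (hb0 : b ≠ 0) (hb : b < ℓ) :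
    w (b : F) = ((0 : ℤ) : WithTop ℤ) := by
  refine val_eq_of_not_valGE (valGE_natCast b) fun hcon => ?_
  have hcop : Int.gcd b ℓ = 1 := by
    rw [Int.gcd_natCast_natCast]
    exact Nat.Coprime.symm ((S.prime.coprime_iff_not_dvd).2 fun h => by
      have := Nat.le_of_dvd (Nat.pos_of_ne_zero hb0) h; omega)
  have hbez := Int.gcd_eq_gcd_ab b ℓ
  rw [hcop] at hbez
  have h1 : (1 : F) = (b : F) * (Int.gcdA b ℓ : F) + (ℓ : F) * (Int.gcdB b ℓ : F) := by
    exact_mod_cast congrArg (Int.cast : ℤ → F) hbez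
  have h2 : ValGE w 1 (1 : F) := by
    rw [h1]
    exact ((hcon.mono (by omega)).mul_right (valGE_intCast _)).add
      (((valGE_of_eq S.val_ell).mono (by have := S.ε_pos; omega)).mul_right (valGE_intCast _))
  have := valGE_le (val_one_eq w) h2
  omega

/-- `τ - 1` raises the valuation on `E` by at least `T`. -/
theorem valGE_sub {x : F} {m : ℤ} (hx : (τ ^ ℓ) x = x) (h : ValGE w m x) :
    ValGE w (m + T) (τ x - x) := by
  -- Peeling off leading terms `c * p ^ b` brings the remainder to valuation at least `m + N`.
  have key : ∀ (N : ℕ) (m : ℤ) (x : F), (τ ^ ℓ) x = x → ValGE w m x →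
      ValGE w (min (m + T) (m + N)) (τ x - x) := by
    intro N
    induction N with
    | zero =>
      intro m x _ h
      have h1 : ValGE w m (τ x) := by rwa [ValGE, S.map_val]
      exact (h1.sub h).mono (by simp)
    | succ N ih =>
      intro m x hx h
      by_cases h0 : x = 0
      · rw [h0, map_zero, sub_zero]; exact valGE_zero _
      obtain ⟨a, ha⟩ := exists_val_eq w h0
      have hma := valGE_le ha h
      obtain ⟨c, b, hc, -, hcv, hr⟩ := S.exists_leading hx ha
      have hf : (τ ^ ℓ) (x - c * p ^ b) = x - c * p ^ b := by
        rw [map_sub, map_mul, pow_apply_of_fixed hc ℓ, map_pow, S.unif_fixed, hx]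
      have h1 := ih _ _ hf hr
      have h2 : ValGE w (a + T) (c * (τ (p ^ b) - p ^ b)) :=
        ((valGE_of_eq hcv).mul (S.valGE_sub_unif_pow b)).mono (by linarith)
      have h3 : τ x - x = c * (τ (p ^ b) - p ^ b) +
          (τ (x - c * p ^ b) - (x - c * p ^ b)) := by
        rw [map_sub, map_mul, hc]; ring
      rw [h3]
      have hd := S.d_pos
      refine (h2.mono ?_).add (h1.mono ?_)
      · exact (min_le_left _ _).trans (by omega)
      · push_cast
        refine le_min ((min_le_left _ _).trans (by omega)) ((min_le_right _ _).trans (by omega))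
  refine (key T.toNat m x hx h).mono ?_
  rw [Int.toNat_of_nonneg S.T_pos.le, min_self]

/-- `τ - 1` raises the valuation by exactly `T` on elements of `E` whose valuation does not occur
on `E₀`. -/
theorem val_sub {x : F} {a : ℤ} (hx : (τ ^ ℓ) x = x) (ha : w x = a) (hd : ¬ (ℓ * d : ℤ) ∣ a) :
    w (τ x - x) = ((a + T : ℤ) : WithTop ℤ) := by
  obtain ⟨c, b, hc, hb, hcv, hr⟩ := S.exists_leading hx ha
  have hb0 : b ≠ 0 := by
    rintro rfl
    exact hd (S.base_dvd c a hc (by simpa using hcv))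
  have hρ : ValGE w T (τ p / p - 1) := valGE_of_eq S.val_ratio
  -- `1 + ρ + ⋯ + ρ ^ (b - 1) ≡ b`, a unit.
  have hsum : w (∑ i ∈ Finset.range b, (τ p / p) ^ i) = ((0 : ℤ) : WithTop ℤ) := by
    have hbu := S.val_natCast_eq_zero hb0 hb
    refine val_eq_of_sub (b := T) hbu ?_ S.T_pos
    have h4 : ∑ i ∈ Finset.range b, (τ p / p) ^ i - (b : F) =
        ∑ i ∈ Finset.range b, ((τ p / p) ^ i - 1) := by
      simp
    rw [h4]
    refine ValGE.sum fun i _ => ?_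
    rw [← geom_sum_mul]
    refine ValGE.mul_left (ValGE.sum fun i _ => ValGE.pow_zero ?_ i) hρ
    simpa using (hρ.mono S.T_pos.le).add valGE_one
  have h1 : w (c * (τ (p ^ b) - p ^ b)) = ((a + T : ℤ) : WithTop ℤ) := by
    rw [S.sub_unif_pow, val_mul_eq hcv (val_mul_eq (val_pow_eq S.unif_val b)
      (val_mul_eq S.val_ratio hsum))]
    congr 1
    ring
  have hf : (τ ^ ℓ) (x - c * p ^ b) = x - c * p ^ b := by
    rw [map_sub, map_mul, pow_apply_of_fixed hc ℓ, map_pow, S.unif_fixed, hx]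
  have h3 : τ x - x = c * (τ (p ^ b) - p ^ b) +
      (τ (x - c * p ^ b) - (x - c * p ^ b)) := by
    rw [map_sub, map_mul, hc]; ring
  rw [h3]
  exact val_add_eq h1 (S.valGE_sub hf hr) (by have := S.d_pos; omega)

end PrimeStep


/-! ### The trace in a step of prime degree -/

section Difference

variable {F : Type*} [Field F]

/-- The operator `τ - 1` in the ring of `ℤ`-linear endomorphisms. -/
def diffEnd (τ : RingAut F) : Module.End ℤ F := (τ : F →+* F).toAddMonoidHom.toIntLinearMap - 1

theorem diffEnd_apply (τ : RingAut F) (x : F) : diffEnd τ x = τ x - x := rfl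

theorem diffEnd_add_one_pow (τ : RingAut F) (s : ℕ) (x : F) :
    ((diffEnd τ + 1) ^ s : Module.End ℤ F) x = (τ ^ s) x := by
  induction s with
  | zero => rfl
  | succ s ih =>
    rw [pow_succ', pow_succ', RingAut.mul_apply, Module.End.mul_apply, ih]
    change τ ((τ ^ s) x) - (τ ^ s) x + (τ ^ s) x = _
    simp

theorem fixed_diffEnd_pow {τ : RingAut F} {ℓ : ℕ} {x : F} (hx : (τ ^ ℓ) x = x) (s : ℕ) :
    (τ ^ ℓ) ((diffEnd τ ^ s : Module.End ℤ F) x) = (diffEnd τ ^ s : Module.End ℤ F) x := by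
  induction s with
  | zero => exact hx
  | succ s ih =>
    rw [pow_succ', Module.End.mul_apply, diffEnd_apply, map_sub, pow_apply_map_of_fixed ih, ih]

end Difference

namespace PrimeStep

variable {F : Type*} [Field F] {w : AddValuation F (WithTop ℤ)} {τ : RingAut F} {ℓ : ℕ}
  {d : ℤ} {p : F} {T ε : ℤ} (S : PrimeStep w τ ℓ d p T ε)

include S

theorem valGE_diffEnd_pow {x : F} {m : ℤ} (hx : (τ ^ ℓ) x = x) (h : ValGE w m x) (s : ℕ) :
    ValGE w (m + s * T) ((diffEnd τ ^ s : Module.End ℤ F) x) := by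
  induction s with
  | zero => simpa using h
  | succ s ih =>
    rw [pow_succ', Module.End.mul_apply, diffEnd_apply]
    refine (S.valGE_sub (fixed_diffEnd_pow hx s) ih).mono (le_of_eq ?_)
    push_cast
    ring

theorem val_diffEnd_pow {x : F} {a : ℤ} (hx : (τ ^ ℓ) x = x) (ha : w x = a) (s : ℕ)
    (h : ∀ i < s, ¬ (ℓ * d : ℤ) ∣ a + i * T) :
    w ((diffEnd τ ^ s : Module.End ℤ F) x) = ((a + s * T : ℤ) : WithTop ℤ) := by
  induction s with
  | zero => simpa using ha
  | succ s ih =>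
    rw [pow_succ', Module.End.mul_apply, diffEnd_apply,
      S.val_sub (fixed_diffEnd_pow hx s) (ih fun i hi => h i (by omega)) (h s (by omega))]
    congr 1
    push_cast
    ring

/-- The trace of `E / E₀` is `(τ - 1) ^ (ℓ - 1) + ℓ + ℓ (τ - 1) ρ` with an operator `ρ` that
preserves valuations. -/
theorem exists_traceSum_eq {x : F} (hx : (τ ^ ℓ) x = x) :
    ∃ y, (τ ^ ℓ) y = y ∧ (∀ m, ValGE w m x → ValGE w m y) ∧
      traceSum τ ℓ x = (diffEnd τ ^ (ℓ - 1) : Module.End ℤ F) x + ℓ * x +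
        ℓ * diffEnd τ y := by
  obtain ⟨r, hr⟩ := exists_geom_sum_one_add_X S.prime
  have h := congrArg (fun q => (Polynomial.aeval (diffEnd τ) q : Module.End ℤ F) x) hr
  have hdiff : ∀ (m : ℤ) (s : ℕ), ValGE w m x →
      ValGE w m ((diffEnd τ ^ s : Module.End ℤ F) x) := fun m s hm =>
    (S.valGE_diffEnd_pow hx hm s).mono (by have := S.T_pos; nlinarith)
  refine ⟨(Polynomial.aeval (diffEnd τ) r : Module.End ℤ F) x, ?_, ?_, ?_⟩
  · simp only [Polynomial.aeval_eq_sum_range, LinearMap.sum_apply, LinearMap.smul_apply, map_sum,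
      map_zsmul, fixed_diffEnd_pow hx]
  · intro m hm
    simp only [Polynomial.aeval_eq_sum_range, LinearMap.sum_apply, LinearMap.smul_apply]
    refine ValGE.sum fun i _ => ?_
    rw [zsmul_eq_mul]
    exact (valGE_intCast _).mul_left (hdiff m i hm)
  · simp only [map_sum, map_pow, map_add, Polynomial.aeval_X, map_one, map_mul, map_natCast,
      LinearMap.sum_apply, diffEnd_add_one_pow, LinearMap.add_apply, Module.End.mul_apply,
      Module.End.natCast_apply, Module.End.one_apply, nsmul_eq_mul] at h
    rw [traceSum, h]
    ring

/-- `0 = τ ^ ℓ - 1 = (τ - 1) ^ ℓ + ℓ (τ - 1) + ℓ (τ - 1) ^ 2 ρ` on `E`. -/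
theorem exists_diffEnd_relation {x : F} (hx : (τ ^ ℓ) x = x) :
    ∃ y, (τ ^ ℓ) y = y ∧ (∀ m, ValGE w m x → ValGE w m y) ∧
      (diffEnd τ ^ ℓ : Module.End ℤ F) x + ℓ * diffEnd τ x +
        ℓ * (diffEnd τ ^ 2 : Module.End ℤ F) y = 0 := by
  obtain ⟨y, hy, hv, h⟩ := S.exists_traceSum_eq hx
  refine ⟨y, hy, hv, ?_⟩
  have h1 := congrArg (diffEnd τ) h
  have hn : ∀ z : F, diffEnd τ (ℓ * z) = ℓ * diffEnd τ z := fun z => by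
    rw [← nsmul_eq_mul, map_nsmul, nsmul_eq_mul]
  rw [diffEnd_apply, map_traceSum hx, sub_self, map_add, map_add, hn, hn,
    ← Module.End.mul_apply, ← pow_succ', Nat.sub_add_cancel S.prime.one_le,
    ← Module.End.mul_apply, ← pow_two] at h1
  exact h1.symm

theorem dvd_ε : (ℓ * d : ℤ) ∣ ε := S.base_dvd (ℓ : F) ε (map_natCast τ ℓ) S.val_ell

/-- The ramification jump `t = T / d` of a step of degree `ℓ` is at most `e ℓ / (ℓ - 1)`. -/
theorem jump_le : (ℓ - 1) * T ≤ ε := by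
  by_contra! hlt
  obtain ⟨y, hy, hv, h⟩ := S.exists_diffEnd_relation S.unif_fixed
  have hT := S.T_pos
  have h1 : w (ℓ * diffEnd τ p) = ((ε + (d + T) : ℤ) : WithTop ℤ) :=
    val_mul_eq S.val_ell S.jump
  have h2 := S.valGE_diffEnd_pow S.unif_fixed (valGE_of_eq S.unif_val) ℓ
  have h3 := (valGE_of_eq S.val_ell).mul
    (S.valGE_diffEnd_pow hy (hv _ (valGE_of_eq S.unif_val)) 2)
  have h4 : ℓ * diffEnd τ p = -((diffEnd τ ^ ℓ : Module.End ℤ F) p +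
      ℓ * (diffEnd τ ^ 2 : Module.End ℤ F) y) := by linear_combination h
  have h5 : ValGE w (ε + (d + T) + 1) (ℓ * diffEnd τ p) := by
    rw [h4]
    exact ((h2.mono (by linarith)).add (h3.mono (by push_cast; linarith))).neg
  have := valGE_le h1 h5
  omega

theorem prime_dvd_of_dvd_mul {i : ℕ} (hi0 : 0 < i) (hi : i < ℓ) (h : (ℓ * d : ℤ) ∣ i * T) :
    (ℓ * d : ℤ) ∣ T := by
  obtain ⟨t, rfl⟩ : d ∣ T := by
    have := S.top_dvd (τ p / p - 1) T ?_ S.val_ratio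
    · exact this
    · rw [map_sub, map_div₀, pow_apply_map_of_fixed S.unif_fixed, S.unif_fixed, map_one]
  have hd := S.d_pos
  rw [mul_comm (ℓ : ℤ), mul_left_comm] at h
  have h1 := (mul_dvd_mul_iff_left hd.ne').1 h
  rw [mul_comm (ℓ : ℤ)]
  refine mul_dvd_mul_left d (((Nat.prime_iff_prime_int.1 S.prime).dvd_mul.1 h1).resolve_left ?_)
  intro h2
  have := Nat.le_of_dvd hi0 (Int.natCast_dvd_natCast.1 h2)
  omega

/-- If `ℓ` divides the jump, the jump has its largest possible value. -/
theorem jump_eq_of_dvd (hdvd : (ℓ * d : ℤ) ∣ T) : (ℓ - 1) * T = ε := by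
  refine le_antisymm S.jump_le ?_
  by_contra! hlt
  obtain ⟨y, hy, hv, h⟩ := S.exists_diffEnd_relation S.unif_fixed
  have hT := S.T_pos
  have hd := S.d_pos
  have h1 : ValGE w (ε + (d + T)) (ℓ * diffEnd τ p) := valGE_of_eq
    (val_mul_eq S.val_ell S.jump)
  have h2 := S.val_diffEnd_pow S.unif_fixed S.unif_val ℓ fun i _ hi => by
    have h3 : (ℓ * d : ℤ) ∣ d := (Int.dvd_add_left (hdvd.mul_left _)).1 hi
    have h4 := Int.le_of_dvd hd h3
    have h5 : (2 : ℤ) ≤ ℓ := by exact_mod_cast S.prime.two_le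
    nlinarith
  have h3 := (valGE_of_eq S.val_ell).mul
    (S.valGE_diffEnd_pow hy (hv _ (valGE_of_eq S.unif_val)) 2)
  have h4 : (diffEnd τ ^ ℓ : Module.End ℤ F) p = -(ℓ * diffEnd τ p +
      ℓ * (diffEnd τ ^ 2 : Module.End ℤ F) y) := by linear_combination h
  have h5 : ValGE w (d + ℓ * T + 1) ((diffEnd τ ^ ℓ : Module.End ℤ F) p) := by
    rw [h4]
    exact ((h1.mono (by linarith)).add (h3.mono (by push_cast; linarith))).neg
  have := valGE_le h2 h5
  omega

/-- The trace of `E / E₀` raises valuations by at least `(ℓ - 1) T`. -/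
theorem valGE_traceSum {x : F} {m : ℤ} (hx : (τ ^ ℓ) x = x) (h : ValGE w m x) :
    ValGE w (m + (ℓ - 1) * T) (traceSum τ ℓ x) := by
  obtain ⟨y, hy, hv, heq⟩ := S.exists_traceSum_eq hx
  have hle := S.jump_le
  have hT := S.T_pos
  have h1 := S.valGE_diffEnd_pow hx h (ℓ - 1)
  have h2 := (valGE_of_eq S.val_ell).mul h
  have h3 := (valGE_of_eq S.val_ell).mul (S.valGE_sub hy (hv _ h))
  rw [Nat.cast_sub S.prime.one_le, Nat.cast_one] at h1
  rw [heq]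
  exact (h1.add (h2.mono (by linarith))).add (h3.mono (by linarith))

/-- The trace raises the valuation of an element by exactly `(ℓ - 1) T` if this gives a
valuation that occurs on `E₀`. -/
theorem val_traceSum {x : F} {a : ℤ} (hx : (τ ^ ℓ) x = x) (ha : w x = a)
    (hdvd : (ℓ * d : ℤ) ∣ a - T) :
    w (traceSum τ ℓ x) = ((a + (ℓ - 1) * T : ℤ) : WithTop ℤ) := by
  obtain ⟨y, hy, hv, heq⟩ := S.exists_traceSum_eq hx
  have hT := S.T_pos
  have hd := S.d_pos
  have hva := valGE_of_eq ha
  have h3 := (valGE_of_eq S.val_ell).mul (S.valGE_sub hy (hv _ hva))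
  by_cases hdT : (ℓ * d : ℤ) ∣ T
  · -- Here `a` is divisible by `ℓ d`, and `ℓ x` is the leading term of the trace.
    have hε := S.jump_eq_of_dvd hdT
    have h1 : ValGE w (a + d + (ℓ - 1) * T) ((diffEnd τ ^ (ℓ - 1) : Module.End ℤ F) x) := by
      obtain ⟨c, b, hc, hb, hcv, hr⟩ := S.exists_leading hx ha
      have hb0 : b = 0 := by
        have h4 := S.base_dvd c _ hc hcv
        have h5 : (ℓ * d : ℤ) ∣ a := (dvd_iff_dvd_of_dvd_sub hdvd).2 hdT
        have h6 : (ℓ * d : ℤ) ∣ b * d := (dvd_sub_right h5).1 h4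
        have h7 : (ℓ : ℤ) ∣ b := (mul_dvd_mul_iff_right hd.ne').1 h6
        exact Nat.eq_zero_of_dvd_of_lt (Int.natCast_dvd_natCast.1 h7) hb
      subst hb0
      rw [pow_zero, mul_one] at hr
      have hf : (τ ^ ℓ) (x - c) = x - c := by rw [map_sub, hx, pow_apply_of_fixed hc]
      have h8 := S.valGE_diffEnd_pow hf hr (ℓ - 1)
      have h9 : ((diffEnd τ ^ (ℓ - 1) : Module.End ℤ F) (x - c)) =
          (diffEnd τ ^ (ℓ - 1) : Module.End ℤ F) x := by
        have h10 : ℓ - 1 = (ℓ - 2) + 1 := by have := S.prime.two_le; omega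
        have h11 : diffEnd τ (x - c) = diffEnd τ x := by
          rw [diffEnd_apply, diffEnd_apply, map_sub, hc, sub_sub_sub_cancel_right]
        rw [h10, pow_succ, Module.End.mul_apply, Module.End.mul_apply, h11]
      rw [h9, Nat.cast_sub S.prime.one_le, Nat.cast_one] at h8
      exact h8
    have h2 := val_mul_eq S.val_ell ha
    rw [← diffEnd_apply] at h3
    have h4 : traceSum τ ℓ x = ℓ * x + ((diffEnd τ ^ (ℓ - 1) : Module.End ℤ F) x +
        ℓ * diffEnd τ y) := by rw [heq]; ring
    rw [h4, val_add_eq h2 ((h1.mono (k := ε + a + 1) (by linarith)).add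
      (h3.mono (by linarith))) (by omega), ← hε]
    congr 1
    ring
  · -- Otherwise no `a + i T` with `i < ℓ - 1` occurs on `E₀`, and `(τ - 1) ^ (ℓ - 1) x` is the
    -- leading term.
    have hlt : (ℓ - 1) * T < ε := by
      refine lt_of_le_of_ne S.jump_le fun hcon => hdT ?_
      have h5 := S.dvd_ε
      rw [← hcon] at h5
      refine S.prime_dvd_of_dvd_mul (i := ℓ - 1) (by have := S.prime.two_le; omega)
        (by have := S.prime.two_le; omega) ?_
      rwa [Nat.cast_sub S.prime.one_le, Nat.cast_one]
    have h1 := S.val_diffEnd_pow hx ha (ℓ - 1) fun i hi hcon => hdT <|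
      S.prime_dvd_of_dvd_mul (i := i + 1) (by omega) (by omega) <| by
        have h6 : a + i * T = (a - T) + ((i + 1 : ℕ) : ℤ) * T := by push_cast; ring
        rw [h6] at hcon
        exact (dvd_add_right hdvd).1 hcon
    rw [Nat.cast_sub S.prime.one_le, Nat.cast_one] at h1
    have h2 := (valGE_of_eq S.val_ell).mul hva
    rw [heq, add_assoc]
    exact val_add_eq h1 ((h2.mono (k := a + (ℓ - 1) * T + 1) (by linarith)).add
      (h3.mono (by linarith))) (by omega)

/-- On the ideals of level congruent to the jump, the trace is surjective. -/
theorem exists_traceSum_eq_of_valGE {y : F} {a : ℤ} (hda : d ∣ a) (hdvd : (ℓ * d : ℤ) ∣ a - T)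
    (hy : τ y = y) (hyv : ValGE w (a + (ℓ - 1) * T) y) :
    ∃ x, (τ ^ ℓ) x = x ∧ ValGE w a x ∧ traceSum τ ℓ x = y := by
  obtain ⟨m, rfl⟩ := hda
  have hx0f : (τ ^ ℓ) (p ^ m) = p ^ m := by rw [map_zpow₀, S.unif_fixed]
  have hx0v : w (p ^ m) = ((d * m : ℤ) : WithTop ℤ) := by
    rw [val_zpow_eq S.unif_val, mul_comm]
  have ht := S.val_traceSum hx0f hx0v hdvd
  have htf := map_traceSum hx0f
  have hc : τ (y / traceSum τ ℓ (p ^ m)) = y / traceSum τ ℓ (p ^ m) := by rw [map_div₀, hy, htf]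
  refine ⟨y / traceSum τ ℓ (p ^ m) * p ^ m, ?_, ?_, ?_⟩
  · rw [map_mul, hx0f, pow_apply_of_fixed hc]
  · have := hyv.div ht
    rw [sub_self] at this
    exact this.mul_left (valGE_of_eq hx0v)
  · rw [traceSum_mul_of_fixed hc, div_mul_cancel₀ _ (ne_zero_of_val_eq ht)]

end PrimeStep


/-! ### The norm in a step of prime degree -/

section NormPoly

open Polynomial

variable {F : Type*} [Field F] {w : AddValuation F (WithTop ℤ)}

theorem valGE_coeff_mul {m : ℤ} {f g : F[X]} (hf : ∀ i : ℕ, ValGE w (i * m) (f.coeff i))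
    (hg : ∀ i : ℕ, ValGE w (i * m) (g.coeff i)) (i : ℕ) : ValGE w (i * m) ((f * g).coeff i) := by
  rw [coeff_mul]
  refine ValGE.sum fun ij hij => ?_
  rw [Finset.HasAntidiagonal.mem_antidiagonal] at hij
  convert (hf ij.1).mul (hg ij.2) using 1
  rw [← hij]
  push_cast
  ring

theorem valGE_coeff_one_add_C_mul_X {m : ℤ} {a : F} (ha : ValGE w m a) (i : ℕ) :
    ValGE w (i * m) ((1 + C a * X : F[X]).coeff i) := by
  rcases i with _ | _ | i
  · simpa using valGE_one
  · simpa [coeff_one] using ha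
  · simpa [coeff_one, coeff_X] using valGE_zero _

theorem one_add_C_mul_X_ne_zero (a : F) : (1 + C a * X : F[X]) ≠ 0 := fun h => by
  simpa using congrArg (Polynomial.eval 0) h

end NormPoly

namespace PrimeStep

variable {F : Type*} [Field F] {w : AddValuation F (WithTop ℤ)} {τ : RingAut F} {ℓ : ℕ}
  {d : ℤ} {p : F} {T ε : ℤ} (S : PrimeStep w τ ℓ d p T ε)

include S

open Polynomial in
/-- The norm of `1 + x` is `1 + Tr x + N x` up to traces of elements of valuation at least twice
that of `x`: with `P = ∏ (1 + τ ^ s x X)`, the identity `P' = Tr (x P / (1 + x X))` exhibits `i`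
times the `i`-th coefficient of `P` as a trace. -/
theorem exists_normProd_one_add {x : F} {m : ℤ} (hm : 0 ≤ m) (hx : (τ ^ ℓ) x = x)
    (h : ValGE w m x) :
    ∃ r, ValGE w (2 * m + (ℓ - 1) * T) r ∧
      normProd τ ℓ (1 + x) = 1 + traceSum τ ℓ x + normProd τ ℓ x + r := by
  set f : ℕ → F[X] := fun s => 1 + C ((τ ^ s) x) * X with hf
  have hfne : ∀ s, f s ≠ 0 := fun s => one_add_C_mul_X_ne_zero _
  set P : F[X] := ∏ s ∈ Finset.range ℓ, f s with hP
  set Q : F[X] := ∏ s ∈ Finset.range (ℓ - 1), f (s + 1) with hQ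
  have hf0 : f ℓ = f 0 := by simp only [hf, hx, pow_zero, RingAut.one_apply]
  have hℓ1 : ℓ - 1 + 1 = ℓ := Nat.sub_add_cancel S.prime.one_le
  have hPQ : P = f 0 * Q := by
    rw [hP, ← hℓ1, Finset.prod_range_succ', mul_comm]
  have hmapf : ∀ s r, (f s).map ((τ ^ r : RingAut F) : F →+* F) = f (s + r) := by
    intro s r
    simp only [hf, Polynomial.map_add, Polynomial.map_one, Polynomial.map_mul, map_C, map_X]
    rw [add_comm s, pow_add, RingAut.mul_apply]
    rfl
  have hmapP1 : P.map ((τ ^ 1 : RingAut F) : F →+* F) = P := by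
    refine mul_right_cancel₀ (hfne 0) ?_
    rw [hP, Polynomial.map_prod]
    simp only [hmapf]
    rw [← Finset.prod_range_succ' f, Finset.prod_range_succ, hf0]
  have hmapP : ∀ r, P.map ((τ ^ r : RingAut F) : F →+* F) = P := by
    intro r
    induction r with
    | zero => exact Polynomial.map_id
    | succ r ih =>
      have : ((τ ^ (r + 1) : RingAut F) : F →+* F) =
          ((τ ^ r : RingAut F) : F →+* F).comp ((τ ^ 1 : RingAut F) : F →+* F) := by
        rw [pow_add]; rfl
      rw [this, ← Polynomial.map_map, hmapP1, ih]
  have hPQr : ∀ r, P = f r * Q.map ((τ ^ r : RingAut F) : F →+* F) := by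
    intro r
    conv_lhs => rw [← hmapP r, hPQ, Polynomial.map_mul, hmapf, zero_add]
  have hQfix : Q.map ((τ ^ ℓ : RingAut F) : F →+* F) = Q := by
    refine mul_left_cancel₀ (hfne 0) ?_
    rw [← hPQ, ← hf0, ← hPQr]
  have hQv : ∀ i : ℕ, ValGE w (i * m) (Q.coeff i) := by
    refine Finset.prod_induction (fun s => f (s + 1)) (fun q : F[X] => ∀ i : ℕ,
      ValGE w (i * m) (q.coeff i)) (fun _ _ => valGE_coeff_mul) ?_ ?_
    · intro i
      rcases i with _ | i
      · simpa using valGE_one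
      · simpa [coeff_one] using valGE_zero _
    · intro s _ i
      exact valGE_coeff_one_add_C_mul_X (S.valGE_pow h (s + 1)) i
  -- `i` times the `i`-th coefficient of `P` is a trace.
  have hcoeff : ∀ i : ℕ, P.coeff (i + 1) * ((i : F) + 1) = traceSum τ ℓ (x * Q.coeff i) := by
    intro i
    rw [← coeff_derivative, hP, derivative_prod_finset, finsetSum_coeff, traceSum]
    refine Finset.sum_congr rfl fun s hs => ?_
    have h1 : ∏ j ∈ (Finset.range ℓ).erase s, f j =
        Q.map ((τ ^ s : RingAut F) : F →+* F) := by
      refine mul_left_cancel₀ (hfne s) ?_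
      rw [Finset.mul_prod_erase _ _ hs, ← hPQr]
    have h2 : derivative (f s) = C ((τ ^ s) x) := by simp [hf]
    rw [h1, h2, coeff_mul_C, coeff_map, map_mul, mul_comm]
    rfl
  have hQE : ∀ i, (τ ^ ℓ) (x * Q.coeff i) = x * Q.coeff i := by
    intro i
    rw [map_mul, hx]
    congr 1
    conv_rhs => rw [← hQfix, coeff_map]
    rfl
  have hPv : ∀ i : ℕ, i + 3 ≤ ℓ → ValGE w (2 * m + (ℓ - 1) * T) (P.coeff (i + 2)) := by
    intro i hi
    have h1 := S.valGE_traceSum (hQE (i + 1)) (h.mul (hQv (i + 1)))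
    rw [← hcoeff] at h1
    have hne : ((i + 2 : ℕ) : F) = ((i + 1 : ℕ) : F) + 1 := by push_cast; ring
    have h2 := S.val_natCast_eq_zero (b := i + 2) (by omega) (by omega)
    rw [← hne] at h1
    have h3 := h1.div h2
    rw [mul_div_cancel_right₀ _ (ne_zero_of_val_eq h2)] at h3
    refine h3.mono ?_
    push_cast
    nlinarith
  have hdeg : ∀ s ∈ Finset.range ℓ, (f s).natDegree ≤ 1 := by
    intro s _
    refine (natDegree_add_le _ _).trans ?_
    simpa using (natDegree_C_mul_le _ _).trans natDegree_X_le
  have hPdeg : P.natDegree < ℓ + 1 := by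
    refine Nat.lt_succ_of_le ((natDegree_prod_le _ _).trans ((Finset.sum_le_sum hdeg).trans ?_))
    simp
  have heval : P.eval 1 = normProd τ ℓ (1 + x) := by
    simp [hP, hf, eval_prod, normProd]
  have hPℓ : P.coeff ℓ = normProd τ ℓ x := by
    have h1 := coeff_prod_of_natDegree_le (s := Finset.range ℓ) f 1 hdeg
    rw [Finset.card_range, mul_one] at h1
    rw [hP, h1, normProd]
    refine Finset.prod_congr rfl fun s _ => ?_
    simp [hf, coeff_one]
  have hP0 : P.coeff 0 = 1 := by
    simp [hP, coeff_zero_prod, hf]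
  have hQ0 : Q.coeff 0 = 1 := by
    simp [hQ, coeff_zero_prod, hf]
  have hP1 : P.coeff 1 = traceSum τ ℓ x := by
    have := hcoeff 0
    simpa [hQ0] using this
  refine ⟨∑ i ∈ Finset.range (ℓ - 2), P.coeff (i + 2), ValGE.sum fun i hi => hPv i ?_, ?_⟩
  · have := Finset.mem_range.1 hi
    omega
  · rw [← heval, eval_eq_sum_range' hPdeg, Finset.sum_range_succ]
    have h2 : Finset.range ℓ = Finset.range (ℓ - 2 + 1 + 1) := by
      congr 1
      have := S.prime.two_le
      omega
    rw [h2, Finset.sum_range_succ', Finset.sum_range_succ']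
    simp only [one_pow, mul_one, zero_add, hP0, hP1, hPℓ]
    ring

/-- If `U^m` denotes the units congruent to `1` at level `m`, the norm maps `U^{λ(m)}` of `E` to
`U^{ℓ m}` of `E₀`, where `λ` is the function `stepPsi ℓ T`, the inverse of Herbrand's function of
`E / E₀` up to the normalization of valuations. -/
def _root_.Ramification.stepPsi (ℓ : ℕ) (T m : ℤ) : ℤ := max m (T + ℓ * (m - T))

omit S in
theorem _root_.Ramification.stepPsi_of_le {ℓ : ℕ} (hℓ : ℓ.Prime) {T m : ℤ} (h : m ≤ T) :
    stepPsi ℓ T m = m := by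
  have : (2 : ℤ) ≤ ℓ := by exact_mod_cast hℓ.two_le
  exact max_eq_left (by nlinarith)

omit S in
theorem _root_.Ramification.stepPsi_of_ge {ℓ : ℕ} (hℓ : ℓ.Prime) {T m : ℤ} (h : T ≤ m) :
    stepPsi ℓ T m = T + ℓ * (m - T) := by
  have : (2 : ℤ) ≤ ℓ := by exact_mod_cast hℓ.two_le
  exact max_eq_right (by nlinarith)

theorem valGE_normProd_sub_one {x : F} {k c : ℤ} (hk : 0 ≤ k) (hx : (τ ^ ℓ) x = x)
    (h : ValGE w k (x - 1)) (h1 : c ≤ k + (ℓ - 1) * T) (h2 : c ≤ ℓ * k) :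
    ValGE w c (normProd τ ℓ x - 1) := by
  have hf : (τ ^ ℓ) (x - 1) = x - 1 := by rw [map_sub, hx, map_one]
  obtain ⟨r, hr, heq⟩ := S.exists_normProd_one_add hk hf h
  rw [add_sub_cancel] at heq
  have h3 := S.valGE_traceSum hf h
  have h4 := S.valGE_normProd h
  have h5 : normProd τ ℓ x - 1 = traceSum τ ℓ (x - 1) + normProd τ ℓ (x - 1) + r := by
    rw [heq]; ring
  rw [h5]
  exact ((h3.mono h1).add (h4.mono h2)).add (hr.mono (by linarith))

theorem valGE_normProd_of_stepPsi_add_one {x : F} {m : ℤ} (hm : 0 ≤ m) (hx : (τ ^ ℓ) x = x)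
    (h : ValGE w (stepPsi ℓ T m + 1) (x - 1)) : ValGE w (ℓ * m + 1) (normProd τ ℓ x - 1) := by
  have hℓ : (2 : ℤ) ≤ ℓ := by exact_mod_cast S.prime.two_le
  rcases lt_or_ge m T with hmT | hmT
  · rw [stepPsi_of_le S.prime hmT.le] at h
    exact S.valGE_normProd_sub_one (by omega) hx h (by nlinarith) (by nlinarith)
  · rw [stepPsi_of_ge S.prime hmT] at h
    have := S.T_pos
    have hle : m ≤ T + ℓ * (m - T) := by nlinarith
    exact S.valGE_normProd_sub_one (by nlinarith) hx h (by linarith) (by nlinarith)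

/-- Below the jump the norm multiplies the level of a unit by exactly `ℓ`. -/
theorem val_normProd_sub_one {x : F} {a : ℤ} (hx : (τ ^ ℓ) x = x) (ha : w (x - 1) = a)
    (ha0 : 0 < a) (haT : a < T) : w (normProd τ ℓ x - 1) = ((ℓ * a : ℤ) : WithTop ℤ) := by
  have hℓ : (2 : ℤ) ≤ ℓ := by exact_mod_cast S.prime.two_le
  have hf : (τ ^ ℓ) (x - 1) = x - 1 := by rw [map_sub, hx, map_one]
  obtain ⟨r, hr, heq⟩ := S.exists_normProd_one_add ha0.le hf (valGE_of_eq ha)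
  rw [add_sub_cancel] at heq
  have h3 := S.valGE_traceSum hf (valGE_of_eq ha)
  have h5 : normProd τ ℓ x - 1 = normProd τ ℓ (x - 1) + (traceSum τ ℓ (x - 1) + r) := by
    rw [heq]; ring
  rw [h5]
  exact val_add_eq (S.val_normProd ha) ((h3.mono (k := ℓ * a + 1) (by nlinarith)).add
    (hr.mono (by nlinarith))) (by omega)

/-- Away from the jump, every unit of `E₀` of level `ℓ m` is the norm of a unit of level
`stepPsi ℓ T m` up to higher order. -/
theorem exists_normProd_approx
    (hperf : ∀ x, τ x = x → ValGE w 0 x → ∃ y, τ y = y ∧ ValGE w 1 (x - y ^ ℓ))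
    {y : F} {m : ℤ} (hm : 0 < m) (hdm : d ∣ m) (hmT : m ≠ T) (hdT : d ∣ T) (hy : τ y = y)
    (h : ValGE w (ℓ * m) (y - 1)) :
    ∃ x, (τ ^ ℓ) x = x ∧ ValGE w (stepPsi ℓ T m) (x - 1) ∧
      ValGE w (ℓ * m + 1) (normProd τ ℓ x - y) := by
  have hℓ : (2 : ℤ) ≤ ℓ := by exact_mod_cast S.prime.two_le
  have hT := S.T_pos
  rcases lt_or_gt_of_ne hmT with hlt | hgt
  · -- Below the jump, `N (1 + a p ^ k) ≡ 1 + a ^ ℓ (N p) ^ k`, and the residue field is perfect.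
    rw [stepPsi_of_le S.prime hlt.le]
    obtain ⟨k, rfl⟩ := hdm
    have hk : 0 < k := pos_of_mul_pos_right hm S.d_pos.le
    lift k to ℕ using hk.le
    have hPv := val_pow_eq (S.val_normProd S.unif_val) k
    have hPf : τ (normProd τ ℓ p ^ k) = normProd τ ℓ p ^ k := by
      rw [map_pow, map_normProd S.unif_fixed]
    have hP0 := ne_zero_of_val_eq hPv
    have hbf : τ ((y - 1) / normProd τ ℓ p ^ k) = (y - 1) / normProd τ ℓ p ^ k := by
      rw [map_div₀, hPf, map_sub, hy, map_one]
    have hbv : ValGE w 0 ((y - 1) / normProd τ ℓ p ^ k) :=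
      (h.div hPv).mono (le_of_eq (by ring))
    obtain ⟨a, haf, hav⟩ := hperf _ hbf hbv
    have haE := pow_apply_of_fixed haf ℓ
    have ha0 : ValGE w 0 a := by
      by_cases h0 : a = 0
      · rw [h0]; exact valGE_zero _
      obtain ⟨α, hα⟩ := exists_val_eq w h0
      have h1 : ValGE w 0 (a ^ ℓ) := by
        simpa using hbv.sub (hav.mono zero_le_one)
      have h2 := valGE_le (val_pow_eq hα ℓ) h1
      exact (valGE_of_eq hα).mono (by nlinarith)
    have hxf : (τ ^ ℓ) (a * p ^ k) = a * p ^ k := by rw [map_mul, haE, map_pow, S.unif_fixed]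
    have hxv : ValGE w (d * k) (a * p ^ k) :=
      (ha0.mul_left (valGE_of_eq (val_pow_eq S.unif_val k))).mono (le_of_eq (by ring))
    obtain ⟨r, hr, heq⟩ := S.exists_normProd_one_add hm.le hxf hxv
    refine ⟨1 + a * p ^ k, by rw [map_add, hxf, map_one], by simpa using hxv, ?_⟩
    have hN : normProd τ ℓ (a * p ^ k) = a ^ ℓ * normProd τ ℓ p ^ k := by
      rw [normProd_mul, normProd_of_fixed haf]
      congr 1
      simp only [normProd, map_pow, Finset.prod_pow]
    have h3 : normProd τ ℓ (1 + a * p ^ k) - y = traceSum τ ℓ (a * p ^ k) -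
        ((y - 1) / normProd τ ℓ p ^ k - a ^ ℓ) * normProd τ ℓ p ^ k + r := by
      rw [heq, hN, sub_mul, div_mul_cancel₀ _ hP0]
      ring
    rw [h3]
    have h4 := S.valGE_traceSum hxf hxv
    refine ((h4.mono (by nlinarith)).sub ((hav.mul (valGE_of_eq hPv)).mono (le_of_eq ?_))).add
      (hr.mono (by nlinarith))
    ring
  · -- Above the jump, `N (1 + x) ≡ 1 + Tr x`, and the trace is surjective at this level.
    rw [stepPsi_of_ge S.prime hgt.le]
    have hyf : τ (y - 1) = y - 1 := by rw [map_sub, hy, map_one]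
    obtain ⟨x, hxf, hxv, hxt⟩ := S.exists_traceSum_eq_of_valGE (a := T + ℓ * (m - T)) (y := y - 1)
      (dvd_add hdT ((dvd_sub hdm hdT).mul_left _))
      (by rw [add_sub_cancel_left]; exact mul_dvd_mul_left _ (dvd_sub hdm hdT)) hyf
      (h.mono (le_of_eq (by ring)))
    obtain ⟨r, hr, heq⟩ := S.exists_normProd_one_add (by nlinarith) hxf hxv
    refine ⟨1 + x, by rw [map_add, hxf, map_one], by simpa using hxv, ?_⟩
    have hle : m + 1 ≤ T + ℓ * (m - T) := by nlinarith
    have h3 : normProd τ ℓ (1 + x) - y = normProd τ ℓ x + r := by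
      rw [heq, hxt]
      ring
    rw [h3]
    exact ((S.valGE_normProd hxv).mono (by nlinarith)).add (hr.mono (by nlinarith))

end PrimeStep


/-! ### Principal units -/

section Units

variable {F : Type*} [Field F] {w : AddValuation F (WithTop ℤ)}

theorem valGE_of_sub_one {k : ℤ} {x : F} (hk : 0 ≤ k) (hx : ValGE w k (x - 1)) : ValGE w 0 x := by
  simpa using (hx.mono hk).add valGE_one

theorem val_eq_zero_of_sub_one {k : ℤ} {x : F} (hk : 0 < k) (hx : ValGE w k (x - 1)) :
    w x = ((0 : ℤ) : WithTop ℤ) :=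
  val_eq_of_sub (val_one_eq w) hx hk

theorem valGE_mul_sub_one {k : ℤ} {x y : F} (hk : 0 ≤ k) (hx : ValGE w k (x - 1))
    (hy : ValGE w k (y - 1)) : ValGE w k (x * y - 1) := by
  have : x * y - 1 = x * (y - 1) + (x - 1) := by ring
  rw [this]
  exact ((valGE_of_sub_one hk hx).mul_left hy).add hx

theorem valGE_pow_sub_one {k : ℤ} {x : F} (hk : 0 ≤ k) (hx : ValGE w k (x - 1)) (n : ℕ) :
    ValGE w k (x ^ n - 1) := by
  induction n with
  | zero => simpa using valGE_zero k
  | succ n ih => rw [pow_succ]; exact valGE_mul_sub_one hk ih hx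

theorem valGE_inv_sub_one {k : ℤ} {x : F} (hk : 0 < k) (hx : ValGE w k (x - 1)) :
    ValGE w k (x⁻¹ - 1) := by
  have hv := val_eq_zero_of_sub_one hk hx
  have h0 := ne_zero_of_val_eq hv
  have : x⁻¹ - 1 = (1 - x) / x := by field_simp
  rw [this]
  simpa using hx.sub_comm.div hv

theorem valGE_zpow_sub_one {k : ℤ} {x : F} (hk : 0 < k) (hx : ValGE w k (x - 1)) (n : ℤ) :
    ValGE w k (x ^ n - 1) := by
  obtain ⟨n, rfl | rfl⟩ := n.eq_nat_or_neg
  · simpa using valGE_pow_sub_one hk.le hx n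
  · simpa using valGE_inv_sub_one hk (valGE_pow_sub_one hk.le hx n)

theorem valGE_div_sub_one {k : ℤ} {x y : F} (hk : 0 < k) (hx : ValGE w k (x - 1))
    (hy : ValGE w k (y - 1)) : ValGE w k (x / y - 1) := by
  rw [div_eq_mul_inv]
  exact valGE_mul_sub_one hk.le hx (valGE_inv_sub_one hk hy)

theorem valGE_prod_sub_one {ι : Type*} {s : Finset ι} {f : ι → F} {k : ℤ} (hk : 0 ≤ k)
    (h : ∀ i ∈ s, ValGE w k (f i - 1)) : ValGE w k (∏ i ∈ s, f i - 1) :=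
  Finset.prod_induction f (fun x => ValGE w k (x - 1)) (fun _ _ => valGE_mul_sub_one hk)
    (by simpa using valGE_zero k) h

theorem valGE_sub_of_div {k a : ℤ} {x y : F} (hy : w y = a) (h : ValGE w k (x / y - 1)) :
    ValGE w (k + a) (x - y) := by
  have h0 := ne_zero_of_val_eq hy
  have : x - y = (x / y - 1) * y := by field_simp
  rw [this]
  exact h.mul (valGE_of_eq hy)

theorem valGE_div_sub_one_of_sub {k a : ℤ} {x y : F} (hy : w y = a) (h : ValGE w k (x - y)) :
    ValGE w (k - a) (x / y - 1) := by
  have h0 := ne_zero_of_val_eq hy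
  have : x / y - 1 = (x - y) / y := by field_simp
  rw [this]
  exact h.div hy

open Polynomial in
/-- `(1 + z) ^ ℓ = 1 + z ^ ℓ + ℓ z (1 + z r)` with `r` integral if `z` is. -/
theorem exists_one_add_pow_prime {ℓ : ℕ} (hℓ : ℓ.Prime) {z : F} (hz : ValGE w 0 z) :
    ∃ r, ValGE w 0 r ∧ (1 + z) ^ ℓ = 1 + z ^ ℓ + ℓ * z * (1 + z * r) := by
  obtain ⟨r, hr⟩ := exists_geom_sum_one_add_X hℓ
  have h1 := geom_sum_mul (X + 1 : ℤ[X]) ℓ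
  rw [hr] at h1
  have h2 := congrArg (Polynomial.aeval z) h1
  simp only [map_mul, map_add, map_pow, aeval_X, map_one, map_sub, map_natCast,
    add_sub_cancel_right] at h2
  refine ⟨Polynomial.aeval z r, ?_, ?_⟩
  · rw [aeval_eq_sum_range]
    refine ValGE.sum fun i _ => ?_
    rw [zsmul_eq_mul]
    exact (valGE_intCast _).mul_left (hz.pow_zero i)
  · have h3 : z ^ (ℓ - 1) * z = z ^ ℓ := by rw [← pow_succ, Nat.sub_add_cancel hℓ.one_le]
    rw [add_comm 1 z, ← h3]
    linear_combination -h2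

theorem valGE_one_of_pow {ℓ : ℕ} {z : F} (h : ValGE w 1 (z ^ ℓ)) : ValGE w 1 z := by
  by_cases h0 : z = 0
  · rw [h0]; exact valGE_zero _
  obtain ⟨a, ha⟩ := exists_val_eq w h0
  have h1 := valGE_le (val_pow_eq ha ℓ) h
  refine (valGE_of_eq ha).mono ?_
  by_contra! hcon
  have : (0 : ℤ) ≤ ℓ := by positivity
  nlinarith

/-- Frobenius is injective on the residue field. -/
theorem valGE_sub_one_of_pow_prime {ℓ : ℕ} (hℓ : ℓ.Prime) (hv : ValGE w 1 (ℓ : F)) {y : F}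
    (hy : ValGE w 0 y) (h : ValGE w 1 (y ^ ℓ - 1)) : ValGE w 1 (y - 1) := by
  have hz : ValGE w 0 (y - 1) := hy.sub valGE_one
  obtain ⟨r, hr, heq⟩ := exists_one_add_pow_prime hℓ hz
  rw [add_sub_cancel] at heq
  refine valGE_one_of_pow (ℓ := ℓ) ?_
  have : (y - 1) ^ ℓ = (y ^ ℓ - 1) - ℓ * ((y - 1) * (1 + (y - 1) * r)) := by
    rw [heq]; ring
  rw [this]
  exact h.sub (hv.mul_right (hz.mul_right (valGE_one.add (hz.mul_right hr))))

theorem valGE_sub_one_of_pow_prime_pow {ℓ : ℕ} (hℓ : ℓ.Prime) (hv : ValGE w 1 (ℓ : F)) (n : ℕ)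
    {y : F} (hy : ValGE w 0 y) (h : ValGE w 1 (y ^ ℓ ^ n - 1)) : ValGE w 1 (y - 1) := by
  induction n with
  | zero => simpa using h
  | succ n ih =>
    rw [pow_succ, pow_mul] at h
    exact ih (valGE_sub_one_of_pow_prime hℓ hv (hy.pow_zero _) h)

theorem normProd_ratio (τ : RingAut F) (m : ℕ) {x : F} (hx : x ≠ 0) :
    normProd τ m (τ x / x) = (τ ^ m) x / x := by
  have h1 := normProd_ne_zero τ m hx
  have h2 : normProd τ m (τ x) = τ (normProd τ m x) := by
    have := normProd_comm τ 1 m 1 x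
    simpa using this.symm
  rw [normProd_div, h2, div_eq_div_iff h1 hx, map_normProd_mul, mul_comm]

end Units

/-! ### Totally ramified cyclic towers -/

/-- `F` is a totally ramified cyclic extension of degree `ℓ ^ n` of the field of invariants
of `σ`, whose absolute ramification index is `e`. The valuation `w` is normalized on `F`, and `ϖ`
is a uniformizer of `F`. The field of invariants of `σ ^ (ℓ ^ j)` is the layer of degree `ℓ ^ j`
of the tower. -/
structure CyclicTower {F : Type*} [Field F] (w : AddValuation F (WithTop ℤ)) (σ : RingAut F)
    (ℓ n : ℕ) (ϖ : F) (e : ℤ) : Prop where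
  prime : ℓ.Prime
  map_val : ∀ x, w (σ x) = w x
  order : σ ^ (ℓ ^ n) = 1
  val_unif : w ϖ = ((1 : ℤ) : WithTop ℤ)
  base_dvd : ∀ x (a : ℤ), σ x = x → w x = a → (ℓ ^ n : ℤ) ∣ a
  residue : ∀ x, ValGE w 0 x → ∃ y, σ y = y ∧ ValGE w 1 (x - y)
  val_ell : w (ℓ : F) = ((ℓ ^ n * e : ℤ) : WithTop ℤ)
  e_pos : 0 < e

/-- The `j`-th lower ramification jump of a cyclic tower: the number `i` for which
`σ ^ (ℓ ^ j) ϖ - ϖ` has valuation `i + 1`. -/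
noncomputable def towerJump {F : Type*} [Field F] (w : AddValuation F (WithTop ℤ)) (σ : RingAut F)
    (ℓ : ℕ) (ϖ : F) (j : ℕ) : ℤ := (w ((σ ^ (ℓ ^ j)) ϖ - ϖ)).untopD 0 - 1

/-- The uniformizer of the layer of degree `ℓ ^ j` that is the norm of `ϖ`. -/
noncomputable def towerUnif {F : Type*} [Field F] (σ : RingAut F) (ℓ n : ℕ) (ϖ : F) (j : ℕ) : F :=
  normProd (σ ^ (ℓ ^ j)) (ℓ ^ (n - j)) ϖ

namespace CyclicTower

variable {F : Type*} [Field F] {w : AddValuation F (WithTop ℤ)} {σ : RingAut F} {ℓ n : ℕ}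
  {ϖ : F} {e : ℤ} (S : CyclicTower w σ ℓ n ϖ e)

include S

theorem ell_pos : (0 : ℤ) < ℓ := by exact_mod_cast S.prime.pos

theorem map_val_pow (s : ℕ) (x : F) : w ((σ ^ s) x) = w x := by
  induction s with
  | zero => rfl
  | succ s ih => rw [pow_succ', RingAut.mul_apply, S.map_val, ih]

theorem valGE_pow {m : ℤ} {x : F} (h : ValGE w m x) (s : ℕ) : ValGE w m ((σ ^ s) x) := by
  rwa [ValGE, S.map_val_pow]

theorem valGE_ell : ValGE w 1 (ℓ : F) := by
  refine (valGE_of_eq S.val_ell).mono ?_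
  have h1 : (0 : ℤ) < ℓ ^ n := pow_pos S.ell_pos n
  have := mul_pos h1 S.e_pos
  omega

theorem unif_ne_zero : ϖ ≠ 0 := ne_zero_of_val_eq S.val_unif

theorem layer_dvd {j : ℕ} (hj : j ≤ n) {x : F} {a : ℤ} (hx : (σ ^ (ℓ ^ j)) x = x)
    (ha : w x = a) : (ℓ ^ (n - j) : ℤ) ∣ a := by
  have h1 : w (normProd σ (ℓ ^ j) x) = (((ℓ ^ j : ℕ) * a : ℤ) : WithTop ℤ) := by
    rw [normProd, val_prod_eq _ fun s _ => (S.map_val_pow s x).trans ha, Finset.card_range]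
  have h2 := S.base_dvd _ _ (map_normProd hx) h1
  have h3 : (ℓ ^ n : ℤ) = ((ℓ ^ j : ℕ) : ℤ) * ℓ ^ (n - j) := by
    push_cast
    rw [← pow_add]
    congr 1
    omega
  rw [h3] at h2
  exact (mul_dvd_mul_iff_left (by exact_mod_cast (pow_pos S.prime.pos j).ne')).1 h2

theorem valGE_ratio : ValGE w 1 (σ ϖ / ϖ - 1) := by
  have huv : w (σ ϖ / ϖ) = ((0 : ℤ) : WithTop ℤ) := by
    rw [val_div_eq ((S.map_val ϖ).trans S.val_unif) S.val_unif, sub_self]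
  obtain ⟨y, hy, hyu⟩ := S.residue _ (valGE_of_eq huv)
  have hyv : w y = ((0 : ℤ) : WithTop ℤ) := val_eq_of_sub huv hyu.sub_comm one_pos
  -- `y ^ (ℓ ^ n)` is congruent to the norm of `σ ϖ / ϖ`, which is `1`.
  have h1 : ValGE w 1 (normProd σ (ℓ ^ n) (σ ϖ / ϖ / y) - 1) := by
    refine valGE_prod_sub_one zero_le_one fun s _ => ?_
    have h2 := S.valGE_pow (valGE_div_sub_one_of_sub hyv hyu) s
    rw [map_sub, map_one] at h2
    exact h2
  rw [normProd_div, normProd_ratio _ _ S.unif_ne_zero, S.order, RingAut.one_apply,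
    div_self S.unif_ne_zero, normProd_of_fixed hy, ← inv_eq_one_div] at h1
  have h3 := valGE_inv_sub_one one_pos h1
  rw [inv_inv] at h3
  have h4 := valGE_sub_one_of_pow_prime_pow S.prime S.valGE_ell n (valGE_of_eq hyv) h3
  exact hyu.trans h4

/-- Wildness: `σ` acts trivially on the graded pieces of the valuation filtration. -/
theorem valGE_map_sub {x : F} {m : ℤ} (h : ValGE w m x) : ValGE w (m + 1) (σ x - x) := by
  have hm : w (ϖ ^ m) = (m : WithTop ℤ) := by simpa using val_zpow_eq S.val_unif m
  have hm0 := ne_zero_of_val_eq hm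
  have hu : ValGE w 0 (x / ϖ ^ m) := by simpa using h.div hm
  obtain ⟨y, hy, hyu⟩ := S.residue _ hu
  set u := x / ϖ ^ m with hu_def
  have hx : x = ϖ ^ m * u := by rw [hu_def]; field_simp
  have h1 : ValGE w 1 (σ u - u) := by
    have h2 : σ u - u = σ (u - y) - (u - y) := by rw [map_sub, hy]; ring
    rw [h2]
    have h3 : ValGE w 1 (σ (u - y)) := by rwa [ValGE, S.map_val]
    exact h3.sub hyu
  have h4 := valGE_zpow_sub_one one_pos S.valGE_ratio m
  have h5 : σ x - x = ϖ ^ m * (σ u * ((σ ϖ / ϖ) ^ m - 1) + (σ u - u)) := by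
    rw [hx, map_mul, map_zpow₀, div_zpow]
    field_simp
    ring
  rw [h5]
  have h6 : ValGE w 0 (σ u) := by rwa [ValGE, S.map_val]
  exact (valGE_of_eq hm).mul ((h6.mul_left h4).add h1)

theorem valGE_pow_sub {x : F} {m : ℤ} (h : ValGE w m x) (s : ℕ) :
    ValGE w (m + 1) ((σ ^ s) x - x) := by
  induction s with
  | zero => simpa using valGE_zero _
  | succ s ih =>
    rw [pow_succ', RingAut.mul_apply]
    have h1 := S.valGE_map_sub (S.valGE_pow h s)
    simpa using h1.add ih

theorem pow_unif_ne {j : ℕ} (hj : j < n) : (σ ^ (ℓ ^ j)) ϖ ≠ ϖ := by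
  intro h
  have h1 := S.layer_dvd hj.le h S.val_unif
  have h2 := Int.le_of_dvd one_pos h1
  have h3 : (2 : ℤ) ≤ ℓ := by exact_mod_cast S.prime.two_le
  have h4 : (1 : ℤ) < ℓ ^ (n - j) := one_lt_pow₀ (by omega) (by omega)
  omega

theorem val_pow_unif_sub {j : ℕ} (hj : j < n) :
    w ((σ ^ (ℓ ^ j)) ϖ - ϖ) = ((1 + towerJump w σ ℓ ϖ j : ℤ) : WithTop ℤ) := by
  obtain ⟨a, ha⟩ := exists_val_eq w (sub_ne_zero.2 (S.pow_unif_ne hj))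
  rw [towerJump, ha]
  simp

theorem jump_pos {j : ℕ} (hj : j < n) : 0 < towerJump w σ ℓ ϖ j := by
  have h1 := valGE_le (S.val_pow_unif_sub hj) (S.valGE_pow_sub (valGE_of_eq S.val_unif) (ℓ ^ j))
  omega

theorem val_ratio {j : ℕ} (hj : j < n) :
    w ((σ ^ (ℓ ^ j)) ϖ / ϖ - 1) = (towerJump w σ ℓ ϖ j : WithTop ℤ) := by
  have h0 := S.unif_ne_zero
  have : (σ ^ (ℓ ^ j)) ϖ / ϖ - 1 = ((σ ^ (ℓ ^ j)) ϖ - ϖ) / ϖ := by field_simp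
  rw [this, val_div_eq (S.val_pow_unif_sub hj) S.val_unif]
  congr 1
  ring

/-- The ratio of `σ ^ (ℓ ^ (j + 1)) ϖ` to `ϖ` is a norm of the ratio `ρ` for `j`, hence congruent to
`1 + ℓ (ρ - 1)` beyond the level of `ρ`. -/
theorem jump_lt_succ {j : ℕ} (hj : j + 1 < n) :
    towerJump w σ ℓ ϖ j < towerJump w σ ℓ ϖ (j + 1) := by
  set I := towerJump w σ ℓ ϖ j
  have hI : 0 < I := S.jump_pos (by omega)
  set ρ := (σ ^ (ℓ ^ j)) ϖ / ϖ with hρ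
  have hρv : ValGE w I (ρ - 1) := valGE_of_eq (S.val_ratio (by omega))
  have key : ∀ m : ℕ, ValGE w (I + 1) (normProd (σ ^ (ℓ ^ j)) m ρ - 1 - m * (ρ - 1)) := by
    intro m
    induction m with
    | zero => simpa [normProd] using valGE_zero _
    | succ m ih =>
      rw [normProd_succ]
      set N := normProd (σ ^ (ℓ ^ j)) m ρ
      have h1 : ValGE w (I + 1) (((σ ^ (ℓ ^ j)) ^ m) ρ - ρ) := by
        have := S.valGE_pow_sub hρv (ℓ ^ j * m)
        rw [map_sub, map_one, pow_mul] at this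
        simpa using this
      have hN1 : ValGE w I (N - 1) := by
        simpa using (ih.mono (by omega)).add ((valGE_natCast m).mul_left hρv)
      have h2 : N * ((σ ^ (ℓ ^ j)) ^ m) ρ - 1 - ((m + 1 : ℕ) : F) * (ρ - 1) =
          N * (((σ ^ (ℓ ^ j)) ^ m) ρ - ρ) + (N - 1) * (ρ - 1) + (N - 1 - m * (ρ - 1)) := by
        push_cast
        ring
      rw [h2]
      exact (((valGE_of_sub_one hI.le hN1).mul_left h1).add
        ((hN1.mul hρv).mono (by omega))).add ih
  have h3 := key ℓ
  have h4 : ValGE w (I + 1) ((ℓ : F) * (ρ - 1)) := (S.valGE_ell.mul hρv).mono (by omega)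
  have h5 := h3.add h4
  rw [sub_add_cancel, normProd_ratio _ _ S.unif_ne_zero, ← pow_mul, ← pow_succ] at h5
  have := valGE_le (S.val_ratio hj) h5
  omega

theorem jump_strictMono {i j : ℕ} (hij : i < j) (hj : j < n) :
    towerJump w σ ℓ ϖ i < towerJump w σ ℓ ϖ j := by
  induction j with
  | zero => omega
  | succ j ih =>
    rcases Nat.lt_succ_iff_lt_or_eq.1 hij with h | rfl
    · exact (ih h (by omega)).trans (S.jump_lt_succ hj)
    · exact S.jump_lt_succ hj

theorem pow_order_fixed {j : ℕ} (hj : j ≤ n) (x : F) :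
    ((σ ^ (ℓ ^ j)) ^ (ℓ ^ (n - j))) x = x := by
  rw [← pow_mul, ← pow_add, Nat.add_sub_cancel' hj, S.order, RingAut.one_apply]

theorem map_towerUnif {j : ℕ} (hj : j ≤ n) :
    (σ ^ (ℓ ^ j)) (towerUnif σ ℓ n ϖ j) = towerUnif σ ℓ n ϖ j :=
  map_normProd (S.pow_order_fixed hj ϖ)

theorem val_towerUnif (j : ℕ) :
    w (towerUnif σ ℓ n ϖ j) = ((ℓ ^ (n - j) : ℤ) : WithTop ℤ) := by
  rw [towerUnif, normProd, val_prod_eq _ fun s _ => ?_, Finset.card_range, mul_one]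
  · push_cast
    rfl
  · rw [← pow_mul, S.map_val_pow, S.val_unif]

omit S in
theorem towerUnif_self : towerUnif σ ℓ n ϖ n = ϖ := by
  simp [towerUnif, normProd]

omit S in
theorem normProd_towerUnif {j : ℕ} (hj : j < n) :
    normProd (σ ^ (ℓ ^ j)) ℓ (towerUnif σ ℓ n ϖ (j + 1)) = towerUnif σ ℓ n ϖ j := by
  have h : n - j = n - (j + 1) + 1 := by omega
  rw [towerUnif, towerUnif, pow_succ, pow_mul, normProd_normProd, h, pow_succ']

theorem layer_residue {j : ℕ} (hj : j ≤ n) {x : F} (hx : (σ ^ (ℓ ^ j)) x = x)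
    (hxv : ValGE w 0 x) : ∃ y, σ y = y ∧ ValGE w (ℓ ^ (n - j)) (x - y) := by
  obtain ⟨y, hy, hyv⟩ := S.residue x hxv
  refine ⟨y, hy, hyv.round (c := ℓ ^ (n - j)) (fun a ha => S.layer_dvd hj ?_ ha) dvd_rfl
    (by simp)⟩
  rw [map_sub, hx, pow_apply_of_fixed hy]

theorem primeStep_of_val {j : ℕ} (hj : j < n)
    (h : w ((σ ^ (ℓ ^ j)) (towerUnif σ ℓ n ϖ (j + 1)) / towerUnif σ ℓ n ϖ (j + 1) - 1) =
      ((ℓ ^ (n - (j + 1)) * towerJump w σ ℓ ϖ j : ℤ) : WithTop ℤ)) :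
    PrimeStep w (σ ^ (ℓ ^ j)) ℓ (ℓ ^ (n - (j + 1))) (towerUnif σ ℓ n ϖ (j + 1))
      (ℓ ^ (n - (j + 1)) * towerJump w σ ℓ ϖ j) (ℓ ^ n * e) := by
  have hpp : (σ ^ (ℓ ^ j)) ^ ℓ = σ ^ (ℓ ^ (j + 1)) := by rw [← pow_mul, ← pow_succ]
  have hdpos : (0 : ℤ) < ℓ ^ (n - (j + 1)) := pow_pos S.ell_pos _
  have hd' : (ℓ : ℤ) * ℓ ^ (n - (j + 1)) = ℓ ^ (n - j) := by
    rw [← pow_succ']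
    congr 1
    omega
  refine ⟨S.prime, S.map_val_pow _, hdpos, ?_, S.val_towerUnif _, ?_, ?_, ?_, ?_, ?_, S.val_ell,
    mul_pos (pow_pos S.ell_pos _) S.e_pos⟩
  · rw [hpp]; exact S.map_towerUnif hj
  · intro x a hx ha
    rw [hd']
    exact S.layer_dvd hj.le hx ha
  · intro x a hx ha
    rw [hpp] at hx
    exact S.layer_dvd hj hx ha
  · intro x hx hxv
    rw [hpp] at hx
    obtain ⟨y, hy, hyv⟩ := S.layer_residue hj hx hxv
    exact ⟨y, pow_apply_of_fixed hy _, hyv⟩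
  · have h0 := ne_zero_of_val_eq (S.val_towerUnif (j + 1))
    have h1 := val_mul_eq (S.val_towerUnif (j + 1)) h
    rw [mul_sub, mul_one, mul_div_cancel₀ _ h0] at h1
    exact h1
  · exact mul_pos hdpos (S.jump_pos hj)

/-- The jumps of the layers are computed by the uniformizer of the top layer: norms multiply
levels below the jump by `ℓ`. -/
theorem val_towerUnif_ratio {j m : ℕ} (hjm : j < m) (hm : m ≤ n) :
    w ((σ ^ (ℓ ^ j)) (towerUnif σ ℓ n ϖ m) / towerUnif σ ℓ n ϖ m - 1) =
      ((ℓ ^ (n - m) * towerJump w σ ℓ ϖ j : ℤ) : WithTop ℤ) := by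
  induction hk : n - m generalizing m j with
  | zero =>
    obtain rfl : m = n := by omega
    rw [towerUnif_self, S.val_ratio hjm]
    simp
  | succ k ih =>
    have hmn : m < n := by omega
    have h1 := fun i (hi : i < m + 1) => ih (j := i) (m := m + 1) hi (by omega) (by omega)
    have hk' : k = n - (m + 1) := by omega
    have P := S.primeStep_of_val hmn (by rw [← hk']; exact h1 m (by omega))
    have hpp : (σ ^ (ℓ ^ m)) ^ ℓ = σ ^ (ℓ ^ (m + 1)) := by rw [← pow_mul, ← pow_succ]
    have hfix : ((σ ^ (ℓ ^ m)) ^ ℓ) ((σ ^ (ℓ ^ j)) (towerUnif σ ℓ n ϖ (m + 1)) /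
        towerUnif σ ℓ n ϖ (m + 1)) = (σ ^ (ℓ ^ j)) (towerUnif σ ℓ n ϖ (m + 1)) /
        towerUnif σ ℓ n ϖ (m + 1) := by
      rw [hpp, map_div₀, pow_apply_comm, S.map_towerUnif hmn]
    have hkpos : (0 : ℤ) < ℓ ^ k := pow_pos S.ell_pos _
    have h2 := P.val_normProd_sub_one hfix (h1 j (by omega))
      (mul_pos hkpos (S.jump_pos (by omega))) (by
        rw [← hk']
        exact mul_lt_mul_of_pos_left (S.jump_strictMono hjm hmn) hkpos)
    rw [normProd_div, ← normProd_comm, normProd_towerUnif hmn] at h2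
    rw [h2]
    congr 1
    ring

/-- Each layer is a step of degree `ℓ`, and its jump is the lower jump of the tower. -/
theorem primeStep {j : ℕ} (hj : j < n) :
    PrimeStep w (σ ^ (ℓ ^ j)) ℓ (ℓ ^ (n - (j + 1))) (towerUnif σ ℓ n ϖ (j + 1))
      (ℓ ^ (n - (j + 1)) * towerJump w σ ℓ ϖ j) (ℓ ^ n * e) :=
  S.primeStep_of_val hj (S.val_towerUnif_ratio (Nat.lt_succ_self j) hj)

end CyclicTower


/-! ### The closure of the norm groups -/

/-- `a` is a limit of norms from the layer of degree `ℓ ^ j` of a cyclic tower. -/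
def IsNormLimit {F : Type*} [Field F] (w : AddValuation F (WithTop ℤ)) (σ : RingAut F) (ℓ j : ℕ)
    (a : F) : Prop :=
  ∀ M : ℤ, ∃ y, y ≠ 0 ∧ (σ ^ (ℓ ^ j)) y = y ∧ ValGE w M (normProd σ (ℓ ^ j) y / a - 1)

section Vandermonde

variable {F : Type*} [Field F] {w : AddValuation F (WithTop ℤ)}

/-- A quantitative form of the linear independence of powers of distinct elements. -/
theorem valGE_of_forall_sum_mul_pow {C : ℤ} {g : ℕ → F} (hg : ∀ i, ValGE w 0 (g i)) (m : ℕ)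
    {a : ℕ → F} (h : ∀ s : ℕ, ValGE w C (∑ i ∈ Finset.range (m + 1), a i * g i ^ s)) :
    ValGE w C (a 0 * ∏ i ∈ Finset.range m, (g 0 - g (i + 1))) := by
  induction m generalizing a with
  | zero => simpa using h 0
  | succ m ih =>
    -- Eliminate the last term.
    have h1 := ih (a := fun i => a i * (g i - g (m + 1))) fun s => by
      have h2 := (h (s + 1)).sub ((hg (m + 1)).mul_left (h s))
      convert h2 using 1
      rw [Finset.sum_range_succ _ (m + 1), Finset.sum_range_succ _ (m + 1), mul_add,
        Finset.mul_sum]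
      have h3 : ∀ x y z : F, x + y - (z + y) = x - z := fun x y z => by ring
      have h4 : g (m + 1) * (a (m + 1) * g (m + 1) ^ s) = a (m + 1) * g (m + 1) ^ (s + 1) := by
        ring
      rw [h4, h3, ← Finset.sum_sub_distrib]
      exact Finset.sum_congr rfl fun i _ => by ring
    rw [Finset.prod_range_succ]
    convert h1 using 1
    ring

end Vandermonde

namespace CyclicTower

variable {F : Type*} [Field F] {w : AddValuation F (WithTop ℤ)} {σ : RingAut F} {ℓ n : ℕ}
  {ϖ : F} {e : ℤ} (S : CyclicTower w σ ℓ n ϖ e)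

include S

theorem pow_unif_layer_ne {j : ℕ} (hj : j < n) {i : ℕ} (hi0 : 0 < i) (hi : i < ℓ) :
    ((σ ^ (ℓ ^ j)) ^ i) (towerUnif σ ℓ n ϖ (j + 1)) ≠ towerUnif σ ℓ n ϖ (j + 1) := by
  intro h
  have P := S.primeStep hj
  have h1 : Function.IsPeriodicPt (σ ^ (ℓ ^ j) : RingAut F) i (towerUnif σ ℓ n ϖ (j + 1)) := by
    rw [Function.IsPeriodicPt, ← RingAut.coe_pow]
    exact h
  have h2 : Function.IsPeriodicPt (σ ^ (ℓ ^ j) : RingAut F) ℓ (towerUnif σ ℓ n ϖ (j + 1)) := by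
    rw [Function.IsPeriodicPt, ← RingAut.coe_pow]
    exact P.unif_fixed
  have h3 := h1.gcd h2
  have h4 : Nat.gcd i ℓ = 1 := Nat.Coprime.symm ((S.prime.coprime_iff_not_dvd).2 fun h => by
    have := Nat.le_of_dvd hi0 h; omega)
  rw [h4] at h3
  have h5 : (σ ^ (ℓ ^ j)) (towerUnif σ ℓ n ϖ (j + 1)) = towerUnif σ ℓ n ϖ (j + 1) := h3
  exact ne_zero_of_val_eq P.jump (by rw [h5, sub_self])

/-- An approximate form of Hilbert's Theorem 90 in a step of degree `ℓ`. -/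
theorem exists_hilbert90 {j : ℕ} (hj : j < n) :
    ∃ c : ℤ, ∀ (M : ℤ) (δ : F), (σ ^ (ℓ ^ (j + 1))) δ = δ →
      ValGE w M (normProd (σ ^ (ℓ ^ j)) ℓ δ - 1) →
      ∃ x, x ≠ 0 ∧ (σ ^ (ℓ ^ (j + 1))) x = x ∧ ValGE w (M - c) (δ * (σ ^ (ℓ ^ j)) x / x - 1) := by
  have P := S.primeStep hj
  have hpp : (σ ^ (ℓ ^ j)) ^ ℓ = σ ^ (ℓ ^ (j + 1)) := by rw [← pow_mul, ← pow_succ]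
  set τ := σ ^ (ℓ ^ j) with hτ
  set p := towerUnif σ ℓ n ϖ (j + 1) with hp
  have hD : ∏ i ∈ Finset.range (ℓ - 1), ((τ ^ 0) p - (τ ^ (i + 1)) p) ≠ 0 := by
    refine Finset.prod_ne_zero_iff.2 fun i hi => sub_ne_zero.2 ?_
    have := Finset.mem_range.1 hi
    exact (S.pow_unif_layer_ne hj (Nat.succ_pos i) (by omega)).symm
  obtain ⟨c, hc⟩ := exists_val_eq w hD
  have hp0 : ValGE w 0 p := (valGE_of_eq P.unif_val).mono P.d_pos.le
  refine ⟨c, fun M δ hδ hN => ?_⟩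
  rw [← hpp] at hδ ⊢
  -- The resolvents `∑ δ * τ δ * ⋯ * τ ^ (i - 1) δ * τ ^ i (p ^ s)` are not all small.
  obtain ⟨s, hs⟩ : ∃ s : ℕ, ¬ ValGE w (c + 1)
      (∑ i ∈ Finset.range (ℓ - 1 + 1), normProd τ i δ * ((τ ^ i) p) ^ s) := by
    by_contra! hcon
    have h1 := valGE_of_forall_sum_mul_pow (fun i => P.valGE_pow hp0 i) (ℓ - 1) hcon
    have h2 : normProd τ 0 δ = 1 := by simp [normProd]
    rw [h2, one_mul] at h1
    have := valGE_le hc h1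
    omega
  rw [Nat.sub_add_cancel S.prime.one_le] at hs
  set x := ∑ i ∈ Finset.range ℓ, normProd τ i δ * ((τ ^ i) p) ^ s with hx
  have hx0 : x ≠ 0 := by
    intro h
    rw [h] at hs
    exact hs (valGE_zero _)
  obtain ⟨b, hb⟩ := exists_val_eq w hx0
  have hbc : b ≤ c := by
    by_contra! hcon
    exact hs ((valGE_of_eq hb).mono hcon)
  refine ⟨x, hx0, ?_, ?_⟩
  · rw [hx, map_sum]
    refine Finset.sum_congr rfl fun i _ => ?_
    rw [map_mul, map_pow, pow_apply_comm, P.unif_fixed]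
    congr 1
    rw [normProd, map_prod]
    exact Finset.prod_congr rfl fun r _ => by rw [pow_apply_comm, hδ]
  · have h1 : δ * τ x - x = (normProd τ ℓ δ - 1) * p ^ s := by
      have h2 : δ * τ x = ∑ i ∈ Finset.range ℓ, normProd τ (i + 1) δ * ((τ ^ (i + 1)) p) ^ s := by
        rw [hx, map_sum, Finset.mul_sum]
        refine Finset.sum_congr rfl fun i _ => ?_
        rw [map_mul, map_pow, ← RingAut.mul_apply, ← pow_succ', ← mul_assoc, mul_comm δ,
          map_normProd_mul, normProd_succ]
      have h3 := Finset.sum_range_sub (fun i => normProd τ i δ * ((τ ^ i) p) ^ s) ℓ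
      rw [Finset.sum_sub_distrib] at h3
      rw [h2, hx, h3, P.unif_fixed, pow_zero, RingAut.one_apply, sub_mul]
      simp [normProd]
    have h4 : δ * τ x / x - 1 = (δ * τ x - x) / x := by field_simp
    rw [h4, h1]
    exact ((hN.mul_right (hp0.pow_zero s)).div hb).mono (by omega)

/-- The analogue for closures of norm groups of the fact that a character `χ` satisfies
`(χ, a ^ ℓ) = (ℓ χ, a)`: if `a ^ ℓ` is a limit of norms from the layer of degree `ℓ ^ (j + 1)`, then
`a` is a limit of norms from the layer of degree `ℓ ^ j`. -/
theorem isNormLimit_of_pow {j : ℕ} (hj : j < n) {a : F} (ha : σ a = a) (ha0 : a ≠ 0)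
    (h : IsNormLimit w σ ℓ (j + 1) (a ^ ℓ)) : IsNormLimit w σ ℓ j a := by
  intro M
  obtain ⟨c, hc⟩ := S.exists_hilbert90 hj
  have hpp : (σ ^ (ℓ ^ j)) ^ ℓ = σ ^ (ℓ ^ (j + 1)) := by rw [← pow_mul, ← pow_succ]
  have haτ : ∀ k, (σ ^ k) a = a := pow_apply_of_fixed ha
  -- The loss `c` occurs in Hilbert's Theorem 90, and `ℓ ^ n * e` in the division by `ℓ` at the end.
  obtain ⟨β, hβ0, hβ, hβN⟩ := h (max M 1 + ℓ ^ n * e + c)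
  set τ := σ ^ (ℓ ^ j) with hτ
  have hMpos : 0 < max M 1 := lt_of_lt_of_le one_pos (le_max_right _ _)
  have hεpos : 0 < ℓ ^ n * e := mul_pos (pow_pos S.ell_pos n) S.e_pos
  have hN : normProd τ ℓ (normProd σ (ℓ ^ j) β / a) =
      normProd σ (ℓ ^ (j + 1)) β / a ^ ℓ := by
    rw [normProd_div, normProd_of_fixed (haτ _), pow_succ, ← normProd_normProd, ← hτ]
    congr 1
    simp only [normProd, map_prod]
    rw [Finset.prod_comm]
    refine Finset.prod_congr rfl fun s _ => Finset.prod_congr rfl fun r _ => ?_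
    rw [hτ, ← pow_mul, pow_apply_comm]
  have hδ : (σ ^ (ℓ ^ (j + 1))) (normProd σ (ℓ ^ j) β / a) = normProd σ (ℓ ^ j) β / a := by
    rw [map_div₀, haτ]
    congr 1
    rw [normProd, map_prod]
    exact Finset.prod_congr rfl fun r _ => by rw [pow_apply_comm, hβ]
  obtain ⟨x, hx0, hx, hxv⟩ := hc _ _ hδ (by rw [hN]; exact hβN)
  rw [add_sub_cancel_right] at hxv
  -- By Hilbert's Theorem 90 for `N β / a`, the norm of `β (σ x / x)` is close to `a`.
  set β' := β * (σ x / x) with hβ'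
  have hσx0 : σ x ≠ 0 := (map_ne_zero _).2 hx0
  have hβ'0 : β' ≠ 0 := mul_ne_zero hβ0 (div_ne_zero hσx0 hx0)
  have hβ'f : (τ ^ ℓ) β' = β' := by
    rw [hpp, hβ', map_mul, map_div₀, hβ, hx, pow_apply_map_of_fixed hx]
  have hP : ValGE w (max M 1 + ℓ ^ n * e) (normProd σ (ℓ ^ j) β' / a - 1) := by
    convert hxv using 2
    rw [hβ', normProd_mul, normProd_ratio _ _ hx0]
    ring
  -- `β'` is nearly invariant under `τ`.
  have hratio : ValGE w (max M 1 + ℓ ^ n * e) (τ β' / β' - 1) := by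
    have h1 : τ β' / β' = σ (normProd σ (ℓ ^ j) β' / a) / (normProd σ (ℓ ^ j) β' / a) := by
      have h2 := map_normProd_mul σ (ℓ ^ j) β'
      have h3 := normProd_ne_zero σ (ℓ ^ j) hβ'0
      rw [map_div₀, ha, div_div_div_cancel_right₀ ha0, div_eq_div_iff hβ'0 h3, h2]
      ring
    rw [h1]
    refine valGE_div_sub_one (by omega) ?_ hP
    have h4 := S.valGE_pow hP 1
    rwa [pow_one, map_sub, map_one] at h4
  have hratios : ∀ s, ValGE w (max M 1 + ℓ ^ n * e) ((τ ^ s) β' / β' - 1) := by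
    intro s
    rw [← normProd_ratio _ _ hβ'0]
    refine valGE_prod_sub_one (by omega) fun r _ => ?_
    have h4 := S.valGE_pow hratio (ℓ ^ j * r)
    rwa [map_sub, map_one, pow_mul, ← hτ] at h4
  have hℓ0 : (ℓ : F) ≠ 0 := ne_zero_of_val_eq S.val_ell
  -- The average of the conjugates of `β'` is close to `β'` and invariant under `τ`.
  set y := traceSum τ ℓ β' / ℓ with hy
  have hyv : ValGE w (max M 1) (y / β' - 1) := by
    have h1 : y / β' - 1 = (∑ s ∈ Finset.range ℓ, ((τ ^ s) β' / β' - 1)) / ℓ := by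
      rw [Finset.sum_sub_distrib, ← Finset.sum_div, hy, traceSum]
      simp only [Finset.sum_const, Finset.card_range, nsmul_eq_mul, mul_one]
      field_simp
    rw [h1]
    exact ((ValGE.sum fun s _ => hratios s).div S.val_ell).mono (by omega)
  have hy0 : y ≠ 0 := by
    intro h0
    have h1 := val_eq_zero_of_sub_one hMpos hyv
    rw [h0, zero_div] at h1
    simp at h1
  refine ⟨y, hy0, ?_, ?_⟩
  · rw [hy, map_div₀, map_traceSum hβ'f, map_natCast]
  · refine ValGE.mono ?_ (le_max_left M 1)
    have h1 : normProd σ (ℓ ^ j) y / a =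
        normProd σ (ℓ ^ j) (y / β') * (normProd σ (ℓ ^ j) β' / a) := by
      rw [← mul_div_assoc, ← normProd_mul, div_mul_cancel₀ _ hβ'0]
    rw [h1]
    refine valGE_mul_sub_one hMpos.le (valGE_prod_sub_one hMpos.le fun s _ => ?_)
      (hP.mono (by omega))
    have h4 := S.valGE_pow hyv s
    rwa [map_sub, map_one] at h4

omit S in
theorem isNormLimit_pow {j : ℕ} {a : F} (h : IsNormLimit w σ ℓ j a) :
    IsNormLimit w σ ℓ (j + 1) (a ^ ℓ) := by
  intro M
  obtain ⟨y, hy0, hy, hyN⟩ := h (max M 0)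
  refine ⟨y, hy0, ?_, ?_⟩
  · rw [pow_succ, pow_mul]
    exact pow_apply_of_fixed hy ℓ
  · rw [pow_succ, ← normProd_normProd, normProd_of_fixed hy]
    have h1 : normProd σ (ℓ ^ j) (y ^ ℓ) = normProd σ (ℓ ^ j) y ^ ℓ := by
      simp only [normProd, map_pow, Finset.prod_pow]
    rw [h1, ← div_pow]
    exact (valGE_pow_sub_one (le_max_right _ _) hyN ℓ).mono (le_max_left _ _)

omit S in
theorem isNormLimit_of_succ {j : ℕ} {a : F} (h : IsNormLimit w σ ℓ (j + 1) a) :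
    IsNormLimit w σ ℓ j a := by
  intro M
  obtain ⟨y, hy0, hy, hyN⟩ := h M
  refine ⟨normProd (σ ^ (ℓ ^ j)) ℓ y, normProd_ne_zero _ _ hy0, map_normProd ?_, ?_⟩
  · rwa [← pow_mul, ← pow_succ]
  · rwa [normProd_normProd, ← pow_succ]

end CyclicTower


/-! ### Norms and the filtration by principal units -/

/-- All units of level `m` of the base field of a cyclic tower are limits of norms from the layer
of degree `ℓ ^ j`. -/
def UnitsAreNormLimits {F : Type*} [Field F] (w : AddValuation F (WithTop ℤ)) (σ : RingAut F)
    (ℓ n j : ℕ) (m : ℤ) : Prop :=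
  ∀ a, σ a = a → ValGE w (ℓ ^ n * m) (a - 1) → IsNormLimit w σ ℓ j a

/-- Up to higher order, all units of level `m` of the base field of a cyclic tower are norms from
the layer of degree `ℓ ^ j`. -/
def GradedUnitsAreNorms {F : Type*} [Field F] (w : AddValuation F (WithTop ℤ)) (σ : RingAut F)
    (ℓ n j : ℕ) (m : ℤ) : Prop :=
  ∀ a, σ a = a → ValGE w (ℓ ^ n * m) (a - 1) →
    ∃ y, y ≠ 0 ∧ (σ ^ (ℓ ^ j)) y = y ∧ ValGE w (ℓ ^ n * m + 1) (normProd σ (ℓ ^ j) y / a - 1)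

/-- The inverse of Herbrand's function of the layer of degree `ℓ ^ j` of a cyclic tower, as a
composite of the functions of the steps of degree `ℓ`. -/
def layerPsi (ℓ : ℕ) (I : ℕ → ℤ) : ℕ → ℤ → ℤ
  | 0, m => m
  | j + 1, m => stepPsi ℓ (I j) (layerPsi ℓ I j m)

theorem stepPsi_mul (ℓ : ℕ) {d : ℤ} (hd : 0 < d) (I k : ℤ) :
    stepPsi ℓ (d * I) (d * k) = d * stepPsi ℓ I k := by
  rw [stepPsi, stepPsi, mul_max_of_nonneg _ _ hd.le]
  congr 1
  ring

theorem stepPsi_strictMono {ℓ : ℕ} (hℓ : ℓ.Prime) (I : ℤ) : StrictMono (stepPsi ℓ I) := by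
  have h2 : (2 : ℤ) ≤ ℓ := by exact_mod_cast hℓ.two_le
  intro a b hab
  exact max_lt_max hab (by nlinarith)

theorem layerPsi_strictMono {ℓ : ℕ} (hℓ : ℓ.Prime) (I : ℕ → ℤ) (j : ℕ) :
    StrictMono (layerPsi ℓ I j) := by
  induction j with
  | zero => exact strictMono_id
  | succ j ih => exact (stepPsi_strictMono hℓ (I j)).comp ih

theorem le_layerPsi (ℓ : ℕ) (I : ℕ → ℤ) (j : ℕ) (m : ℤ) : m ≤ layerPsi ℓ I j m := by
  induction j with
  | zero => exact le_rfl
  | succ j ih => exact ih.trans (le_max_left _ _)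

namespace CyclicTower

variable {F : Type*} [Field F] {w : AddValuation F (WithTop ℤ)} {σ : RingAut F} {ℓ n : ℕ}
  {ϖ : F} {e : ℤ} (S : CyclicTower w σ ℓ n ϖ e)

include S

/-- The base field is stable under rounding levels up to multiples of `ℓ ^ n`. -/
theorem valGE_base_round {x : F} (hx : σ x = x) {m : ℤ} (h : ValGE w (ℓ ^ n * m + 1) x) :
    ValGE w (ℓ ^ n * (m + 1)) x := by
  refine h.round (c := ℓ ^ n) (fun a ha => S.base_dvd x a hx ha) (dvd_mul_right _ _) ?_
  linarith

theorem pow_pos_int (k : ℕ) : (0 : ℤ) < ℓ ^ k := pow_pos S.ell_pos k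

/-- Successive approximation of norms. -/
theorem unitsAreNormLimits_of_graded {j : ℕ} {m : ℤ} (hm : 0 < m)
    (h : ∀ m' ≥ m, GradedUnitsAreNorms w σ ℓ n j m') : UnitsAreNormLimits w σ ℓ n j m := by
  intro a ha hav M
  have hp := S.pow_pos_int n
  have ha0 : a ≠ 0 := ne_zero_of_val_eq (val_eq_zero_of_sub_one (mul_pos hp hm) hav)
  have key : ∀ k : ℕ, ∃ y, y ≠ 0 ∧ (σ ^ (ℓ ^ j)) y = y ∧
      ValGE w (ℓ ^ n * (m + k)) (normProd σ (ℓ ^ j) y / a - 1) := by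
    intro k
    induction k with
    | zero =>
      refine ⟨1, one_ne_zero, map_one _, ?_⟩
      rw [normProd_one, ← inv_eq_one_div]
      simpa using valGE_inv_sub_one (mul_pos hp hm) hav
    | succ k ih =>
      obtain ⟨y, hy0, hy, hyN⟩ := ih
      have hpos : (0 : ℤ) < ℓ ^ n * (m + k) := mul_pos hp (by omega)
      have hNf := map_normProd hy
      have h1 := valGE_inv_sub_one hpos hyN
      rw [inv_div] at h1
      have hf : σ (a / normProd σ (ℓ ^ j) y) = a / normProd σ (ℓ ^ j) y := by
        rw [map_div₀, ha, hNf]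
      obtain ⟨z, hz0, hz, hzN⟩ := h (m + k) (by omega) _ hf h1
      refine ⟨y * z, mul_ne_zero hy0 hz0, by rw [map_mul, hy, hz], ?_⟩
      have h2 : normProd σ (ℓ ^ j) (y * z) / a = normProd σ (ℓ ^ j) z /
          (a / normProd σ (ℓ ^ j) y) := by
        rw [normProd_mul, div_div_eq_mul_div, mul_comm]
      have h3 : σ (normProd σ (ℓ ^ j) (y * z) / a - 1) = normProd σ (ℓ ^ j) (y * z) / a - 1 := by
        rw [map_sub, map_div₀, map_normProd (by rw [map_mul, hy, hz]), ha, map_one]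
      rw [← h2] at hzN
      have := S.valGE_base_round h3 hzN
      rw [Nat.cast_succ, ← add_assoc]
      exact this
  obtain ⟨y, hy0, hy, hyN⟩ := key M.toNat
  refine ⟨y, hy0, hy, hyN.mono ?_⟩
  have h1 : M ≤ m + M.toNat := by omega
  nlinarith

theorem unitsAreNormLimits_of_succ {j : ℕ} {m : ℤ} (hm : 0 < m)
    (h1 : UnitsAreNormLimits w σ ℓ n j (m + 1)) (h2 : GradedUnitsAreNorms w σ ℓ n j m) :
    UnitsAreNormLimits w σ ℓ n j m := by
  intro a ha hav M
  have hp := S.pow_pos_int n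
  obtain ⟨y, hy0, hy, hyN⟩ := h2 a ha hav
  have ha0 : a ≠ 0 := ne_zero_of_val_eq (val_eq_zero_of_sub_one (mul_pos hp hm) hav)
  have hNf := map_normProd hy
  have h3 := valGE_inv_sub_one (by have := mul_pos hp hm; omega) hyN
  rw [inv_div] at h3
  have hf : σ (a / normProd σ (ℓ ^ j) y) = a / normProd σ (ℓ ^ j) y := by
    rw [map_div₀, ha, hNf]
  have h4 := S.valGE_base_round (x := a / normProd σ (ℓ ^ j) y - 1)
    (by rw [map_sub, hf, map_one]) h3
  obtain ⟨z, hz0, hz, hzN⟩ := h1 _ hf h4 M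
  refine ⟨y * z, mul_ne_zero hy0 hz0, by rw [map_mul, hy, hz], ?_⟩
  have h5 : normProd σ (ℓ ^ j) (y * z) / a = normProd σ (ℓ ^ j) z /
      (a / normProd σ (ℓ ^ j) y) := by
    rw [normProd_mul, div_div_eq_mul_div, mul_comm]
  rwa [h5]

theorem unitsAreNormLimits_mono {j : ℕ} {m m' : ℤ} (hm : m ≤ m')
    (h : UnitsAreNormLimits w σ ℓ n j m) : UnitsAreNormLimits w σ ℓ n j m' := by
  intro a ha hav
  exact h a ha (hav.mono (mul_le_mul_of_nonneg_left hm (S.pow_pos_int n).le))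

theorem unitsAreNormLimits_zero {m : ℤ} (hm : 0 < m) : UnitsAreNormLimits w σ ℓ n 0 m := by
  intro a ha hav M
  have ha0 : a ≠ 0 := ne_zero_of_val_eq
    (val_eq_zero_of_sub_one (mul_pos (S.pow_pos_int n) hm) hav)
  refine ⟨a, ha0, by simpa using ha, ?_⟩
  have : normProd σ (ℓ ^ 0) a = a := by simp [normProd]
  rw [this, div_self ha0, sub_self]
  exact valGE_zero _

/-- Norms from the `j`-th layer respect the filtrations by principal units. -/
theorem valGE_normProd_layer {j : ℕ} (hj : j ≤ n) {m : ℤ} (hm : 0 ≤ m) {x : F}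
    (hx : (σ ^ (ℓ ^ j)) x = x)
    (h : ValGE w (ℓ ^ (n - j) * layerPsi ℓ (towerJump w σ ℓ ϖ) j m + 1) (x - 1)) :
    ValGE w (ℓ ^ n * m + 1) (normProd σ (ℓ ^ j) x - 1) := by
  induction j generalizing x with
  | zero => simpa [normProd, layerPsi] using h
  | succ j ih =>
    have P := S.primeStep (j := j) hj
    have hpp : (σ ^ (ℓ ^ j)) ^ ℓ = σ ^ (ℓ ^ (j + 1)) := by rw [← pow_mul, ← pow_succ]
    rw [← hpp] at hx
    have hd : (ℓ : ℤ) * (ℓ ^ (n - (j + 1)) * layerPsi ℓ (towerJump w σ ℓ ϖ) j m) =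
        ℓ ^ (n - j) * layerPsi ℓ (towerJump w σ ℓ ϖ) j m := by
      rw [← mul_assoc, ← pow_succ']
      congr 2
      omega
    rw [layerPsi, ← stepPsi_mul _ (S.pow_pos_int _)] at h
    have h1 := P.valGE_normProd_of_stepPsi_add_one
      (mul_nonneg (S.pow_pos_int _).le (hm.trans (le_layerPsi _ _ _ _))) hx h
    rw [hd] at h1
    have h2 := ih (by omega) (map_normProd hx) h1
    rwa [normProd_normProd, ← pow_succ] at h2

/-- Away from the upper jumps the norm is surjective on the graded pieces of the filtration by
principal units. -/
theorem gradedUnitsAreNorms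
    (hperf : ∀ x, σ x = x → ValGE w 0 x → ∃ y, σ y = y ∧ ValGE w 1 (x - y ^ ℓ))
    {j : ℕ} (hj : j ≤ n) {m : ℤ} (hm : 0 < m)
    (hne : ∀ i < j, layerPsi ℓ (towerJump w σ ℓ ϖ) i m ≠ towerJump w σ ℓ ϖ i) :
    GradedUnitsAreNorms w σ ℓ n j m := by
  intro a ha hav
  have hp := S.pow_pos_int n
  have ha0 : a ≠ 0 := ne_zero_of_val_eq (val_eq_zero_of_sub_one (mul_pos hp hm) hav)
  suffices hsuff : ∃ x, (σ ^ (ℓ ^ j)) x = x ∧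
      ValGE w (ℓ ^ (n - j) * layerPsi ℓ (towerJump w σ ℓ ϖ) j m) (x - 1) ∧
      ValGE w (ℓ ^ n * m + 1) (normProd σ (ℓ ^ j) x / a - 1) by
    obtain ⟨x, hx, hxv, hxN⟩ := hsuff
    refine ⟨x, ?_, hx, hxN⟩
    have h1 : 0 < layerPsi ℓ (towerJump w σ ℓ ϖ) j m := hm.trans_le (le_layerPsi _ _ _ _)
    exact ne_zero_of_val_eq (val_eq_zero_of_sub_one (mul_pos (S.pow_pos_int _) h1) hxv)
  induction j with
  | zero =>
    refine ⟨a, by simpa using ha, by simpa [layerPsi] using hav, ?_⟩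
    have : normProd σ (ℓ ^ 0) a = a := by simp [normProd]
    rw [this, div_self ha0, sub_self]
    exact valGE_zero _
  | succ j ih =>
    obtain ⟨x, hx, hxv, hxN⟩ := ih (by omega) fun i hi => hne i (by omega)
    have P := S.primeStep (j := j) hj
    have hpp : (σ ^ (ℓ ^ j)) ^ ℓ = σ ^ (ℓ ^ (j + 1)) := by rw [← pow_mul, ← pow_succ]
    set Λ := layerPsi ℓ (towerJump w σ ℓ ϖ) j m with hΛ
    have hΛpos : 0 < Λ := hm.trans_le (le_layerPsi _ _ _ _)
    have hd : (ℓ : ℤ) * (ℓ ^ (n - (j + 1)) * Λ) = ℓ ^ (n - j) * Λ := by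
      rw [← mul_assoc, ← pow_succ']
      congr 2
      omega
    have hdpos := S.pow_pos_int (n - (j + 1))
    -- The residue field of the layer is that of the base field, hence perfect.
    have hperf' : ∀ y, (σ ^ (ℓ ^ j)) y = y → ValGE w 0 y →
        ∃ z, (σ ^ (ℓ ^ j)) z = z ∧ ValGE w 1 (y - z ^ ℓ) := by
      intro y _ hyv
      obtain ⟨y', hy', hyy'⟩ := S.residue y hyv
      have hy'v : ValGE w 0 y' := by simpa using hyv.sub (hyy'.mono zero_le_one)
      obtain ⟨z, hz, hzv⟩ := hperf y' hy' hy'v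
      exact ⟨z, pow_apply_of_fixed hz _, hyy'.trans hzv⟩
    obtain ⟨x', hx', hx'v, hx'N⟩ := P.exists_normProd_approx hperf' (mul_pos hdpos hΛpos)
      (dvd_mul_right _ _) (fun h => hne j (by omega) (mul_left_cancel₀ hdpos.ne' h))
      (dvd_mul_right _ _) hx (by rw [hd]; exact hxv)
    rw [hd] at hx'N
    rw [stepPsi_mul _ hdpos] at hx'v
    have hxval := val_eq_zero_of_sub_one (mul_pos (S.pow_pos_int _) hΛpos) hxv
    have hx0 := ne_zero_of_val_eq hxval
    refine ⟨x', by rwa [← hpp], hx'v, ?_⟩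
    have h1 := valGE_div_sub_one_of_sub hxval hx'N
    rw [sub_zero] at h1
    have h2 := S.valGE_normProd_layer (j := j) (by omega) hm.le
      (by rw [map_div₀, hx, map_normProd hx']) h1
    have h3 : normProd σ (ℓ ^ (j + 1)) x' / a = normProd σ (ℓ ^ j)
        (normProd (σ ^ (ℓ ^ j)) ℓ x' / x) * (normProd σ (ℓ ^ j) x / a) := by
      rw [← mul_div_assoc, ← normProd_mul, div_mul_cancel₀ _ hx0, normProd_normProd, pow_succ]
    rw [h3]
    exact valGE_mul_sub_one (by have := mul_pos hp hm; omega) h2 hxN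

/-- Above `e / (ℓ - 1)`, raising to the power `ℓ` shifts the levels of units by `e`. Hence limits of
norms at level `m` for the `j`-th layer give limits of norms at level `m + e` for the next one. -/
theorem unitsAreNormLimits_add {j : ℕ} {m : ℤ} (hm : 0 < m)
    (hme : e < (ℓ - 1) * m) (h : UnitsAreNormLimits w σ ℓ n j m) :
    UnitsAreNormLimits w σ ℓ n (j + 1) (m + e) := by
  have hp := S.pow_pos_int n
  have he := S.e_pos
  have hℓ : (2 : ℤ) ≤ ℓ := by exact_mod_cast S.prime.two_le
  refine S.unitsAreNormLimits_of_graded (by omega) fun m' hm' a ha hav => ?_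
  have ha0 : w a = ((0 : ℤ) : WithTop ℤ) :=
    val_eq_zero_of_sub_one (mul_pos hp (by omega : 0 < m')) hav
  have hℓ0 : (ℓ : F) ≠ 0 := ne_zero_of_val_eq S.val_ell
  set z := (a - 1) / ℓ with hz
  have hzv : ValGE w (ℓ ^ n * (m' - e)) z :=
    (hav.div S.val_ell).mono (le_of_eq (by ring))
  have hz0 : ValGE w 0 z := hzv.mono (mul_nonneg hp.le (by omega))
  have hzf : σ z = z := by rw [hz, map_div₀, map_sub, ha, map_one, map_natCast]
  obtain ⟨r, hr, heq⟩ := exists_one_add_pow_prime S.prime hz0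
  have hb := h (1 + z) (by rw [map_add, map_one, hzf]) (by
    rw [add_sub_cancel_left]
    exact hzv.mono (mul_le_mul_of_nonneg_left (by omega) hp.le))
  obtain ⟨y, hy0, hy, hyN⟩ := isNormLimit_pow hb (ℓ ^ n * m' + 1)
  refine ⟨y, hy0, hy, ?_⟩
  have h1 : ValGE w (ℓ ^ n * m' + 1) ((1 + z) ^ ℓ / a - 1) := by
    have h2 : (1 + z) ^ ℓ - a = z ^ ℓ + ℓ * (z * z) * r := by
      have h3 : a = 1 + ℓ * z := by rw [hz]; field_simp; ring
      rw [heq]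
      linear_combination (-1 : F) * h3
    have h4 := hzv.pow ℓ
    have h5 := ((valGE_of_eq S.val_ell).mul (hzv.mul hzv)).mul_right hr
    have h6 : ValGE w (ℓ ^ n * m' + 1) ((1 + z) ^ ℓ - a) := by
      rw [h2]
      refine (h4.mono ?_).add (h5.mono ?_)
      · have h7 : m' + 1 ≤ ℓ * (m' - e) := by nlinarith
        nlinarith
      · have h7 : m' + 1 ≤ e + 2 * (m' - e) := by omega
        nlinarith
    simpa using valGE_div_sub_one_of_sub ha0 h6
  have hz1 : (1 + z) ^ ℓ ≠ 0 := by
    have h2 : ValGE w 1 ((1 + z) - 1) := by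
      rw [add_sub_cancel_left]
      refine hzv.mono ?_
      have := mul_pos hp (by omega : 0 < m' - e)
      omega
    exact pow_ne_zero _ (ne_zero_of_val_eq (val_eq_zero_of_sub_one one_pos h2))
  have h3 : normProd σ (ℓ ^ (j + 1)) y / a =
      (normProd σ (ℓ ^ (j + 1)) y / (1 + z) ^ ℓ) * ((1 + z) ^ ℓ / a) := by
    field_simp
  rw [h3]
  have := mul_pos hp (by omega : 0 < m')
  exact valGE_mul_sub_one (by omega) hyN h1

/-- Limits of norms at level `m'` for the `(j + 1)`-st layer give limits of norms at level `m` for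
the `j`-th layer, if `ℓ`-th powers of units of level `m` have level `m'`. -/
theorem unitsAreNormLimits_of_le_mul {j : ℕ} (hj : j < n) {m m' : ℤ} (hm : 0 < m)
    (h1 : m' ≤ ℓ * m) (h2 : m' ≤ m + e) (h : UnitsAreNormLimits w σ ℓ n (j + 1) m') :
    UnitsAreNormLimits w σ ℓ n j m := by
  intro a ha hav
  have hp := S.pow_pos_int n
  have hpm := mul_pos hp hm
  have ha0 : a ≠ 0 := ne_zero_of_val_eq (val_eq_zero_of_sub_one hpm hav)
  refine S.isNormLimit_of_pow hj ha ha0 (h _ (by rw [map_pow, ha]) ?_)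
  have hz0 : ValGE w 0 (a - 1) := hav.mono hpm.le
  obtain ⟨r, hr, heq⟩ := exists_one_add_pow_prime S.prime hz0
  rw [add_sub_cancel] at heq
  have h3 : a ^ ℓ - 1 = (a - 1) ^ ℓ + ℓ * (a - 1) * (1 + (a - 1) * r) := by
    rw [heq]; ring
  rw [h3]
  refine ((hav.pow ℓ).mono ?_).add ((((valGE_of_eq S.val_ell).mul hav).mul_right
    (valGE_one.add (hz0.mul_right hr))).mono ?_)
  · nlinarith
  · nlinarith

theorem exists_unitsAreNormLimits (j : ℕ) : ∃ m : ℤ, 0 < m ∧ UnitsAreNormLimits w σ ℓ n j m := by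
  have he := S.e_pos
  have hℓ : (2 : ℤ) ≤ ℓ := by exact_mod_cast S.prime.two_le
  induction j with
  | zero => exact ⟨1, one_pos, S.unitsAreNormLimits_zero one_pos⟩
  | succ j ih =>
    obtain ⟨m, hm, h⟩ := ih
    refine ⟨max m (e + 1) + e, by have := le_max_left m (e + 1); omega,
      S.unitsAreNormLimits_add (by have := le_max_left m (e + 1); omega) ?_
        (S.unitsAreNormLimits_mono (le_max_left _ _) h)⟩
    have := le_max_right m (e + 1)
    nlinarith

end CyclicTower


/-! ### The upper jumps -/

/-- The integers `μ 0, …, μ (n - 1)` are the upper ramification jumps of a cyclic tower with lower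
ramification jumps `I 0, …, I (n - 1)`. They grow by `e` from `e / (ℓ - 1)` on; below, they grow at
least by the factor `ℓ`, without passing `e ℓ / (ℓ - 1)`. -/
structure IsUpperJumps (ℓ n : ℕ) (e : ℤ) (I μ : ℕ → ℤ) : Prop where
  zero : μ 0 = I 0
  succ : ∀ j, j + 1 < n → I (j + 1) - I j = ℓ ^ (j + 1) * (μ (j + 1) - μ j)
  pos : 1 ≤ μ 0
  zero_le : (ℓ - 1) * μ 0 ≤ ℓ * e
  stable : ∀ j, j + 1 < n → e ≤ (ℓ - 1) * μ j → μ (j + 1) = μ j + e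
  unstable : ∀ j, j + 1 < n → (ℓ - 1) * μ j < e →
    ℓ * μ j ≤ μ (j + 1) ∧ (ℓ - 1) * μ (j + 1) ≤ ℓ * e

namespace CyclicTower

variable {F : Type*} [Field F] {w : AddValuation F (WithTop ℤ)} {σ : RingAut F} {ℓ n : ℕ}
  {ϖ : F} {e : ℤ} (S : CyclicTower w σ ℓ n ϖ e)

include S

/-- Let `μ j` be the largest level at which not all units of the base field are limits of norms from
the layer of degree `ℓ ^ (j + 1)`. These numbers are the upper jumps. -/
theorem exists_isUpperJumps (hn : 0 < n)
    (hperf : ∀ x, σ x = x → ValGE w 0 x → ∃ y, σ y = y ∧ ValGE w 1 (x - y ^ ℓ))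
    (hgen : ¬ UnitsAreNormLimits w σ ℓ n 1 1) :
    ∃ μ : ℕ → ℤ, IsUpperJumps ℓ n e (towerJump w σ ℓ ϖ) μ := by
  have he := S.e_pos
  have hℓ : (2 : ℤ) ≤ ℓ := by exact_mod_cast S.prime.two_le
  have hgen' : ∀ j, ¬ UnitsAreNormLimits w σ ℓ n (j + 1) 1 := by
    intro j
    induction j with
    | zero => exact hgen
    | succ j ih => exact fun h => ih fun a ha hav => isNormLimit_of_succ (h a ha hav)
  have hex : ∀ j, ∃ m : ℤ, 1 ≤ m ∧ ¬ UnitsAreNormLimits w σ ℓ n (j + 1) m ∧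
      UnitsAreNormLimits w σ ℓ n (j + 1) (m + 1) := by
    intro j
    by_contra! hcon
    obtain ⟨m, hm, h⟩ := S.exists_unitsAreNormLimits (j + 1)
    have key : ∀ k : ℕ, ¬ UnitsAreNormLimits w σ ℓ n (j + 1) (k + 1) := by
      intro k
      induction k with
      | zero => simpa using hgen' j
      | succ k ih => simpa using hcon (k + 1) (by omega) ih
    refine key (m - 1).toNat ?_
    have : (((m - 1).toNat : ℤ) + 1) = m := by omega
    rwa [this]
  choose μ hμ1 hμ hμ' using hex
  have lt_of : ∀ {j : ℕ} {m m' : ℤ}, ¬ UnitsAreNormLimits w σ ℓ n j m →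
      UnitsAreNormLimits w σ ℓ n j m' → m < m' := fun h h' => by
    by_contra! hcon
    exact h (S.unitsAreNormLimits_mono hcon h')
  -- Upper bounds from `U ^ (m + e) = (U ^ m) ^ ℓ`.
  have hupper : ∀ j (m : ℤ), 0 < m → e < (ℓ - 1) * m → UnitsAreNormLimits w σ ℓ n j m →
      μ j < m + e := fun j m hm hme h => lt_of (hμ j) (S.unitsAreNormLimits_add hm hme h)
  have hlower : ∀ j, j + 1 < n → ∀ m', m' ≤ ℓ * μ j → m' ≤ μ j + e → m' ≤ μ (j + 1) := by
    intro j hj m' h1 h2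
    have := lt_of (fun h => hμ j (S.unitsAreNormLimits_of_le_mul hj (by have := hμ1 j; omega)
      h1 h2 h)) (hμ' (j + 1))
    omega
  -- The least integer above `e / (ℓ - 1)`.
  obtain ⟨q, hq, hq'⟩ : ∃ q : ℤ, (ℓ - 1) * q ≤ e ∧ e < (ℓ - 1) * (q + 1) := by
    refine ⟨e / (ℓ - 1), Int.mul_ediv_self_le (by omega), ?_⟩
    have := Int.lt_mul_ediv_self_add (x := e) (k := ℓ - 1) (by omega)
    linarith
  have hq0 : 0 ≤ q := by nlinarith
  have hbound : ∀ m : ℤ, m ≤ q + e → (ℓ - 1) * m ≤ ℓ * e := by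
    intro m hm
    nlinarith
  have hmono : ∀ j, j + 1 < n → μ j < μ (j + 1) := by
    intro j hj
    have h1 := hμ1 j
    rcases le_total (ℓ * μ j) (μ j + e) with h | h
    · have := hlower j hj _ le_rfl h
      nlinarith
    · have := hlower j hj _ h le_rfl
      omega
  have hstrict : ∀ i j, i < j → j < n → μ i < μ j := by
    intro i j hij hj
    induction j with
    | zero => omega
    | succ j ih =>
      rcases Nat.lt_succ_iff_lt_or_eq.1 hij with h | rfl
      · exact (ih h (by omega)).trans (hmono j hj)
      · exact hmono i hj
  set I := towerJump w σ ℓ ϖ with hI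
  -- The level `μ j` is a jump, and it is not one of the previous ones.
  have hjump : ∀ j, j < n → layerPsi ℓ I j (μ j) = I j := by
    intro j
    induction j using Nat.strong_induction_on with
    | _ j ih =>
      intro hj
      by_contra hcon
      refine hμ j (S.unitsAreNormLimits_of_succ (by have := hμ1 j; omega) (hμ' j)
        (S.gradedUnitsAreNorms hperf hj (by have := hμ1 j; omega) fun i hi heq => ?_))
      rcases Nat.lt_succ_iff_lt_or_eq.1 hi with h | rfl
      · have h1 := ih i h (by omega)
        rw [← hI] at heq
        rw [← h1] at heq
        have := (layerPsi_strictMono S.prime I i).injective heq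
        have := hstrict i j h hj
        omega
      · exact hcon heq
  -- Beyond the level `μ j`, the function `layerPsi ℓ I (j + 1)` has slope `ℓ ^ (j + 1)`.
  have hslope : ∀ j, j < n → ∀ m, μ j ≤ m →
      layerPsi ℓ I (j + 1) m = I j + ℓ ^ (j + 1) * (m - μ j) := by
    intro j
    induction j with
    | zero =>
      intro hj m hm
      have h0 : μ 0 = I 0 := hjump 0 hj
      rw [layerPsi, layerPsi, stepPsi_of_ge S.prime (by omega), h0]
      ring
    | succ j ih =>
      intro hj m hm
      have h1 := hmono j hj
      have h2 := ih (by omega) m (by omega)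
      have h3 := ih (by omega) (μ (j + 1)) (by omega)
      rw [hjump (j + 1) hj] at h3
      have h4 : I (j + 1) ≤ layerPsi ℓ I (j + 1) m := by
        rw [← hjump (j + 1) hj]
        exact (layerPsi_strictMono S.prime I (j + 1)).monotone hm
      rw [layerPsi, stepPsi_of_ge S.prime h4, h2, h3]
      ring
  refine ⟨μ, hjump 0 hn, ?_, hμ1 0, hbound _ ?_, ?_, ?_⟩
  · intro j hj
    have h1 := hslope j (by omega) (μ (j + 1)) (hmono j hj).le
    rw [hjump (j + 1) hj] at h1
    rw [h1]
    ring
  · have := hupper 0 (q + 1) (by omega) hq' (S.unitsAreNormLimits_zero (by omega))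
    omega
  · intro j hj hje
    have h1 := hμ1 j
    have h2 := hupper (j + 1) (μ j + 1) (by omega) (by nlinarith) (hμ' j)
    have h3 := hlower j hj (μ j + e) (by linarith) le_rfl
    omega
  · intro j hj hje
    have h1 := hμ1 j
    refine ⟨hlower j hj _ le_rfl (by linarith), hbound _ ?_⟩
    have h2 : μ j ≤ q := by
      by_contra! hcon
      have : (ℓ - 1) * (q + 1) ≤ (ℓ - 1) * μ j := mul_le_mul_of_nonneg_left hcon (by omega)
      omega
    have h3 := hupper (j + 1) (q + 1) (by omega) hq'
      (S.unitsAreNormLimits_mono (by omega) (hμ' j))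
    omega

omit S in
theorem valGE_prod_sub_prod {ι : Type*} (s : Finset ι) {f g : ι → F} {k : ℤ} (hk : 0 ≤ k)
    (hg : ∀ i ∈ s, ValGE w 0 (g i)) (h : ∀ i ∈ s, ValGE w k (f i - g i)) :
    ValGE w k (∏ i ∈ s, f i - ∏ i ∈ s, g i) := by
  classical
  induction s using Finset.induction_on with
  | empty => simpa using valGE_zero k
  | insert i s hi ih =>
    rw [Finset.prod_insert hi, Finset.prod_insert hi]
    have h1 := h i (by simp)
    have h2 := ih (fun j hj => hg j (by simp [hj])) (fun j hj => h j (by simp [hj]))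
    have h3 : ValGE w 0 (f i) := by simpa using (h1.mono hk).add (hg i (by simp))
    have h4 : f i * ∏ j ∈ s, f j - g i * ∏ j ∈ s, g j =
        f i * (∏ j ∈ s, f j - ∏ j ∈ s, g j) + (f i - g i) * ∏ j ∈ s, g j := by ring
    rw [h4]
    exact (h3.mul_left h2).add (h1.mul_right (ValGE.prod fun j hj => hg j (by simp [hj])))

/-- At the first jump, the norm induces a map `c ↦ c ^ ℓ + β c` on the residue field, with a unit
`β` of the base field that comes from any given `σ`-stable subfield containing `ϖ`. If the residue
field is large enough, this map is not surjective, and some units are not limits of norms. -/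
theorem not_unitsAreNormLimits_one (hn : 0 < n) (C : Subfield F) (hC : ϖ ∈ C)
    (hCσ : ∀ x ∈ C, σ x ∈ C)
    (hgen : ∀ β ∈ C, σ β = β → w β = ((0 : ℤ) : WithTop ℤ) →
      ∃ z, σ z = z ∧ ValGE w 0 z ∧ ∀ c, σ c = c → ValGE w 0 c → ¬ ValGE w 1 (z - c ^ ℓ - β * c)) :
    ¬ UnitsAreNormLimits w σ ℓ n 1 1 := by
  have P := S.primeStep (j := 0) hn
  have hIpos := S.jump_pos (j := 0) hn
  have hd' : (ℓ : ℤ) * ℓ ^ (n - (0 + 1)) = ℓ ^ n := by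
    rw [← pow_succ']
    congr 1
    omega
  have hfixE : ∀ {x : F}, (σ ^ ℓ) x = x → (σ ^ ℓ ^ (0 + 1)) x = x := by
    intro x hx
    simpa only [zero_add, pow_one] using hx
  rw [pow_zero, pow_one] at P
  set p := towerUnif σ ℓ n ϖ (0 + 1) with hp
  set I := towerJump w σ ℓ ϖ 0 with hI
  set d : ℤ := ℓ ^ (n - (0 + 1)) with hd
  have hdpos := P.d_pos
  have hℓ : (2 : ℤ) ≤ ℓ := by exact_mod_cast S.prime.two_le
  have hTpos := P.T_pos
  have hCpow : ∀ s, ∀ x ∈ C, (σ ^ s) x ∈ C := by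
    intro s x hx
    induction s with
    | zero => exact hx
    | succ s ih => rw [pow_succ', RingAut.mul_apply]; exact hCσ _ ih
  have hpC : p ∈ C := by
    rw [hp, towerUnif, normProd]
    refine prod_mem fun s _ => ?_
    rw [← pow_mul]
    exact hCpow _ _ hC
  -- The base uniformizer to the power `I`, and the trace of `p ^ I`.
  have hPv := S.val_towerUnif 0
  set P₀ := normProd σ ℓ p with hP0
  have hP0v : w (P₀ ^ I) = ((ℓ ^ n * I : ℤ) : WithTop ℤ) := by
    rw [val_zpow_eq (P.val_normProd P.unif_val), hd']
    congr 1
    ring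
  have hP0f : σ (P₀ ^ I) = P₀ ^ I := by rw [map_zpow₀, map_normProd P.unif_fixed]
  have hP0ne := ne_zero_of_val_eq hP0v
  have hxf : (σ ^ ℓ) (p ^ I) = p ^ I := by rw [map_zpow₀, P.unif_fixed]
  have hxv : w (p ^ I) = ((d * I : ℤ) : WithTop ℤ) := by
    rw [val_zpow_eq P.unif_val, mul_comm]
  have hTr := P.val_traceSum hxf hxv (by simp)
  have hTrf := map_traceSum hxf
  have hlev : d * I + (ℓ - 1) * (d * I) = ℓ ^ n * I := by rw [← hd']; ring
  rw [hlev] at hTr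
  set β := traceSum σ ℓ (p ^ I) / P₀ ^ I with hβ
  have hβv : w β = ((0 : ℤ) : WithTop ℤ) := by rw [val_div_eq hTr hP0v, sub_self]
  have hβf : σ β = β := by rw [hβ, map_div₀, hTrf, hP0f]
  have hβC : β ∈ C := by
    refine div_mem (sum_mem fun s _ => hCpow _ _ (zpow_mem hpC _)) (zpow_mem ?_ _)
    exact prod_mem fun s _ => hCpow _ _ hpC
  obtain ⟨z, hzf, hzv, hz⟩ := hgen β hβC hβf hβv
  have hlevpos : 0 < ℓ ^ n * I := mul_pos (S.pow_pos_int n) hIpos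
  intro hcon
  have hav : ValGE w (ℓ ^ n * I) ((1 + z * P₀ ^ I) - 1) := by
    rw [add_sub_cancel_left]
    exact hzv.mul_left (valGE_of_eq hP0v)
  have haf : σ (1 + z * P₀ ^ I) = 1 + z * P₀ ^ I := by
    rw [map_add, map_one, map_mul, hzf, hP0f]
  have hau := val_eq_zero_of_sub_one hlevpos hav
  obtain ⟨y, hy0, hyf, hyN⟩ := hcon _ haf
    (hav.mono (mul_le_mul_of_nonneg_left (by omega) (S.pow_pos_int n).le)) (ℓ ^ n * I + 1)
  rw [pow_one] at hyf hyN
  have hyN1 := valGE_sub_of_div hau hyN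
  rw [add_zero] at hyN1
  have hyN2 : ValGE w (ℓ ^ n * I) (normProd σ ℓ y - 1) :=
    ValGE.trans (hyN1.mono (by omega)) hav
  -- `y` is a unit, and it is congruent to `1`.
  have hyv : w y = ((0 : ℤ) : WithTop ℤ) := by
    obtain ⟨b, hb⟩ := exists_val_eq w hy0
    have h1 := val_unique (P.val_normProd hb) (val_eq_zero_of_sub_one hlevpos hyN2)
    have : b = 0 := by
      rcases mul_eq_zero.1 h1 with h | h
      · omega
      · exact h
    rw [hb, this]
  have hy1 : ValGE w 1 (y - 1) := by
    obtain ⟨c, hc, hcv⟩ := S.residue y (valGE_of_eq hyv)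
    have hc0 : ValGE w 0 c := by simpa using (valGE_of_eq hyv).sub (hcv.mono zero_le_one)
    have h1 : ValGE w 1 (normProd σ ℓ y - c ^ ℓ) := by
      rw [← normProd_of_fixed hc]
      refine valGE_prod_sub_prod _ zero_le_one (fun s _ => P.valGE_pow hc0 s) fun s _ => ?_
      rw [← map_sub]
      exact P.valGE_pow hcv s
    refine hcv.trans (valGE_sub_one_of_pow_prime S.prime S.valGE_ell hc0 ?_)
    exact h1.sub_comm.trans (hyN2.mono (by omega))
  have hηf : (σ ^ ℓ) (y - 1) = y - 1 := by rw [map_sub, hyf, map_one]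
  -- It is even congruent to `1` at the level of the jump, below which the norm multiplies levels
  -- by `ℓ`.
  have hηT : ValGE w (d * I) (y - 1) := by
    by_contra hlt
    have h0 : y - 1 ≠ 0 := by
      intro h
      rw [h] at hlt
      exact hlt (valGE_zero _)
    obtain ⟨b, hb⟩ := exists_val_eq w h0
    have hb1 := valGE_le hb hy1
    have hbT : b < d * I := by
      by_contra! h
      exact hlt ((valGE_of_eq hb).mono h)
    have h1 := valGE_le (P.val_normProd_sub_one hyf hb (by omega) hbT) hyN2
    rw [← hd'] at h1
    nlinarith
  -- Compare the leading terms of `y = 1 + c p ^ I + ⋯` and its norm.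
  have hx0 := ne_zero_of_val_eq hxv
  have hq0 : ValGE w 0 ((y - 1) / p ^ I) := by
    simpa using hηT.div hxv
  have hqf : (σ ^ ℓ) ((y - 1) / p ^ I) = (y - 1) / p ^ I := by
    rw [map_div₀, hηf, hxf]
  obtain ⟨c, hc, hcv⟩ := P.residue _ hqf hq0
  have hc0 : ValGE w 0 c := by simpa using hq0.sub (hcv.mono hdpos.le)
  refine hz c hc hc0 ?_
  obtain ⟨r, hr, heq⟩ := P.exists_normProd_one_add hTpos.le hηf hηT
  rw [add_sub_cancel] at heq
  have hdecomp : y - 1 = c * p ^ I + p ^ I * ((y - 1) / p ^ I - c) := by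
    field_simp
    ring
  have hκf : (σ ^ ℓ) (p ^ I * ((y - 1) / p ^ I - c)) = p ^ I * ((y - 1) / p ^ I - c) := by
    rw [map_mul, map_sub, hqf, hxf, pow_apply_of_fixed hc]
  have hκv := (valGE_of_eq hxv).mul hcv
  have hT1 : ValGE w (ℓ ^ n * I + 1) (traceSum σ ℓ (y - 1) - c * β * P₀ ^ I) := by
    have h1 : traceSum σ ℓ (y - 1) = c * traceSum σ ℓ (p ^ I) +
        traceSum σ ℓ (p ^ I * ((y - 1) / p ^ I - c)) := by
      conv_lhs => rw [hdecomp]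
      rw [← traceSum_mul_of_fixed hc]
      simp only [traceSum, map_add, Finset.sum_add_distrib]
    have h2 : c * β * P₀ ^ I = c * traceSum σ ℓ (p ^ I) := by
      rw [hβ, mul_assoc, div_mul_cancel₀ _ hP0ne]
    rw [h1, h2, add_sub_cancel_left]
    refine (P.valGE_traceSum hκf hκv).mono ?_
    linarith
  have hN1 : ValGE w (ℓ ^ n * I + 1) (normProd σ ℓ (y - 1) - c ^ ℓ * P₀ ^ I) := by
    have h1 : normProd σ ℓ (y - 1) = normProd σ ℓ ((y - 1) / p ^ I) * P₀ ^ I := by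
      have h2 : normProd σ ℓ (p ^ I) = P₀ ^ I := by
        simp only [hP0, normProd, map_zpow₀, Finset.prod_zpow]
      rw [← h2, ← normProd_mul, div_mul_cancel₀ _ hx0]
    rw [h1, ← sub_mul, ← normProd_of_fixed hc]
    refine ((valGE_prod_sub_prod _ hdpos.le (fun s _ => P.valGE_pow hc0 s) fun s _ => ?_).mul
      (valGE_of_eq hP0v)).mono (k := ℓ ^ n * I + 1) (by linarith)
    rw [← map_sub]
    exact P.valGE_pow hcv s
  have hfin : ValGE w (ℓ ^ n * I + 1) ((z - c ^ ℓ - β * c) * P₀ ^ I) := by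
    have h1 : (z - c ^ ℓ - β * c) * P₀ ^ I =
        (traceSum σ ℓ (y - 1) - c * β * P₀ ^ I) + (normProd σ ℓ (y - 1) - c ^ ℓ * P₀ ^ I) + r -
          (normProd σ ℓ y - (1 + z * P₀ ^ I)) := by
      rw [heq]
      ring
    rw [h1]
    exact ((hT1.add hN1).add (hr.mono (by rw [← hlev]; linarith))).sub hyN1
  have h2 := hfin.div hP0v
  rw [mul_div_cancel_right₀ _ hP0ne] at h2
  exact h2.mono (by omega)

end CyclicTower


/-! ### The valuation of a prime element -/

section PrimeVal

variable {D : Type*} [CommRing D] [IsDomain D] {p : D} (hp : Prime p)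
  (hfin : ∀ x : D, x ≠ 0 → FiniteMultiplicity p x)
  (F : Type*) [Field F] [Algebra D F] [IsFractionRing D F]

/-- The multiplicity of a prime element `p` of a domain, with integer values. -/
noncomputable def intMultiplicity : AddValuation D (WithTop ℤ) :=
  (multiplicity_addValuation hp).map (AddMonoidHom.withTopMap (Nat.castAddMonoidHom ℤ)) rfl
    (by
      intro a b hab
      cases b using WithTop.recTopCoe with
      | top => exact le_top
      | coe b =>
        cases a using WithTop.recTopCoe with
        | top => exact absurd hab (by exact not_le_of_gt (WithTop.coe_lt_top b))
        | coe a =>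
          have : a ≤ b := WithTop.coe_le_coe.1 hab
          change ((a : ℤ) : WithTop ℤ) ≤ ((b : ℤ) : WithTop ℤ)
          exact_mod_cast this)

theorem intMultiplicity_eq {f : D} {m : ℕ} (h : emultiplicity p f = m) :
    intMultiplicity hp f = ((m : ℤ) : WithTop ℤ) := by
  change AddMonoidHom.withTopMap (Nat.castAddMonoidHom ℤ) (emultiplicity p f) = _
  rw [h]
  rfl

theorem le_intMultiplicity_iff {f : D} {m : ℕ} :
    ((m : ℤ) : WithTop ℤ) ≤ intMultiplicity hp f ↔ p ^ m ∣ f := by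
  rw [pow_dvd_iff_le_emultiplicity]
  cases h : emultiplicity p f with
  | top =>
    have : intMultiplicity hp f = ⊤ := by
      change AddMonoidHom.withTopMap (Nat.castAddMonoidHom ℤ) (emultiplicity p f) = _
      rw [h]
      rfl
    simp [this]
  | coe k =>
    rw [intMultiplicity_eq hp h]
    norm_cast

include hfin in
theorem nonZeroDivisors_le_primeCompl :
    nonZeroDivisors D ≤ (AddValuation.toValuation (intMultiplicity hp)).supp.primeCompl := by
  intro x hx hmem
  have h0 := nonZeroDivisors.ne_zero hx
  obtain ⟨m, hm⟩ := finiteMultiplicity_iff_emultiplicity_ne_top.1 (hfin x h0) |>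
    ENat.ne_top_iff_exists.1
  have h1 : intMultiplicity hp x = ⊤ := hmem
  rw [intMultiplicity_eq hp hm.symm] at h1
  exact WithTop.coe_ne_top h1

/-- The valuation defined by a prime element `p` on the field of fractions of a domain in which
only `0` is divisible by all powers of `p`. -/
noncomputable def primeVal : AddValuation F (WithTop ℤ) :=
  AddValuation.toValuation.symm <|
    (AddValuation.toValuation (intMultiplicity hp)).extendToLocalization
      (nonZeroDivisors_le_primeCompl hp hfin) F

theorem primeVal_algebraMap (f : D) :
    primeVal hp hfin F (algebraMap D F f) = intMultiplicity hp f :=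
  Valuation.extendToLocalization_apply_map_apply (AddValuation.toValuation (intMultiplicity hp))
    (nonZeroDivisors_le_primeCompl hp hfin) F f

theorem valGE_algebraMap_iff {f : D} {m : ℕ} :
    ValGE (primeVal hp hfin F) m (algebraMap D F f) ↔ p ^ m ∣ f := by
  rw [ValGE, primeVal_algebraMap, le_intMultiplicity_iff]

theorem valGE_algebraMap (f : D) : ValGE (primeVal hp hfin F) 0 (algebraMap D F f) := by
  simpa using (valGE_algebraMap_iff hp hfin F (f := f) (m := 0)).2 (by simp)

theorem valGE_one_algebraMap_iff {f : D} :
    ValGE (primeVal hp hfin F) 1 (algebraMap D F f) ↔ p ∣ f := by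
  simpa using (valGE_algebraMap_iff hp hfin F (f := f) (m := 1))

theorem primeVal_eq_zero_iff {f : D} :
    primeVal hp hfin F (algebraMap D F f) = ((0 : ℤ) : WithTop ℤ) ↔ ¬ p ∣ f := by
  rw [← valGE_one_algebraMap_iff hp hfin F]
  refine ⟨fun h h1 => ?_, fun h => val_eq_of_not_valGE (valGE_algebraMap hp hfin F f) h⟩
  have := valGE_le h h1
  omega

/-- An element integral for the valuation of `p` has a denominator prime to `p`. -/
theorem exists_div_of_valGE_zero {x : F} (hx : ValGE (primeVal hp hfin F) 0 x) :
    ∃ f g : D, ¬ p ∣ g ∧ x = algebraMap D F f / algebraMap D F g := by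
  obtain ⟨a, b, hb, rfl⟩ := IsFractionRing.div_surjective (A := D) x
  have hb0 := nonZeroDivisors.ne_zero hb
  obtain ⟨c, hc, hpc⟩ := (hfin b hb0).exists_eq_pow_mul_and_not_dvd
  set k := multiplicity p b
  have hpk : algebraMap D F (p ^ k) ≠ 0 :=
    (map_ne_zero_iff _ (IsFractionRing.injective D F)).2 (pow_ne_zero _ hp.ne_zero)
  have hbv : ValGE (primeVal hp hfin F) k (algebraMap D F b) :=
    (valGE_algebraMap_iff hp hfin F).2 ⟨c, hc⟩
  have hb1 : algebraMap D F b ≠ 0 := (map_ne_zero_iff _ (IsFractionRing.injective D F)).2 hb0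
  have hav : ValGE (primeVal hp hfin F) k (algebraMap D F a) := by
    have := hx.mul hbv
    rwa [div_mul_cancel₀ _ hb1, zero_add] at this
  obtain ⟨d, hd⟩ := (valGE_algebraMap_iff hp hfin F).1 hav
  refine ⟨d, c, hpc, ?_⟩
  rw [hc, hd, map_mul, map_mul, mul_div_mul_left _ _ hpk]

theorem primeVal_map_ringEquiv (τ : D ≃+* D) (hτ : Associated (τ p) p) (τ' : RingAut F)
    (h : ∀ f, τ' (algebraMap D F f) = algebraMap D F (τ f)) (x : F) :
    primeVal hp hfin F (τ' x) = primeVal hp hfin F x := by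
  have key : ∀ f : D, f ≠ 0 → primeVal hp hfin F (algebraMap D F (τ f)) =
      primeVal hp hfin F (algebraMap D F f) := by
    intro f hf
    have h1 : emultiplicity p (τ f) = emultiplicity p f := by
      rw [emultiplicity_eq_of_associated_left hτ, emultiplicity_map_eq]
    obtain ⟨m, hm⟩ := finiteMultiplicity_iff_emultiplicity_ne_top.1 (hfin f hf) |>
      ENat.ne_top_iff_exists.1
    rw [primeVal_algebraMap, primeVal_algebraMap, intMultiplicity_eq hp hm.symm,
      intMultiplicity_eq hp (h1.trans hm.symm)]
  by_cases hx0 : x = 0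
  · rw [hx0, map_zero]
  obtain ⟨a, b, hb, rfl⟩ := IsFractionRing.div_surjective (A := D) x
  have hb0 := nonZeroDivisors.ne_zero hb
  have ha0 : a ≠ 0 := by
    rintro rfl
    simp at hx0
  have hinj := IsFractionRing.injective D F
  obtain ⟨i, hi⟩ := exists_val_eq (primeVal hp hfin F) ((map_ne_zero_iff _ hinj).2 ha0)
  obtain ⟨j, hj⟩ := exists_val_eq (primeVal hp hfin F) ((map_ne_zero_iff _ hinj).2 hb0)
  rw [map_div₀, h, h, val_div_eq ((key a ha0).trans hi) ((key b hb0).trans hj), val_div_eq hi hj]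

end PrimeVal


/-! ### Monoid algebras with exponents in `ℚ≥0` over a perfect field -/

section Perfect

open Polynomial

variable {k : Type*} [Field k] {ℓ : ℕ} [hℓ : Fact ℓ.Prime] [CharP k ℓ]

/-- The equation `y ^ ℓ + β y = γ X ^ D` has no solution `y = b / c` in rational functions.
Comparing degrees, `D` is divisible by `ℓ`; subtracting the `ℓ`-th root of the right-hand side
from `y` then replaces `D` by `D / ℓ`. -/
theorem additive_polynomial_ne (hroot : ∀ a : k, ∃ b, b ^ ℓ = a) (D : ℕ) (hD : 0 < D) {β : k}
    (hβ : β ≠ 0) (γ : k) (hγ : γ ≠ 0) (b c : k[X]) (hc : c ≠ 0) :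
    C γ * X ^ D * c ^ ℓ ≠ b ^ ℓ + C β * b * c ^ (ℓ - 1) := by
  induction D using Nat.strong_induction_on generalizing γ b with
  | _ D ih =>
    intro heq
    have hℓ2 := hℓ.out.two_le
    have hlhs : (C γ * X ^ D * c ^ ℓ).natDegree = D + ℓ * c.natDegree := by
      rw [natDegree_mul (by simp [hγ]) (pow_ne_zero _ hc), natDegree_C_mul_X_pow _ _ hγ,
        natDegree_pow]
    have hb : b ≠ 0 := by
      rintro rfl
      rw [zero_pow hℓ.out.ne_zero, mul_zero, zero_mul, add_zero] at heq
      exact mul_ne_zero (by simp [hγ]) (pow_ne_zero _ hc) heq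
    have hmid : (C β * b * c ^ (ℓ - 1)).natDegree = b.natDegree + (ℓ - 1) * c.natDegree := by
      rw [natDegree_mul (by simp [hβ, hb]) (pow_ne_zero _ hc), natDegree_C_mul hβ,
        natDegree_pow]
    have hsplit : ℓ * c.natDegree = c.natDegree + (ℓ - 1) * c.natDegree := by
      conv_lhs => rw [show ℓ = 1 + (ℓ - 1) by omega]
      ring
    have hbc : c.natDegree < b.natDegree := by
      by_contra! hcon
      have h1 := natDegree_add_le (b ^ ℓ) (C β * b * c ^ (ℓ - 1))
      rw [← heq, hlhs, hmid, natDegree_pow] at h1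
      have h2 : ℓ * b.natDegree ≤ ℓ * c.natDegree := Nat.mul_le_mul_left _ hcon
      omega
    have hbsplit : ℓ * b.natDegree = b.natDegree + (ℓ - 1) * b.natDegree := by
      conv_lhs => rw [show ℓ = 1 + (ℓ - 1) by omega]
      ring
    have hlt : (C β * b * c ^ (ℓ - 1)).natDegree < (b ^ ℓ).natDegree := by
      rw [hmid, natDegree_pow, hbsplit]
      have := Nat.mul_lt_mul_of_pos_left hbc (show 0 < ℓ - 1 by omega)
      omega
    have hdeg := congrArg natDegree heq
    rw [hlhs, natDegree_add_eq_left_of_natDegree_lt hlt, natDegree_pow] at hdeg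
    obtain ⟨m, rfl⟩ : ℓ ∣ D :=
      (Nat.dvd_add_left (Dvd.intro _ rfl)).1 (hdeg ▸ Dvd.intro _ rfl)
    have hm : 0 < m := Nat.pos_of_mul_pos_left hD
    obtain ⟨γ', rfl⟩ := hroot γ
    have hγ' : γ' ≠ 0 := by
      rintro rfl
      exact hγ (zero_pow hℓ.out.ne_zero)
    have hmD : m < ℓ * m := by nlinarith
    refine ih m hmD hm (β * γ') (mul_ne_zero hβ hγ') (C γ' * X ^ m * c - b) ?_
    rw [sub_pow_char, mul_pow, mul_pow, ← C_pow, ← pow_mul, mul_comm m ℓ, heq, C_mul]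
    have : c ^ ℓ = c * c ^ (ℓ - 1) := by rw [← pow_succ', Nat.sub_add_cancel hℓ.out.one_le]
    rw [this]
    ring

/-- Polynomials as elements of the monoid algebra, where `X` stands for the monomial of exponent
`1 / D`. -/
noncomputable def rootMonomialHom (k : Type*) [Field k] (D : ℕ) :
    k[X] →+* AddMonoidAlgebra k ℚ≥0 :=
  (AddMonoidAlgebra.mapDomainRingHom k
    (AddMonoidHom.mulRight ((D : ℚ≥0)⁻¹) |>.comp (Nat.castAddMonoidHom ℚ≥0))).comp
    (toFinsuppIso k).toRingHom

theorem rootMonomialHom_monomial (D i : ℕ) (a : k) :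
    rootMonomialHom k D (monomial i a) = AddMonoidAlgebra.single ((i : ℚ≥0) * (D : ℚ≥0)⁻¹) a := by
  simp [rootMonomialHom]

theorem rootMonomialHom_injective {D : ℕ} (hD : 0 < D) :
    Function.Injective (rootMonomialHom k D) := by
  refine Function.Injective.comp (g := AddMonoidAlgebra.mapDomainRingHom k _)
    (AddMonoidAlgebra.mapDomain_injective ?_) (toFinsuppIso k).injective
  intro i j hij
  have hD' : (D : ℚ≥0)⁻¹ ≠ 0 := by positivity
  exact Nat.cast_injective (R := ℚ≥0) (mul_right_cancel₀ hD' hij)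

theorem exists_rootMonomialHom_eq (f : AddMonoidAlgebra k ℚ≥0) :
    ∃ D : ℕ, 0 < D ∧ ∀ E : ℕ, 0 < E → D ∣ E → f ∈ Set.range (rootMonomialHom k E) := by
  induction f using AddMonoidAlgebra.induction_linear with
  | zero => exact ⟨1, one_pos, fun E _ _ => ⟨0, map_zero _⟩⟩
  | add f g hf hg =>
    obtain ⟨D, hD, h⟩ := hf
    obtain ⟨D', hD', h'⟩ := hg
    refine ⟨D * D', mul_pos hD hD', fun E hE hdvd => ?_⟩
    obtain ⟨P, hP⟩ := h E hE ((Dvd.intro _ rfl).trans hdvd)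
    obtain ⟨Q, hQ⟩ := h' E hE ((Dvd.intro_left _ rfl).trans hdvd)
    exact ⟨P + Q, by rw [map_add, hP, hQ]⟩
  | single q a =>
    refine ⟨q.den, q.den_pos, fun E hE hdvd => ?_⟩
    obtain ⟨m, rfl⟩ := hdvd
    refine ⟨monomial (q.num * m) a, ?_⟩
    rw [rootMonomialHom_monomial]
    congr 1
    have hm : (m : ℚ≥0) ≠ 0 := by
      rintro h
      have : m = 0 := by exact_mod_cast h
      subst this
      simp at hE
    have hq : (q.den : ℚ≥0) ≠ 0 := by exact_mod_cast q.den_ne_zero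
    conv_rhs => rw [← NNRat.num_div_den q]
    push_cast
    field_simp

/-- Over a perfect field, the monomial of exponent `1` is not of the form `y ^ ℓ + β y`, even with
a fraction `y = f / g`. -/
theorem additive_monoidAlgebra_ne (hroot : ∀ a : k, ∃ b, b ^ ℓ = a) {β : k} (hβ : β ≠ 0)
    (f g : AddMonoidAlgebra k ℚ≥0) (hg : g ≠ 0) :
    AddMonoidAlgebra.single 1 1 * g ^ ℓ ≠
      f ^ ℓ + AddMonoidAlgebra.single 0 β * f * g ^ (ℓ - 1) := by
  intro heq
  obtain ⟨D, hD, hf⟩ := exists_rootMonomialHom_eq f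
  obtain ⟨D', hD', hg'⟩ := exists_rootMonomialHom_eq g
  obtain ⟨b, rfl⟩ := hf (D * D') (mul_pos hD hD') (Dvd.intro _ rfl)
  obtain ⟨c, rfl⟩ := hg' (D * D') (mul_pos hD hD') (Dvd.intro_left _ rfl)
  have hE : ((D * D' : ℕ) : ℚ≥0) ≠ 0 := by exact_mod_cast (mul_pos hD hD').ne'
  have h1 : rootMonomialHom k (D * D') (C 1 * X ^ (D * D')) = AddMonoidAlgebra.single 1 1 := by
    rw [C_mul_X_pow_eq_monomial, rootMonomialHom_monomial, mul_inv_cancel₀ hE]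
  have h2 : rootMonomialHom k (D * D') (C β) = AddMonoidAlgebra.single 0 β := by
    rw [← monomial_zero_left, rootMonomialHom_monomial, Nat.cast_zero, zero_mul]
  refine additive_polynomial_ne hroot (D * D') (mul_pos hD hD') hβ 1 one_ne_zero b c ?_ ?_
  · rintro rfl
    exact hg (map_zero _)
  · apply rootMonomialHom_injective (mul_pos hD hD')
    rw [map_mul, h1, map_pow, heq, map_add, map_pow, map_mul, map_mul, h2, map_pow]

/-- Divisibility of the exponents makes the monoid algebra perfect. -/
theorem exists_pow_eq_monoidAlgebra (hroot : ∀ a : k, ∃ b, b ^ ℓ = a)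
    (f : AddMonoidAlgebra k ℚ≥0) : ∃ h, h ^ ℓ = f := by
  have hchar : CharP (AddMonoidAlgebra k ℚ≥0) ℓ :=
    charP_of_injective_ringHom (f := AddMonoidAlgebra.singleZeroRingHom)
      AddMonoidAlgebra.single_right_injective ℓ
  induction f using AddMonoidAlgebra.induction_linear with
  | zero => exact ⟨0, zero_pow hℓ.out.ne_zero⟩
  | add f g hf hg =>
    obtain ⟨f, rfl⟩ := hf
    obtain ⟨g, rfl⟩ := hg
    exact ⟨f + g, add_pow_char _ _ ℓ⟩
  | single q a =>
    obtain ⟨a, rfl⟩ := hroot a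
    refine ⟨AddMonoidAlgebra.single (q / ℓ) a, ?_⟩
    have : (ℓ : ℚ≥0) ≠ 0 := by exact_mod_cast hℓ.out.ne_zero
    rw [AddMonoidAlgebra.single_pow, nsmul_eq_mul, mul_div_cancel₀ _ this]

end Perfect


/-! ### The field with generic residue extension -/

/-- `B` is a discrete valuation ring with uniformizer `p` that is totally ramified of degree `N`
over the discrete valuation ring `R` of invariants of the automorphism `σ`, whose order
divides `N`. -/
structure TotallyRamifiedAut (R : Type*) {B : Type*} [CommRing R] [CommRing B] [Algebra R B]
    (σ : RingAut B) (N : ℕ) (p : B) : Prop where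
  unif : Irreducible p
  order : σ ^ N = 1
  map : ∀ r : R, σ (algebraMap R B r) = algebraMap R B r
  fixed : ∀ b, σ b = b → ∃ r, algebraMap R B r = b
  residue : ∀ b, ∃ r, p ∣ b - algebraMap R B r
  ramified : ∀ π : R, Irreducible π → Associated (algebraMap R B π) (p ^ N)

section Generic

variable {B : Type*} [CommRing B]

theorem single_zero_dvd_iff {b : B} {f : AddMonoidAlgebra B ℚ≥0} :
    AddMonoidAlgebra.single 0 b ∣ f ↔ ∀ q, b ∣ f.coeff q := by
  constructor
  · rintro ⟨g, rfl⟩ q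
    rw [AddMonoidAlgebra.coeff_single_zero_mul]
    exact Dvd.intro _ rfl
  · intro h
    choose c hc using h
    classical
    refine ⟨AddMonoidAlgebra.ofCoeff
      (Finsupp.onFinset f.coeff.support (fun q => if q ∈ f.coeff.support then c q else 0) ?_), ?_⟩
    · intro q hq
      by_contra hcon
      exact hq (if_neg hcon)
    · ext q
      rw [AddMonoidAlgebra.coeff_single_zero_mul]
      by_cases hq : q ∈ f.coeff.support
      · simp only [Finsupp.onFinset_apply, if_pos hq, hc q]
      · rw [Finsupp.notMem_support_iff] at hq
        simp [hq]

theorem single_zero_pow (b : B) (m : ℕ) :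
    (AddMonoidAlgebra.single 0 b : AddMonoidAlgebra B ℚ≥0) ^ m =
      AddMonoidAlgebra.single 0 (b ^ m) := by
  rw [AddMonoidAlgebra.single_pow, smul_zero]

/-- The coefficientwise action of an automorphism of `B`. -/
noncomputable def coeffAut (σ : RingAut B) : RingAut (AddMonoidAlgebra B ℚ≥0) :=
  AddMonoidAlgebra.mapRingEquiv ℚ≥0 σ

theorem coeff_coeffAut (σ : RingAut B) (f : AddMonoidAlgebra B ℚ≥0) (q : ℚ≥0) :
    (coeffAut σ f).coeff q = σ (f.coeff q) := by
  simp [coeffAut]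

theorem coeffAut_single (σ : RingAut B) (q : ℚ≥0) (b : B) :
    coeffAut σ (AddMonoidAlgebra.single q b) = AddMonoidAlgebra.single q (σ b) := by
  simp [coeffAut]

/-- The field of fractions of the monoid algebra `B[ℚ≥0]`. For a discrete valuation ring `B` with
perfect residue field, the Gauss valuation gives it a residue field that is perfect, too, but not
algebraic over that of `B`. -/
abbrev GenericField (B : Type*) [CommRing B] := FractionRing (AddMonoidAlgebra B ℚ≥0)

/-- The constants `B → Frac (B[ℚ≥0])`. -/
noncomputable def constHom (B : Type*) [CommRing B] :
    B →+* GenericField B :=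
  (algebraMap (AddMonoidAlgebra B ℚ≥0) _).comp AddMonoidAlgebra.singleZeroRingHom

theorem constHom_injective : Function.Injective (constHom B) :=
  (IsFractionRing.injective (AddMonoidAlgebra B ℚ≥0) _).comp
    AddMonoidAlgebra.single_right_injective

/-- The extension of an automorphism of `B` to `Frac (B[ℚ≥0])` that fixes the monomials. -/
noncomputable def genericAut (σ : RingAut B) : RingAut (GenericField B) :=
  IsFractionRing.ringEquivOfRingEquiv (coeffAut σ)

theorem genericAut_algebraMap (σ : RingAut B) (f : AddMonoidAlgebra B ℚ≥0) :
    genericAut σ (algebraMap _ _ f) = algebraMap _ _ (coeffAut σ f) :=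
  IsFractionRing.ringEquivOfRingEquiv_algebraMap _ _

theorem genericAut_constHom (σ : RingAut B) (b : B) :
    genericAut σ (constHom B b) = constHom B (σ b) := by
  exact (genericAut_algebraMap _ _).trans (congrArg _ (coeffAut_single σ 0 b))

theorem genericAut_pow_algebraMap (σ : RingAut B) (s : ℕ) (f : AddMonoidAlgebra B ℚ≥0) :
    (genericAut σ ^ s) (algebraMap _ _ f) = algebraMap _ _ (coeffAut (σ ^ s) f) := by
  induction s with
  | zero =>
    have h1 : coeffAut (σ ^ 0) f = f := by
      ext q
      rw [coeff_coeffAut]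
      rfl
    rw [h1]
    rfl
  | succ s ih =>
    rw [pow_succ', RingAut.mul_apply, ih, genericAut_algebraMap]
    refine congrArg _ (AddMonoidAlgebra.ext (Finsupp.ext fun q => ?_))
    rw [coeff_coeffAut, coeff_coeffAut, coeff_coeffAut, pow_succ', RingAut.mul_apply]

theorem genericAut_pow_constHom (σ : RingAut B) (s : ℕ) (b : B) :
    (genericAut σ ^ s) (constHom B b) = constHom B ((σ ^ s) b) := by
  exact (genericAut_pow_algebraMap _ _ _).trans (congrArg _ (coeffAut_single (σ ^ s) 0 b))

variable [IsDomain B]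

theorem genericAut_pow_eq_one {σ : RingAut B} {N : ℕ} (h : σ ^ N = 1) : genericAut σ ^ N = 1 := by
  refine RingEquiv.ext fun x => ?_
  obtain ⟨a, b, _, rfl⟩ := IsFractionRing.div_surjective (A := AddMonoidAlgebra B ℚ≥0) x
  have h1 : ∀ f : AddMonoidAlgebra B ℚ≥0, coeffAut (1 : RingAut B) f = f := by
    intro f
    ext q
    rw [coeff_coeffAut]
    rfl
  rw [map_div₀, genericAut_pow_algebraMap, genericAut_pow_algebraMap, h, h1, h1]
  rfl

variable [IsDiscreteValuationRing B] {p : B}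

/-- Reduction of the coefficients in the monoid algebra `B[ℚ≥0]`. -/
noncomputable def coeffResidue (B : Type*) [CommRing B] [IsLocalRing B] :
    AddMonoidAlgebra B ℚ≥0 →+* AddMonoidAlgebra (ResidueField B) ℚ≥0 :=
  AddMonoidAlgebra.mapRingHom ℚ≥0 (residue B)

theorem single_zero_dvd_iff_residue (hp : Irreducible p) {f : AddMonoidAlgebra B ℚ≥0} :
    AddMonoidAlgebra.single 0 p ∣ f ↔ coeffResidue B f = 0 := by
  rw [single_zero_dvd_iff, ← AddMonoidAlgebra.coeff_eq_zero, Finsupp.ext_iff]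
  refine forall_congr' fun q => ?_
  rw [coeffResidue, AddMonoidAlgebra.coeff_mapRingHom, Finsupp.zero_apply, residue_eq_zero_iff,
    hp.maximalIdeal_eq, Ideal.mem_span_singleton]

theorem prime_single_zero (hp : Irreducible p) :
    Prime (AddMonoidAlgebra.single 0 p : AddMonoidAlgebra B ℚ≥0) := by
  have h0 : (AddMonoidAlgebra.single 0 p : AddMonoidAlgebra B ℚ≥0) ≠ 0 := by
    simpa using hp.ne_zero
  rw [← Ideal.span_singleton_prime h0]
  have : Ideal.span {(AddMonoidAlgebra.single 0 p : AddMonoidAlgebra B ℚ≥0)} =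
      RingHom.ker (coeffResidue B) := by
    ext f
    rw [Ideal.mem_span_singleton, RingHom.mem_ker, single_zero_dvd_iff_residue hp]
  rw [this]
  exact RingHom.ker_isPrime _

theorem finiteMultiplicity_single_zero (hp : Irreducible p) (f : AddMonoidAlgebra B ℚ≥0)
    (hf : f ≠ 0) : FiniteMultiplicity (AddMonoidAlgebra.single 0 p) f := by
  obtain ⟨q, hq⟩ : ∃ q, f.coeff q ≠ 0 := by
    by_contra! hcon
    exact hf (AddMonoidAlgebra.ext (Finsupp.ext hcon))
  obtain ⟨m, hm⟩ := FiniteMultiplicity.of_not_isUnit hp.not_isUnit hq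
  refine ⟨m, fun h => hm ?_⟩
  rw [single_zero_pow, single_zero_dvd_iff] at h
  exact h q

/-- The Gauss valuation on the field of fractions of `B[ℚ≥0]`. The residue field is the field of
fractions of the monoid algebra of the residue field of `B`. -/
noncomputable def gaussVal (hp : Irreducible p) :
    AddValuation (GenericField B) (WithTop ℤ) :=
  primeVal (prime_single_zero hp) (finiteMultiplicity_single_zero hp) _

theorem valGE_one_gaussVal_iff (hp : Irreducible p) {f : AddMonoidAlgebra B ℚ≥0} :
    ValGE (gaussVal hp) 1 (algebraMap _ _ f) ↔ AddMonoidAlgebra.single 0 p ∣ f :=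
  valGE_one_algebraMap_iff _ _ _

theorem gaussVal_eq_zero_iff (hp : Irreducible p) {f : AddMonoidAlgebra B ℚ≥0} :
    gaussVal hp (algebraMap _ _ f) = ((0 : ℤ) : WithTop ℤ) ↔ ¬ AddMonoidAlgebra.single 0 p ∣ f :=
  primeVal_eq_zero_iff _ _ _

theorem valGE_constHom_iff (hp : Irreducible p) {b : B} {m : ℕ} :
    ValGE (gaussVal hp) m (constHom B b) ↔ p ^ m ∣ b := by
  refine (valGE_algebraMap_iff _ _ _).trans ?_
  rw [single_zero_pow]
  refine single_zero_dvd_iff.trans ⟨fun h => ?_, fun h q => ?_⟩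
  · simpa using h 0
  · change p ^ m ∣ Finsupp.single 0 b q
    rw [Finsupp.single_apply]
    split_ifs
    · exact h
    · exact dvd_zero _

theorem associated_map_of_irreducible (hp : Irreducible p) (σ : RingAut B) :
    Associated (σ p) p :=
  IsDiscreteValuationRing.associated_of_irreducible B
    ((MulEquiv.irreducible_iff (σ : B ≃* B)).2 hp) hp

theorem gaussVal_genericAut (hp : Irreducible p) (σ : RingAut B)
    (x : GenericField B) :
    gaussVal hp (genericAut σ x) = gaussVal hp x := by
  refine primeVal_map_ringEquiv _ _ _ (coeffAut σ) ?_ _ (genericAut_algebraMap σ) x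
  rw [coeffAut_single]
  exact (associated_map_of_irreducible hp σ).map
    (AddMonoidAlgebra.singleZeroRingHom : B →+* AddMonoidAlgebra B ℚ≥0)

end Generic


theorem genericAut_div_fixed {B : Type*} [CommRing B] [IsDomain B] {σ : RingAut B}
    {f g : AddMonoidAlgebra B ℚ≥0} (hf : coeffAut σ f = f)
    (hg : coeffAut σ g = g) :
    genericAut σ (algebraMap _ _ f / algebraMap _ _ g) =
      algebraMap _ (GenericField B) f / algebraMap _ _ g := by
  rw [map_div₀, genericAut_algebraMap, genericAut_algebraMap, hf, hg]

namespace TotallyRamifiedAut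

variable {R B : Type*} [CommRing R] [CommRing B] [Algebra R B] {σ : RingAut B} {N : ℕ} {p : B}
  (A : TotallyRamifiedAut R σ N p)

include A

/-- Every element of `B[ℚ≥0]` is congruent to an invariant one. -/
theorem exists_fixed_dvd_sub (f : AddMonoidAlgebra B ℚ≥0) :
    ∃ h, coeffAut σ h = h ∧ AddMonoidAlgebra.single 0 p ∣ f - h := by
  induction f using AddMonoidAlgebra.induction_linear with
  | zero => exact ⟨0, map_zero _, by simp⟩
  | add f g hf hg =>
    obtain ⟨a, ha, ha'⟩ := hf
    obtain ⟨b, hb, hb'⟩ := hg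
    refine ⟨a + b, by rw [map_add, ha, hb], ?_⟩
    rw [add_sub_add_comm]
    exact dvd_add ha' hb'
  | single q b =>
    obtain ⟨r, c, hc⟩ := A.residue b
    refine ⟨AddMonoidAlgebra.single q (algebraMap R B r), by rw [coeffAut_single, A.map],
      AddMonoidAlgebra.single q c, ?_⟩
    rw [AddMonoidAlgebra.single_mul_single, zero_add, ← hc, AddMonoidAlgebra.single_sub]

theorem dvd_algebraMap_iff [IsDomain R] [IsDiscreteValuationRing R] (hN : 0 < N) {π : R}
    (hπ : Irreducible π) (r : R) :
    p ∣ algebraMap R B r ↔ π ∣ r := by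
  constructor
  · intro h
    rw [← Ideal.mem_span_singleton, ← hπ.maximalIdeal_eq, mem_maximalIdeal, mem_nonunits_iff]
    intro hu
    exact A.unif.not_isUnit (isUnit_of_dvd_unit h (hu.map _))
  · intro h
    refine ((dvd_pow_self p hN.ne').trans (A.ramified π hπ).symm.dvd).trans ?_
    exact map_dvd _ h

variable [IsDomain B] [IsDiscreteValuationRing B]

theorem gaussVal_constHom {b : B} {m : ℕ} (h : Associated b (p ^ m)) :
    gaussVal A.unif (constHom B b) = ((m : ℤ) : WithTop ℤ) := by
  refine val_eq_of_not_valGE ((valGE_constHom_iff A.unif).2 h.symm.dvd) ?_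
  have := (valGE_constHom_iff A.unif (b := b) (m := m + 1)).not.2 ?_
  · simpa using this
  · intro hdvd
    have h1 := hdvd.trans h.dvd
    rw [pow_dvd_pow_iff A.unif.ne_zero A.unif.not_isUnit] at h1
    omega

theorem single_dvd_coeffAut_iff (τ : RingAut B) (f : AddMonoidAlgebra B ℚ≥0) :
    AddMonoidAlgebra.single 0 p ∣ coeffAut τ f ↔ AddMonoidAlgebra.single 0 p ∣ f := by
  rw [single_zero_dvd_iff, single_zero_dvd_iff]
  refine forall_congr' fun q => ?_
  rw [coeff_coeffAut, ← (associated_map_of_irreducible A.unif τ).dvd_iff_dvd_left, map_dvd_iff]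

/-- The product with its conjugates makes an element of `B[ℚ≥0]` invariant. -/
theorem exists_mul_fixed (hN : 0 < N) {g : AddMonoidAlgebra B ℚ≥0} (hg : g ≠ 0) :
    ∃ h, h ≠ 0 ∧ coeffAut σ (h * g) = h * g ∧
      (¬ AddMonoidAlgebra.single 0 p ∣ g → ¬ AddMonoidAlgebra.single 0 p ∣ h * g) := by
  obtain ⟨m, rfl⟩ : ∃ m, N = m + 1 := ⟨N - 1, by omega⟩
  have hinj := IsFractionRing.injective (AddMonoidAlgebra B ℚ≥0) (GenericField B)
  have hprod : (∏ s ∈ Finset.range m, coeffAut (σ ^ (s + 1)) g) * g =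
      ∏ s ∈ Finset.range (m + 1), coeffAut (σ ^ s) g := by
    have h0 : coeffAut (σ ^ 0) g = g := by
      ext q
      rw [coeff_coeffAut]
      rfl
    rw [Finset.prod_range_succ', h0]
  refine ⟨∏ s ∈ Finset.range m, coeffAut (σ ^ (s + 1)) g, ?_, ?_, ?_⟩
  · exact Finset.prod_ne_zero_iff.2 fun s _ => (map_ne_zero_iff _ (RingEquiv.injective _)).2 hg
  · rw [hprod]
    apply hinj
    have h1 : algebraMap _ (GenericField B) (∏ s ∈ Finset.range (m + 1), coeffAut (σ ^ s) g) =
        normProd (genericAut σ) (m + 1) (algebraMap _ _ g) := by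
      rw [map_prod, normProd]
      exact Finset.prod_congr rfl fun s _ => (genericAut_pow_algebraMap σ s g).symm
    rw [← genericAut_algebraMap, h1]
    refine map_normProd ?_
    rw [genericAut_pow_eq_one A.order]
    rfl
  · intro hpg
    rw [hprod, (prime_single_zero A.unif).dvd_finsetProd_iff]
    rintro ⟨s, _, hs⟩
    exact hpg ((A.single_dvd_coeffAut_iff _ _).1 hs)

theorem exists_div_fixed (hN : 0 < N) (x : GenericField B) :
    ∃ f g : AddMonoidAlgebra B ℚ≥0, g ≠ 0 ∧ coeffAut σ g = g ∧
      x = algebraMap _ _ f / algebraMap _ _ g := by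
  obtain ⟨a, b, hb, rfl⟩ := IsFractionRing.div_surjective (A := AddMonoidAlgebra B ℚ≥0) x
  obtain ⟨h, h0, hfix, -⟩ := A.exists_mul_fixed hN (nonZeroDivisors.ne_zero hb)
  refine ⟨h * a, h * b, mul_ne_zero h0 (nonZeroDivisors.ne_zero hb), hfix, ?_⟩
  rw [map_mul, map_mul, mul_div_mul_left]
  exact (map_ne_zero_iff _ (IsFractionRing.injective _ _)).2 h0

theorem exists_div_fixed_of_valGE (hN : 0 < N) {x : GenericField B}
    (hx : ValGE (gaussVal A.unif) 0 x) :
    ∃ f g : AddMonoidAlgebra B ℚ≥0, ¬ AddMonoidAlgebra.single 0 p ∣ g ∧ coeffAut σ g = g ∧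
      x = algebraMap _ _ f / algebraMap _ _ g := by
  obtain ⟨a, b, hb, rfl⟩ := exists_div_of_valGE_zero _ _ _ hx
  have hb0 : b ≠ 0 := by
    rintro rfl
    exact hb (dvd_zero _)
  obtain ⟨h, h0, hfix, hdvd⟩ := A.exists_mul_fixed hN hb0
  refine ⟨h * a, h * b, hdvd hb, hfix, ?_⟩
  rw [map_mul, map_mul, mul_div_mul_left]
  exact (map_ne_zero_iff _ (IsFractionRing.injective _ _)).2 h0

/-- The residue field of the Gauss valuation is perfect. -/
theorem exists_fixed_valGE_sub_pow {ℓ : ℕ} [hℓ : Fact ℓ.Prime] [CharP (ResidueField B) ℓ]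
    (hN : 0 < N) (hroot : ∀ a : ResidueField B, ∃ b, b ^ ℓ = a) (x : GenericField B)
    (hx : ValGE (gaussVal A.unif) 0 x) :
    ∃ y, genericAut σ y = y ∧ ValGE (gaussVal A.unif) 1 (x - y ^ ℓ) := by
  obtain ⟨f, g, hpg, hg, rfl⟩ := A.exists_div_fixed_of_valGE hN hx
  obtain ⟨h₀, hh₀⟩ := exists_pow_eq_monoidAlgebra hroot (coeffResidue B (f * g ^ (ℓ - 1)))
  obtain ⟨h₁, hh₁⟩ : ∃ h₁, coeffResidue B h₁ = h₀ := by
    clear hh₀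
    induction h₀ using AddMonoidAlgebra.induction_linear with
    | zero => exact ⟨0, map_zero _⟩
    | add f g hf hg =>
      obtain ⟨a, rfl⟩ := hf
      obtain ⟨b, rfl⟩ := hg
      exact ⟨a + b, map_add _ _ _⟩
    | single q b =>
      obtain ⟨b, rfl⟩ := residue_surjective b
      exact ⟨AddMonoidAlgebra.single q b, AddMonoidAlgebra.mapRingHom_single _ _ _⟩
  obtain ⟨h, hh, hdvd⟩ := A.exists_fixed_dvd_sub h₁
  have hgv := (gaussVal_eq_zero_iff A.unif).2 hpg
  have hg0 := ne_zero_of_val_eq hgv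
  refine ⟨algebraMap _ _ h / algebraMap _ _ g, genericAut_div_fixed hh hg, ?_⟩
  have h1 : algebraMap _ (GenericField B) f / algebraMap _ _ g -
      (algebraMap _ _ h / algebraMap _ _ g) ^ ℓ =
      algebraMap _ _ (f * g ^ (ℓ - 1) - h ^ ℓ) / algebraMap _ _ g ^ ℓ := by
    have h2 : algebraMap _ (GenericField B) g ^ ℓ =
        algebraMap _ _ g * algebraMap _ _ g ^ (ℓ - 1) := by
      rw [← pow_succ', Nat.sub_add_cancel hℓ.out.one_le]
    rw [map_sub, map_mul, map_pow, map_pow, sub_div, div_pow]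
    congr 1
    rw [h2, mul_div_mul_right _ _ (pow_ne_zero _ hg0)]
  rw [h1]
  have h3 : AddMonoidAlgebra.single 0 p ∣ f * g ^ (ℓ - 1) - h ^ ℓ := by
    rw [single_zero_dvd_iff_residue A.unif] at hdvd ⊢
    rw [map_sub, sub_eq_zero] at hdvd
    rw [map_sub, ← hh₀, map_pow, ← hdvd, hh₁, sub_self]
  simpa using ((valGE_one_gaussVal_iff A.unif).2 h3).div (val_pow_eq hgv ℓ)

variable [IsDomain R] [IsDiscreteValuationRing R]

/-- Invariant elements of `B[ℚ≥0]` have coefficients in `R`, so that their valuation is divisible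
by `N`. -/
theorem dvd_val_of_fixed (hN : 0 < N) (f : AddMonoidAlgebra B ℚ≥0) (hf : coeffAut σ f = f)
    (m : ℕ) (hm : gaussVal A.unif (algebraMap _ _ f) = ((m : ℤ) : WithTop ℤ)) : N ∣ m := by
  induction m using Nat.strong_induction_on generalizing f with
  | _ m ih =>
    rcases Nat.eq_zero_or_pos m with rfl | hm0
    · exact dvd_zero _
    obtain ⟨π, hπ⟩ := IsDiscreteValuationRing.exists_irreducible R
    have hpf : AddMonoidAlgebra.single 0 p ∣ f := by
      rw [← valGE_one_gaussVal_iff A.unif]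
      exact (valGE_of_eq hm).mono (by omega)
    rw [single_zero_dvd_iff] at hpf
    obtain ⟨g, rfl⟩ : AddMonoidAlgebra.single 0 (algebraMap R B π) ∣ f := by
      refine single_zero_dvd_iff.2 fun q => ?_
      obtain ⟨r, hr⟩ := A.fixed (f.coeff q) (by rw [← coeff_coeffAut, hf])
      rw [← hr]
      exact map_dvd _ ((A.dvd_algebraMap_iff hN hπ r).1 (hr ▸ hpf q))
    have hg : coeffAut σ g = g := by
      rw [map_mul, coeffAut_single, A.map] at hf
      refine mul_left_cancel₀ ?_ hf
      have := (A.ramified π hπ).symm.ne_zero_iff.1 (pow_ne_zero _ A.unif.ne_zero)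
      simpa using this
    have hv := A.gaussVal_constHom (A.ramified π hπ)
    obtain ⟨a, ha⟩ := exists_val_eq (gaussVal A.unif)
      (x := algebraMap _ (GenericField B) g) (by
        intro h0
        rw [map_mul, h0, mul_zero] at hm
        exact ne_zero_of_val_eq hm rfl)
    have ha0 : 0 ≤ a := valGE_le ha (valGE_algebraMap _ _ _ g)
    lift a to ℕ using ha0
    rw [map_mul] at hm
    have hsum : (m : ℤ) = N + a := val_unique hm (val_mul_eq hv ha)
    have hsum' : m = N + a := by exact_mod_cast hsum
    rw [hsum']
    exact dvd_add dvd_rfl (ih a (by omega) g hg ha)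

variable {ℓ n : ℕ}

/-- The passage to the generic residue field preserves the cyclic extension, its ramification, and
the absolute ramification index. -/
theorem cyclicTower [hℓ : Fact ℓ.Prime] (hN : N = ℓ ^ n) {e : ℕ} (he : 0 < e)
    (hRe : ∀ π : R, Irreducible π → Associated (ℓ : R) (π ^ e)) :
    CyclicTower (gaussVal A.unif) (genericAut σ) ℓ n (constHom B p) e where
  prime := hℓ.out
  map_val := gaussVal_genericAut A.unif σ
  order := by rw [← hN]; exact genericAut_pow_eq_one A.order
  val_unif := by simpa using A.gaussVal_constHom (b := p) (m := 1) (by rw [pow_one])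
  base_dvd := by
    have hN0 : 0 < N := hN ▸ pow_pos hℓ.out.pos n
    have hinj := IsFractionRing.injective (AddMonoidAlgebra B ℚ≥0) (GenericField B)
    have key : ∀ f : AddMonoidAlgebra B ℚ≥0, coeffAut σ f = f → ∀ a : ℤ,
        gaussVal A.unif (algebraMap _ _ f) = a → (ℓ ^ n : ℤ) ∣ a := by
      intro f hf a ha
      have ha0 : 0 ≤ a := valGE_le ha (valGE_algebraMap _ _ _ f)
      lift a to ℕ using ha0
      have := A.dvd_val_of_fixed hN0 f hf a ha
      rw [hN] at this
      exact_mod_cast this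
    intro x a hx ha
    obtain ⟨f, g, hg0, hg, rfl⟩ := A.exists_div_fixed hN0 x
    have hg1 : algebraMap _ (GenericField B) g ≠ 0 := (map_ne_zero_iff _ hinj).2 hg0
    have hf : coeffAut σ f = f := by
      rw [map_div₀, genericAut_algebraMap, genericAut_algebraMap, hg,
        div_left_inj' hg1] at hx
      exact hinj hx
    have hf1 : algebraMap _ (GenericField B) f ≠ 0 := by
      intro h0
      rw [h0, zero_div] at ha
      exact ne_zero_of_val_eq ha rfl
    obtain ⟨i, hi⟩ := exists_val_eq (gaussVal A.unif) hf1
    obtain ⟨j, hj⟩ := exists_val_eq (gaussVal A.unif) hg1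
    rw [val_unique ha (val_div_eq hi hj)]
    exact dvd_sub (key f hf i hi) (key g hg j hj)
  residue := by
    intro x hx
    obtain ⟨f, g, hpg, hg, rfl⟩ := A.exists_div_fixed_of_valGE (hN ▸ pow_pos hℓ.out.pos n) hx
    obtain ⟨h, hh, hdvd⟩ := A.exists_fixed_dvd_sub f
    refine ⟨algebraMap _ _ h / algebraMap _ _ g, genericAut_div_fixed hh hg, ?_⟩
    rw [← sub_div, ← map_sub]
    simpa using ((valGE_one_gaussVal_iff A.unif).2 hdvd).div
      ((gaussVal_eq_zero_iff A.unif).2 hpg)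
  val_ell := by
    obtain ⟨π, hπ⟩ := IsDiscreteValuationRing.exists_irreducible R
    have h1 : Associated (algebraMap R B (ℓ : R)) (p ^ (N * e)) := by
      refine ((hRe π hπ).map (algebraMap R B)).trans ?_
      rw [map_pow, pow_mul]
      exact (A.ramified π hπ).pow_pow
    have h2 := A.gaussVal_constHom h1
    rw [map_natCast, map_natCast] at h2
    rw [h2, hN]
    push_cast
    rfl
  e_pos := by exact_mod_cast he

/-- The residue class of the monomial of exponent `1` is not of the form `c ^ ℓ + β c` with a
constant `β`, so that over the generic residue field not all principal units are limits of norms. -/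
theorem not_unitsAreNormLimits_one [hℓ : Fact ℓ.Prime] [CharP (ResidueField B) ℓ]
    (hroot : ∀ a : ResidueField B, ∃ b, b ^ ℓ = a) (hN : N = ℓ ^ n) (hn : 0 < n) {e : ℕ}
    (he : 0 < e) (hRe : ∀ π : R, Irreducible π → Associated (ℓ : R) (π ^ e)) :
    ¬ UnitsAreNormLimits (gaussVal A.unif) (genericAut σ) ℓ n 1 1 := by
  have hN0 : 0 < N := hN ▸ pow_pos hℓ.out.pos n
  have S := A.cyclicTower hN he hRe
  have hinj := IsFractionRing.injective (AddMonoidAlgebra B ℚ≥0) (GenericField B)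
  let ι : FractionRing B →+* GenericField B := IsFractionRing.lift (constHom_injective (B := B))
  have hι : ∀ b, ι (algebraMap _ _ b) = constHom B b := fun b =>
    IsFractionRing.lift_algebraMap _ b
  refine S.not_unitsAreNormLimits_one hn ι.fieldRange ⟨algebraMap _ _ p, hι p⟩ ?_ ?_
  · rintro _ ⟨x, rfl⟩
    obtain ⟨a, b, _, rfl⟩ := IsFractionRing.div_surjective (A := B) x
    refine ⟨algebraMap _ _ (σ a) / algebraMap _ _ (σ b), ?_⟩
    rw [map_div₀, map_div₀, map_div₀, hι, hι, hι, hι, genericAut_constHom, genericAut_constHom]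
  · rintro _ ⟨x, rfl⟩ - hβ
    -- A constant of valuation `0` is a unit `u` of `B`.
    obtain ⟨u, hu, hux⟩ : ∃ u : B, ¬ p ∣ u ∧ ι x = constHom B u := by
      obtain ⟨a, b, hb, rfl⟩ := IsFractionRing.div_surjective (A := B) x
      have hb0 := nonZeroDivisors.ne_zero hb
      have ha0 : a ≠ 0 := by
        rintro rfl
        rw [map_zero, zero_div, map_zero] at hβ
        exact ne_zero_of_val_eq hβ rfl
      obtain ⟨i, hi⟩ := IsDiscreteValuationRing.associated_pow_irreducible ha0 A.unif
      obtain ⟨j, hj⟩ := IsDiscreteValuationRing.associated_pow_irreducible hb0 A.unif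
      rw [map_div₀, hι, hι] at hβ ⊢
      have hij := val_unique hβ (val_div_eq (A.gaussVal_constHom hi) (A.gaussVal_constHom hj))
      have hij' : i = j := by omega
      subst hij'
      obtain ⟨u, hu⟩ := hj.trans hi.symm
      refine ⟨u, fun h => A.unif.not_isUnit (isUnit_of_dvd_unit h u.isUnit), ?_⟩
      rw [← hu, map_mul, mul_div_cancel_left₀]
      exact (map_ne_zero_iff _ constHom_injective).2 hb0
    have hu0 : IsLocalRing.residue B u ≠ 0 := by
      rwa [Ne, residue_eq_zero_iff, A.unif.maximalIdeal_eq, Ideal.mem_span_singleton]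
    rw [hux]
    refine ⟨algebraMap _ _ (AddMonoidAlgebra.single 1 1), ?_, valGE_algebraMap _ _ _ _, ?_⟩
    · rw [genericAut_algebraMap, coeffAut_single, map_one]
    intro c _ hc hcon
    obtain ⟨f, g, hpg, -, rfl⟩ := A.exists_div_fixed_of_valGE hN0 hc
    have hgv := (gaussVal_eq_zero_iff A.unif).2 hpg
    have hg0 := ne_zero_of_val_eq hgv
    have hdvd : AddMonoidAlgebra.single 0 p ∣ AddMonoidAlgebra.single 1 1 * g ^ ℓ - f ^ ℓ -
        AddMonoidAlgebra.single 0 u * f * g ^ (ℓ - 1) := by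
      refine (valGE_one_gaussVal_iff A.unif).1 ?_
      have h1 := hcon.mul_right (valGE_algebraMap _ (finiteMultiplicity_single_zero A.unif)
        (GenericField B) (g ^ ℓ))
      convert h1 using 1
      have h2 : algebraMap _ (GenericField B) g ^ ℓ =
          algebraMap _ _ g * algebraMap _ _ g ^ (ℓ - 1) := by
        rw [← pow_succ', Nat.sub_add_cancel hℓ.out.one_le]
      have h3 : constHom B u =
          algebraMap _ (GenericField B) (AddMonoidAlgebra.single (0 : ℚ≥0) u) := rfl
      rw [map_sub, map_sub, map_mul, map_pow, map_pow, map_mul, map_mul, map_pow, h3, sub_mul,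
        sub_mul, div_pow, div_mul_cancel₀ _ (pow_ne_zero _ hg0)]
      congr 1
      rw [h2]
      field_simp
    rw [single_zero_dvd_iff_residue A.unif, map_sub, map_sub, map_mul, map_mul, map_mul, map_pow,
      map_pow, map_pow] at hdvd
    refine additive_monoidAlgebra_ne hroot hu0 (coeffResidue B f) (coeffResidue B g)
      (fun h => hpg ((single_zero_dvd_iff_residue A.unif).2 h)) ?_
    rw [coeffResidue, AddMonoidAlgebra.mapRingHom_single, AddMonoidAlgebra.mapRingHom_single,
      map_one] at hdvd
    rw [← sub_eq_zero, ← hdvd, coeffResidue]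
    ring

end TotallyRamifiedAut


/-! ### Totally ramified extensions of discrete valuation rings -/

theorem associated_algebraMap_of_totallyRamified {R B : Type*} [CommRing R] [IsDomain R]
    [IsDiscreteValuationRing R] [CommRing B] [IsDomain B] [IsDiscreteValuationRing B] [Algebra R B]
    (hram : (maximalIdeal R).map (algebraMap R B) = Ring.jacobson B ^ Module.finrank R B) {π : R}
    (hπ : Irreducible π) {p : B} (hp : Irreducible p) :
    Associated (algebraMap R B π) (p ^ Module.finrank R B) := by
  rw [← Ideal.span_singleton_eq_span_singleton, ← Ideal.span_singleton_pow, ← hp.maximalIdeal_eq,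
    ← ringJacobson_eq_maximalIdeal, ← hram, hπ.maximalIdeal_eq, Ideal.map_span,
    Set.image_singleton]

section TotallyRamified

variable {R B : Type*} [CommRing R] [IsDomain R] [IsDiscreteValuationRing R]
  [CommRing B] [IsDedekindDomain B] [Algebra R B] [FaithfulSMul R B]
  [Module.Finite R B]
  (hram : (maximalIdeal R).map (algebraMap R B) = Ring.jacobson B ^ Module.finrank R B)

include hram

/-- In the fundamental identity `∑ e f = N`, each prime contributes at least `N`, as its
ramification index is at least `N`. So there is only one prime, and its inertia degree is `1`. -/
theorem exists_unique_prime_of_totallyRamified :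
    ∃ q : Ideal B, q.IsMaximal ∧ q.LiesOver (maximalIdeal R) ∧ q.inertiaDeg R = 1 ∧
      ∀ q' : Ideal B, q'.IsMaximal → q' = q := by
  classical
  set 𝔪 := maximalIdeal R with h𝔪
  set N := Module.finrank R B with hN
  have hfree : Module.Free R B := inferInstance
  have hNpos : 0 < N := Module.finrank_pos
  have hm0 : 𝔪.map (algebraMap R B) ≠ ⊥ :=
    Ideal.map_ne_bot_of_ne_bot (IsDiscreteValuationRing.not_a_field R)
  have := (Algebra.QuasiFinite.finite_primesOver (S := B) 𝔪).fintype
  have hsum := Ideal.sum_ramification_inertia_eq_finrank 𝔪 B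
  rw [← hN] at hsum
  have hover : ∀ q : Ideal B, q.IsMaximal → q ∈ 𝔪.primesOver B := by
    intro q hq
    refine ⟨hq.isPrime, ⟨?_⟩⟩
    exact (eq_maximalIdeal (Ideal.IsMaximal.under R q)).symm
  have hmax : ∀ q : Ideal B, q ∈ 𝔪.primesOver B → q.IsMaximal := by
    rintro q ⟨h1, h2⟩
    exact Ideal.IsMaximal.of_liesOver_isMaximal q 𝔪
  have hterm : ∀ q : 𝔪.primesOver B, N ≤ q.1.ramificationIdx R ∧ 0 < q.1.inertiaDeg R := by
    rintro ⟨q, hq⟩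
    have hqm := hmax q hq
    obtain ⟨h1, h2⟩ := hq
    refine ⟨?_, Ideal.inertiaDeg_pos q R⟩
    rw [Ideal.IsDedekindDomain.ramificationIdx_eq_multiplicity 𝔪 q hm0]
    have hq0 : q ≠ ⊥ := ne_bot_of_le_ne_bot hm0 (Ideal.map_le_of_le_comap (q.over_def 𝔪).le)
    have hqp : Prime q := Ideal.prime_of_isPrime hq0 h1
    refine FiniteMultiplicity.le_multiplicity_of_pow_dvd
      (FiniteMultiplicity.of_prime_left hqp hm0) ?_
    rw [Ideal.dvd_iff_le, hram]
    refine Ideal.pow_right_mono ?_ N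
    rw [Ring.jacobson_eq_sInf_isMaximal]
    exact sInf_le hqm
  obtain ⟨q₀, hq₀⟩ := Ideal.exists_maximal B
  let Q : 𝔪.primesOver B := ⟨q₀, hover q₀ hq₀⟩
  have hge : ∀ q : 𝔪.primesOver B, N ≤ q.1.ramificationIdx R * q.1.inertiaDeg R := fun q =>
    (hterm q).1.trans (Nat.le_mul_of_pos_right _ (hterm q).2)
  refine ⟨q₀, hq₀, (hover q₀ hq₀).2, ?_, ?_⟩
  · have h1 := Finset.single_le_sum (f := fun q : 𝔪.primesOver B =>
      q.1.ramificationIdx R * q.1.inertiaDeg R) (fun _ _ => Nat.zero_le _) (Finset.mem_univ Q)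
    rw [hsum] at h1
    have h2 := Nat.mul_le_mul_right (q₀.inertiaDeg R) (hterm Q).1
    have h3 : N * q₀.inertiaDeg R ≤ N * 1 := by simpa using h2.trans h1
    have h4 := Nat.le_of_mul_le_mul_left h3 hNpos
    have h5 : 0 < q₀.inertiaDeg R := (hterm Q).2
    omega
  · intro q' hq'
    by_contra hne
    let Q' : 𝔪.primesOver B := ⟨q', hover q' hq'⟩
    have hQ : Q' ≠ Q := fun h => hne (congrArg Subtype.val h)
    have h1 := Finset.sum_le_sum_of_subset (f := fun q : 𝔪.primesOver B =>
      q.1.ramificationIdx R * q.1.inertiaDeg R) (Finset.subset_univ {Q', Q})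
    rw [hsum, Finset.sum_pair hQ] at h1
    have h2 := hge Q
    have h3 := hge Q'
    omega

theorem isDiscreteValuationRing_of_totallyRamified : IsDiscreteValuationRing B := by
  obtain ⟨q, hq, hover, -, huniq⟩ := exists_unique_prime_of_totallyRamified hram
  have : IsLocalRing B := IsLocalRing.of_unique_max_ideal ⟨q, hq, huniq⟩
  refine { not_a_field' := ?_ }
  have hm0 : (maximalIdeal R).map (algebraMap R B) ≠ ⊥ :=
    Ideal.map_ne_bot_of_ne_bot (IsDiscreteValuationRing.not_a_field R)
  rw [← huniq _ (maximalIdeal.isMaximal B)] at hover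
  exact ne_bot_of_le_ne_bot hm0
    (Ideal.map_le_of_le_comap ((maximalIdeal B).over_def (maximalIdeal R)).le)

theorem exists_sub_mem_of_totallyRamified [IsLocalRing B] (b : B) :
    ∃ r : R, b - algebraMap R B r ∈ maximalIdeal B := by
  obtain ⟨q, hq, hover, hdeg, -⟩ := exists_unique_prime_of_totallyRamified hram
  obtain rfl := eq_maximalIdeal hq
  rw [Ideal.inertiaDeg_eq_of_isMaximal (maximalIdeal R) (maximalIdeal B)] at hdeg
  let := Ideal.Quotient.field (maximalIdeal R)
  obtain ⟨c, hc⟩ := (finrank_eq_one_iff_of_nonzero' (1 : B ⧸ maximalIdeal B) one_ne_zero).1 hdeg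
    (Ideal.Quotient.mk _ b)
  obtain ⟨r, rfl⟩ := Ideal.Quotient.mk_surjective c
  refine ⟨r, ?_⟩
  rw [← Ideal.Quotient.mk_eq_mk_iff_sub_mem, ← hc, Algebra.smul_def, mul_one]
  rfl

end TotallyRamified


/-! ### Rings of integers of totally ramified Galois extensions -/

section Integers

variable (R K F : Type*) [CommRing R] [Field K] [Algebra R K] [IsFractionRing R K]
  [Field F] [Algebra K F] [Algebra R F] [IsScalarTower R K F]

/-- The action of the Galois group on the ring of integers. -/
noncomputable def integersAut [Algebra.IsAlgebraic K F] :
    Gal(F/K) →* RingAut (integralClosure R F) where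
  toFun τ := (galRestrict R K F (integralClosure R F) τ).toRingEquiv
  map_one' := by rw [map_one]; rfl
  map_mul' τ τ' := by rw [map_mul]; rfl

variable {F}

theorem coe_integersAut [Algebra.IsAlgebraic K F] (τ : Gal(F/K)) (b : integralClosure R F) :
    (integersAut R K F τ b : F) = τ b :=
  algebraMap_galRestrict_apply R τ b

theorem integersAut_algebraMap [Algebra.IsAlgebraic K F] (τ : Gal(F/K)) (r : R) :
    integersAut R K F τ (algebraMap R _ r) = algebraMap R _ r :=
  (galRestrict R K F (integralClosure R F) τ).commutes r

variable {R K} [IsDomain R] [IsDiscreteValuationRing R] [FiniteDimensional K F]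
  (hram : (maximalIdeal R).map (algebraMap R (integralClosure R F)) =
      integersMaxIdeal R F ^ Module.finrank K F)

include hram

theorem map_maximalIdeal_integers :
    (maximalIdeal R).map (algebraMap R (integralClosure R F)) =
      Ring.jacobson (integralClosure R F) ^ Module.finrank R (integralClosure R F) := by
  have := IsIntegralClosure.isFractionRing_of_finite_extension R K F (integralClosure R F)
  rw [← IsFractionRing.finrank_eq R K (integralClosure R F) F]
  exact hram

variable [IsGalois K F]

/-- The ring of integers is local, as total ramification leaves room for one prime only. -/
theorem isDiscreteValuationRing_integers : IsDiscreteValuationRing (integralClosure R F) := by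
  have := integralClosure.isDedekindDomain R K F
  have := IsIntegralClosure.finite R K F (integralClosure R F)
  have : FaithfulSMul R F := by
    rw [faithfulSMul_iff_algebraMap_injective, IsScalarTower.algebraMap_eq R K F]
    exact (algebraMap K F).injective.comp (IsFractionRing.injective R K)
  exact isDiscreteValuationRing_of_totallyRamified (map_maximalIdeal_integers hram)

theorem exists_dvd_sub_integers {p : integralClosure R F} (hp : Irreducible p)
    (b : integralClosure R F) : ∃ r : R, p ∣ b - algebraMap R _ r := by
  have := integralClosure.isDedekindDomain R K F
  have := IsIntegralClosure.finite R K F (integralClosure R F)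
  have : FaithfulSMul R F := by
    rw [faithfulSMul_iff_algebraMap_injective, IsScalarTower.algebraMap_eq R K F]
    exact (algebraMap K F).injective.comp (IsFractionRing.injective R K)
  have := isDiscreteValuationRing_integers hram
  obtain ⟨r, hr⟩ := exists_sub_mem_of_totallyRamified (map_maximalIdeal_integers hram) b
  exact ⟨r, by rwa [hp.maximalIdeal_eq, Ideal.mem_span_singleton] at hr⟩

/-- The action of a generator of the Galois group. -/
theorem totallyRamifiedAut_integers {τ : Gal(F/K)} (hτ : ∀ g, g ∈ Subgroup.zpowers τ)
    {p : integralClosure R F} (hp : Irreducible p) :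
    TotallyRamifiedAut R (integersAut R K F τ) (Module.finrank K F) p where
  unif := hp
  order := by
    rw [← map_pow, ← IsGalois.card_aut_eq_finrank, pow_card_eq_one', map_one]
  map := integersAut_algebraMap R K τ
  fixed := by
    intro b hb
    have hb' : τ (b : F) = b := by rw [← coe_integersAut R K, hb]
    have hfix : ∀ g : Gal(F/K), g (b : F) = b := by
      intro g
      have hle : Subgroup.zpowers τ ≤ MulAction.stabilizer Gal(F/K) (b : F) :=
        (Subgroup.zpowers_le).2 hb'
      exact hle (hτ g)
    have hmem : (b : F) ∈ (⊥ : IntermediateField K F) := (IsGalois.mem_bot_iff_fixed _).2 hfix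
    obtain ⟨k, hk⟩ := IntermediateField.mem_bot.1 hmem
    have hint : IsIntegral R k := by
      rw [← isIntegral_algebraMap_iff (algebraMap K F).injective, hk]
      exact b.2
    obtain ⟨r, hr⟩ := IsIntegrallyClosed.isIntegral_iff.1 hint
    refine ⟨r, Subtype.ext ?_⟩
    rw [← hk, ← hr]
    exact IsScalarTower.algebraMap_apply R K F r
  residue := exists_dvd_sub_integers hram hp
  ramified := by
    intro π hπ
    have := isDiscreteValuationRing_integers hram
    have := IsIntegralClosure.isFractionRing_of_finite_extension R K F (integralClosure R F)
    rw [IsFractionRing.finrank_eq R K (integralClosure R F) F]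
    exact associated_algebraMap_of_totallyRamified (map_maximalIdeal_integers hram) hπ hp

/-- As the residue extension is trivial, the ramification filtration can be read off from the
action on a uniformizer. -/
theorem mem_lowerGroup_iff {p : integralClosure R F} (hp : Irreducible p) (τ : Gal(F/K)) (i : ℤ) :
    τ ∈ lowerGroup R K F i ↔ p ^ (i + 1).toNat ∣ integersAut R K F τ p - p := by
  have := isDiscreteValuationRing_integers hram
  have hJ : integersMaxIdeal R F = Ideal.span {p} := by
    rw [integersMaxIdeal, ringJacobson_eq_maximalIdeal, hp.maximalIdeal_eq]
  have hmem : τ ∈ lowerGroup R K F i ↔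
      ∀ b, p ^ (i + 1).toNat ∣ integersAut R K F τ b - b := by
    refine forall_congr' fun b => ?_
    rw [hJ, Ideal.span_singleton_pow]
    constructor
    · rintro ⟨c, hc, hcb⟩
      have : integersAut R K F τ b - b = c := by
        refine Subtype.ext ?_
        rw [hcb, AddSubgroupClass.coe_sub, coe_integersAut]
      rw [this]
      exact Ideal.mem_span_singleton.1 hc
    · intro h
      refine ⟨_, Ideal.mem_span_singleton.2 h, ?_⟩
      rw [AddSubgroupClass.coe_sub, coe_integersAut]
  rw [hmem]
  refine ⟨fun h => h p, fun h => ?_⟩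
  set m := (i + 1).toNat
  have key : ∀ s ≤ m, ∀ b, p ^ s ∣ integersAut R K F τ b - b := by
    intro s
    induction s with
    | zero => exact fun _ b => by simp
    | succ s ih =>
      intro hs b
      obtain ⟨r, c, hc⟩ := exists_dvd_sub_integers hram hp b
      have hb : b = algebraMap R _ r + p * c := by rw [← hc]; ring
      have h1 : integersAut R K F τ b - b =
          (integersAut R K F τ p - p) * integersAut R K F τ c +
            p * (integersAut R K F τ c - c) := by
        rw [hb, map_add, map_mul, integersAut_algebraMap]
        ring
      rw [h1]
      refine dvd_add (((pow_dvd_pow p hs).trans h).mul_right _) ?_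
      rw [pow_succ']
      exact mul_dvd_mul_left p (ih (by omega) c)
  exact key m le_rfl

end Integers


/-! ### Ramification jumps of totally ramified cyclic extensions -/

section ResidueChar

variable {R : Type*} [CommRing R] [IsDomain R] [IsDiscreteValuationRing R] {ℓ e : ℕ}
  (he : IsDiscreteValuationRing.addVal R (ℓ : R) = e)

include he

theorem associated_natCast_pow {π : R} (hπ : Irreducible π) : Associated (ℓ : R) (π ^ e) := by
  have h0 : (ℓ : R) ≠ 0 := by
    intro h
    rw [h, IsDiscreteValuationRing.addVal_zero] at he
    exact ENat.top_ne_natCast e he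
  obtain ⟨n, hn⟩ := IsDiscreteValuationRing.associated_pow_irreducible h0 hπ
  obtain ⟨u, hu⟩ := hn.symm
  have h1 := IsDiscreteValuationRing.addVal_def (ℓ : R) u hπ n (by rw [← hu, mul_comm])
  rw [he] at h1
  have h2 : e = n := by exact_mod_cast h1
  rw [h2]
  exact hn

theorem ramificationIndex_pos [CharP (ResidueField R) ℓ] : 0 < e := by
  by_contra! h
  obtain rfl : e = 0 := by omega
  obtain ⟨π, hπ⟩ := IsDiscreteValuationRing.exists_irreducible R
  have h1 := associated_natCast_pow he hπ
  rw [pow_zero, associated_one_iff_isUnit] at h1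
  have h2 := h1.map (residue R)
  rw [map_natCast, CharP.cast_eq_zero] at h2
  exact not_isUnit_zero h2

end ResidueChar

section Jumps

variable {R K F : Type*} [CommRing R] [IsDomain R] [IsDiscreteValuationRing R]
  [Field K] [Algebra R K] [IsFractionRing R K]
  [Field F] [Algebra K F] [Algebra R F] [IsScalarTower R K F] [FiniteDimensional K F]
  [IsGalois K F] {ℓ n e : ℕ} [hℓ : Fact ℓ.Prime] [CharP (ResidueField R) ℓ]
  (he : IsDiscreteValuationRing.addVal R (ℓ : R) = e)
  (hram : (maximalIdeal R).map (algebraMap R (integralClosure R F)) =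
      integersMaxIdeal R F ^ Module.finrank K F)
  {τ : Gal(F/K)} (hτ : ∀ g, g ∈ Subgroup.zpowers τ) (hN : Module.finrank K F = ℓ ^ n)
  {p : integralClosure R F} (hp : Irreducible p)

include he hram hτ hN

theorem cyclicTower_integers [IsDiscreteValuationRing (integralClosure R F)] :
    CyclicTower (gaussVal hp) (genericAut (integersAut R K F τ)) ℓ n (constHom _ p) e :=
  (totallyRamifiedAut_integers hram hτ hp).cyclicTower hN (ramificationIndex_pos he)
    fun _ hπ => associated_natCast_pow he hπ

theorem mem_lowerGroup_iff_le_towerJump [IsDiscreteValuationRing (integralClosure R F)] {j : ℕ}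
    (hj : j < n) (i : ℤ) :
    τ ^ ℓ ^ j ∈ lowerGroup R K F i ↔
      i ≤ towerJump (gaussVal hp) (genericAut (integersAut R K F τ)) ℓ (constHom _ p) j := by
  have S := cyclicTower_integers he hram hτ hN hp
  have h1 := S.val_pow_unif_sub hj
  have h2 := S.jump_pos hj
  rw [mem_lowerGroup_iff hram hp, ← valGE_constHom_iff hp, map_sub, map_pow,
    ← genericAut_pow_constHom]
  constructor
  · intro h
    have := valGE_le h1 h
    omega
  · exact fun h => (valGE_of_eq h1).mono (by omega)

/-- The lower and upper jumps of a totally ramified cyclic extension of degree `ℓ ^ n`. -/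
theorem exists_jumps [PerfectField (ResidueField R)] (hn : 0 < n) :
    ∃ I μ : ℕ → ℤ, IsUpperJumps ℓ n e I μ ∧
      ∀ j, j < n → ∀ i, τ ^ ℓ ^ j ∈ lowerGroup R K F i ↔ i ≤ I j := by
  have := isDiscreteValuationRing_integers hram
  obtain ⟨p, hp⟩ := IsDiscreteValuationRing.exists_irreducible (integralClosure R F)
  have S := cyclicTower_integers he hram hτ hN hp
  have A := totallyRamifiedAut_integers hram hτ hp
  have hsurj : ∀ a : ResidueField (integralClosure R F), ∃ r : R,
      residue _ (algebraMap R _ r) = a := by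
    intro a
    obtain ⟨b, rfl⟩ := residue_surjective a
    obtain ⟨r, hr⟩ := exists_dvd_sub_integers hram hp b
    refine ⟨r, ?_⟩
    rw [← sub_eq_zero, ← map_sub, residue_eq_zero_iff, hp.maximalIdeal_eq,
      Ideal.mem_span_singleton]
    exact dvd_sub_comm.1 hr
  have hmax : ∀ r ∈ maximalIdeal R, residue (integralClosure R F) (algebraMap R _ r) = 0 := by
    intro r hr
    obtain ⟨π, hπ⟩ := IsDiscreteValuationRing.exists_irreducible R
    rw [residue_eq_zero_iff, hp.maximalIdeal_eq, Ideal.mem_span_singleton,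
      A.dvd_algebraMap_iff Module.finrank_pos hπ]
    rwa [hπ.maximalIdeal_eq, Ideal.mem_span_singleton] at hr
  have hchar : CharP (ResidueField (integralClosure R F)) ℓ := by
    refine (CharP.charP_iff_prime_eq_zero hℓ.out).2 ?_
    have h1 := hmax ℓ (by rw [← residue_eq_zero_iff, map_natCast, CharP.cast_eq_zero])
    rwa [map_natCast, map_natCast] at h1
  have hroot : ∀ a : ResidueField (integralClosure R F), ∃ b, b ^ ℓ = a := by
    intro a
    obtain ⟨r, rfl⟩ := hsurj a
    have := PerfectField.toPerfectRing (K := ResidueField R) ℓ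
    obtain ⟨s, hs⟩ := surjective_frobenius (ResidueField R) ℓ (residue R r)
    obtain ⟨s, rfl⟩ := residue_surjective s
    refine ⟨residue _ (algebraMap R _ s), ?_⟩
    rw [frobenius_def, ← map_pow, ← sub_eq_zero, ← map_sub, residue_eq_zero_iff] at hs
    rw [← sub_eq_zero, ← map_pow, ← map_pow, ← map_sub, ← map_sub]
    exact hmax _ hs
  obtain ⟨μ, hμ⟩ := S.exists_isUpperJumps hn
    (fun x _ hx => A.exists_fixed_valGE_sub_pow Module.finrank_pos hroot x hx)
    (A.not_unitsAreNormLimits_one hroot hN hn (ramificationIndex_pos he)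
      fun _ hπ => associated_natCast_pow he hπ)
  exact ⟨_, μ, hμ, fun j hj i => mem_lowerGroup_iff_le_towerJump he hram hτ hN hp hj i⟩

end Jumps


section Compat

variable {R K F F' : Type*} [CommRing R] [IsDomain R] [IsDiscreteValuationRing R]
  [Field K] [Algebra R K] [IsFractionRing R K]
  [Field F] [Algebra K F] [Algebra R F] [IsScalarTower R K F] [FiniteDimensional K F]
  [IsGalois K F]
  [Field F'] [Algebra K F'] [Algebra R F'] [IsScalarTower R K F'] [FiniteDimensional K F']
  [IsGalois K F'] {ℓ m n e : ℕ} [hℓ : Fact ℓ.Prime] [CharP (ResidueField R) ℓ]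
  (he : IsDiscreteValuationRing.addVal R (ℓ : R) = e)
  (hram : (maximalIdeal R).map (algebraMap R (integralClosure R F)) =
      integersMaxIdeal R F ^ Module.finrank K F)
  (hram' : (maximalIdeal R).map (algebraMap R (integralClosure R F')) =
      integersMaxIdeal R F' ^ Module.finrank K F')
  {τ : Gal(F/K)} (hτ : ∀ g, g ∈ Subgroup.zpowers τ) (hN : Module.finrank K F = ℓ ^ m)
  {τ' : Gal(F'/K)} (hτ' : ∀ g, g ∈ Subgroup.zpowers τ') (hN' : Module.finrank K F' = ℓ ^ n)
  (ι : F →ₐ[K] F') (hι : ∀ x, τ' (ι x) = ι (τ x))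

omit [FiniteDimensional K F] [IsGalois K F] [FiniteDimensional K F'] [IsGalois K F'] in
include hι in
theorem pow_apply_algHom (s : ℕ) (x : F) : (τ' ^ s) (ι x) = ι ((τ ^ s) x) := by
  induction s with
  | zero => rfl
  | succ s ih => rw [pow_succ', pow_succ', AlgEquiv.mul_apply, AlgEquiv.mul_apply, ih, hι]

omit hℓ in
include hτ hN hτ' hι in
/-- The subfield of degree `ℓ ^ m` of a cyclic extension is the field of invariants of
`τ' ^ (ℓ ^ m)`. -/
theorem exists_algHom_eq_of_fixed {y : F'} (hy : (τ' ^ ℓ ^ m) y = y) : ∃ x, ι x = y := by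
  suffices y ∈ ι.fieldRange from this
  rw [← IsGalois.fixedField_fixingSubgroup ι.fieldRange, IntermediateField.mem_fixedField_iff]
  intro g hg
  rw [IntermediateField.mem_fixingSubgroup_iff] at hg
  have hfin : IsOfFinOrder τ' := isOfFinOrder_of_finite τ'
  obtain ⟨s, rfl⟩ := hfin.mem_powers_iff_mem_zpowers.2 (hτ' g)
  have h1 : τ ^ s = 1 := by
    ext x
    apply ι.injective
    have := hg (ι x) ⟨x, rfl⟩
    exact (pow_apply_algHom ι hι s x).symm.trans this
  have h2 : orderOf τ = ℓ ^ m := by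
    rw [orderOf_eq_card_of_forall_mem_zpowers hτ, IsGalois.card_aut_eq_finrank, hN]
  obtain ⟨r, rfl⟩ := h2 ▸ orderOf_dvd_of_pow_eq_one h1
  have hle : Subgroup.zpowers (τ' ^ ℓ ^ m) ≤ MulAction.stabilizer Gal(F'/K) y :=
    (Subgroup.zpowers_le).2 hy
  have hmem := Subgroup.npow_mem_zpowers (τ' ^ ℓ ^ m) r
  rw [← pow_mul] at hmem
  exact hle hmem

include he hram hram' hτ hN hτ' hN' hι in
/-- The jumps of a layer in lower numbering do not depend on the extension: the norm of a
uniformizer of a larger layer is a uniformizer of the smaller one, and the valuation of its ratio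
to its conjugate is known in the larger layer. -/
theorem mem_lowerGroup_algHom_iff (hmn : m ≤ n) {j : ℕ} (hj : j < m) (i : ℤ) :
    τ ^ ℓ ^ j ∈ lowerGroup R K F i ↔ τ' ^ ℓ ^ j ∈ lowerGroup R K F' i := by
  have := isDiscreteValuationRing_integers hram
  have := isDiscreteValuationRing_integers hram'
  obtain ⟨π, hπ⟩ := IsDiscreteValuationRing.exists_irreducible R
  obtain ⟨p, hp⟩ := IsDiscreteValuationRing.exists_irreducible (integralClosure R F)
  obtain ⟨p', hp'⟩ := IsDiscreteValuationRing.exists_irreducible (integralClosure R F')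
  have A := totallyRamifiedAut_integers hram hτ hp
  have A' := totallyRamifiedAut_integers hram' hτ' hp'
  have S' := cyclicTower_integers he hram' hτ' hN' hp'
  set σ' := integersAut R K F' τ' with hσ'
  let κ : integralClosure R F →ₐ[R] integralClosure R F' :=
    AlgHom.mapIntegralClosure (ι.restrictScalars R)
  have hκ : ∀ b, (κ b : F') = ι b := fun b => rfl
  have hκσ : ∀ (s : ℕ) b, κ (integersAut R K F (τ ^ s) b) = (σ' ^ s) (κ b) := by
    intro s b
    refine Subtype.ext ?_
    rw [hκ, hσ', ← map_pow, coe_integersAut, coe_integersAut, hκ, pow_apply_algHom ι hι]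
  have hκinj : Function.Injective κ := fun a b hab =>
    Subtype.ext (ι.injective (congrArg Subtype.val hab))
  have hℓpos : ∀ s : ℕ, 0 < ℓ ^ s := fun s => pow_pos hℓ.out.pos s
  -- The image of a uniformizer.
  obtain ⟨c, hc⟩ := IsDiscreteValuationRing.associated_pow_irreducible
    ((map_ne_zero_iff κ hκinj).2 hp.ne_zero) hp'
  have hcm : c = ℓ ^ (n - m) := by
    have h1 := (A.ramified π hπ).map κ
    rw [AlgHom.commutes, map_pow] at h1
    have h2 := (A'.ramified π hπ).symm.trans (h1.trans (hc.pow_pow (n := Module.finrank K F)))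
    rw [← pow_mul, hN, hN'] at h2
    have h3 := val_unique (A'.gaussVal_constHom (Associated.refl _)) (A'.gaussVal_constHom h2)
    have h4 : ℓ ^ n = c * ℓ ^ m := by exact_mod_cast h3
    refine Nat.eq_of_mul_eq_mul_right (hℓpos m) ?_
    rw [← h4, ← pow_add, Nat.sub_add_cancel hmn]
  -- The norm of `p'` comes from the smaller layer.
  obtain ⟨q, hq⟩ : ∃ q, constHom _ (κ q) = towerUnif (genericAut σ') ℓ n (constHom _ p') m := by
    set P := ∏ s ∈ Finset.range (ℓ ^ (n - m)), ((σ' ^ ℓ ^ m) ^ s) p' with hP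
    have hPt : constHom _ P = towerUnif (genericAut σ') ℓ n (constHom _ p') m := by
      rw [towerUnif, normProd, hP, map_prod]
      refine Finset.prod_congr rfl fun s _ => ?_
      rw [← pow_mul, ← pow_mul, genericAut_pow_constHom]
    have hPfix : (τ' ^ ℓ ^ m) (P : F') = P := by
      have h1 := S'.map_towerUnif hmn
      rw [← hPt, genericAut_pow_constHom] at h1
      have h2 := constHom_injective h1
      rw [← coe_integersAut R K, map_pow, ← hσ', h2]
    obtain ⟨x, hx⟩ := exists_algHom_eq_of_fixed hτ hN hτ' ι hι hPfix
    have hint : IsIntegral R x := by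
      rw [← isIntegral_algHom_iff (ι.restrictScalars R) ι.injective]
      change IsIntegral R (ι x)
      rw [hx]
      exact P.2
    refine ⟨⟨x, hint⟩, ?_⟩
    rw [← hPt]
    exact congrArg _ (Subtype.ext hx)
  have hqv := S'.val_towerUnif m
  rw [← hq] at hqv
  have hq0 : q ≠ 0 := by
    rintro rfl
    rw [map_zero, map_zero] at hqv
    exact ne_zero_of_val_eq hqv rfl
  have hqp : Associated q p := by
    obtain ⟨a, ha⟩ := IsDiscreteValuationRing.associated_pow_irreducible hq0 hp
    have h1 := ha.map κ
    rw [map_pow] at h1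
    have h2 := h1.trans (hc.pow_pow (n := a))
    rw [← pow_mul] at h2
    have h3 := val_unique hqv (A'.gaussVal_constHom h2)
    rw [hcm] at h3
    have h4 : ℓ ^ (n - m) * 1 = ℓ ^ (n - m) * a := by
      rw [mul_one]
      exact_mod_cast h3
    obtain rfl := Nat.eq_of_mul_eq_mul_left (hℓpos _) h4
    rwa [pow_one] at ha
  have hqi : Irreducible q := hqp.symm.irreducible hp
  have S := cyclicTower_integers he hram hτ hN hqi
  rw [mem_lowerGroup_iff_le_towerJump he hram hτ hN hqi hj,
    mem_lowerGroup_iff_le_towerJump he hram' hτ' hN' hp' (hj.trans_le hmn)]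
  suffices towerJump (gaussVal hqi) (genericAut (integersAut R K F τ)) ℓ (constHom _ q) j =
      towerJump (gaussVal hp') (genericAut σ') ℓ (constHom _ p') j by rw [this]
  set I := towerJump (gaussVal hqi) (genericAut (integersAut R K F τ)) ℓ (constHom _ q) j with hI
  set I' := towerJump (gaussVal hp') (genericAut σ') ℓ (constHom _ p') j with hI'
  -- Compute the valuation of `σ' ^ (ℓ ^ j) q - q` in two ways.
  have h1 : gaussVal hp' (constHom _ (κ (integersAut R K F (τ ^ ℓ ^ j) q - q))) =
      ((ℓ ^ (n - m) * (1 + I) : ℤ) : WithTop ℤ) := by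
    have hpos := S.jump_pos hj
    have hv := S.val_pow_unif_sub hj
    rw [genericAut_pow_constHom, ← map_sub, ← map_pow] at hv
    have hne : integersAut R K F (τ ^ ℓ ^ j) q - q ≠ 0 := by
      intro h0
      rw [h0, map_zero] at hv
      exact ne_zero_of_val_eq hv rfl
    obtain ⟨a, ha⟩ := IsDiscreteValuationRing.associated_pow_irreducible hne hqi
    have B := totallyRamifiedAut_integers hram hτ hqi
    have haI := val_unique hv (B.gaussVal_constHom ha)
    have h2 : Associated (κ _) (κ (q ^ a)) := ha.map κ
    rw [map_pow κ] at h2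
    have h3 := h2.trans ((((hqp.map κ).trans hc)).pow_pow (n := a))
    rw [← pow_mul, hcm] at h3
    rw [A'.gaussVal_constHom h3]
    rw [haI]
    push_cast
    rfl
  have h2 := S'.val_towerUnif_ratio hj hmn
  rw [← hq, genericAut_pow_constHom, ← hκσ] at h2
  have h3 : constHom _ (κ q) ≠ 0 := ne_zero_of_val_eq hqv
  have h4 := val_mul_eq h2 hqv
  rw [sub_mul, div_mul_cancel₀ _ h3, one_mul, ← map_sub, ← map_sub] at h4
  have h5 := val_unique h1 h4
  have h6 : (0 : ℤ) < ℓ ^ (n - m) := by exact_mod_cast hℓpos _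
  have h7 : (ℓ : ℤ) ^ (n - m) * (1 + I) = ℓ ^ (n - m) * (1 + I') := by rw [h5]; ring
  have h8 := mul_left_cancel₀ h6.ne' h7
  omega

end Compat


/-! ### Herbrand's function of a cyclic extension -/

/-- A subgroup of a cyclic `ℓ`-group is determined by the least power of `ℓ` that it contains as
a power of a generator. -/
theorem subgroup_eq_zpowers_pow {G : Type*} [Group G] {ℓ n j : ℕ} (hℓ : ℓ.Prime) {τ : G}
    (hτ : ∀ g, g ∈ Subgroup.zpowers τ) (hord : τ ^ ℓ ^ n = 1) {H : Subgroup G}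
    (hmem : τ ^ ℓ ^ j ∈ H) (hnot : ∀ k, k + 1 = j → τ ^ ℓ ^ k ∉ H) :
    H = Subgroup.zpowers (τ ^ ℓ ^ j) := by
  refine le_antisymm (fun h hh => ?_) (Subgroup.zpowers_le.2 hmem)
  obtain ⟨s, rfl⟩ := hτ h
  obtain ⟨a, -, ha⟩ := (Nat.dvd_prime_pow hℓ).1 (Nat.gcd_dvd_right s.natAbs (ℓ ^ n))
  have haH : τ ^ ℓ ^ a ∈ H := by
    have hb := Int.gcd_eq_gcd_ab s ((ℓ ^ n : ℕ) : ℤ)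
    have hg : Int.gcd s ((ℓ ^ n : ℕ) : ℤ) = ℓ ^ a := by
      rw [← ha]
      rfl
    rw [hg] at hb
    have h1 : τ ^ ℓ ^ a = (τ ^ s) ^ (s.gcdA ((ℓ ^ n : ℕ) : ℤ)) := by
      rw [← zpow_natCast, hb, zpow_add, zpow_mul, zpow_mul, zpow_natCast, hord, one_zpow, mul_one]
    rw [h1]
    exact H.zpow_mem hh _
  have hja : j ≤ a := by
    by_contra! hlt
    obtain ⟨k, rfl⟩ : ∃ k, j = k + 1 := ⟨j - 1, by omega⟩
    refine hnot k rfl ?_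
    obtain ⟨d, rfl⟩ := Nat.exists_eq_add_of_le (show a ≤ k by omega)
    rw [pow_add, pow_mul]
    exact H.pow_mem haH _
  have hdvd : ((ℓ ^ j : ℕ) : ℤ) ∣ s := by
    refine Int.natCast_dvd.2 ((pow_dvd_pow ℓ hja).trans ?_)
    rw [← ha]
    exact Nat.gcd_dvd_left _ _
  obtain ⟨r, rfl⟩ := hdvd
  change τ ^ (_ : ℤ) ∈ _
  rw [zpow_mul, zpow_natCast]
  exact Subgroup.zpow_mem_zpowers _ r

theorem card_zpowers_pow {G : Type*} [Group G] {ℓ n j : ℕ} (hℓ : ℓ.Prime) {τ : G}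
    (hord : orderOf τ = ℓ ^ n) (hj : j ≤ n) :
    Nat.card (Subgroup.zpowers (τ ^ ℓ ^ j)) = ℓ ^ (n - j) := by
  rw [Nat.card_zpowers, orderOf_pow_of_dvd (pow_ne_zero _ hℓ.ne_zero)
    (hord ▸ pow_dvd_pow ℓ hj), hord, Nat.pow_div hj hℓ.pos]

/-- The sequence of jumps, preceded by the conventional value `-1`. -/
def shiftJump (I : ℕ → ℤ) : ℕ → ℤ
  | 0 => -1
  | j + 1 => I j

section LowerGroup

variable {R K F : Type*} [CommRing R] [Field K] [Field F]
  [Algebra R K] [Algebra K F] [Algebra R F] [IsScalarTower R K F]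

theorem lowerGroup_antitone : Antitone (lowerGroup R K F) := by
  intro i i' h τ hτ b
  obtain ⟨c, hc, hcb⟩ := hτ b
  exact ⟨c, Ideal.pow_le_pow_right (by omega) hc, hcb⟩

variable {ℓ n : ℕ} (hℓ : ℓ.Prime) {τ : Gal(F/K)}
  (hτ : ∀ g, g ∈ Subgroup.zpowers τ) (hord : orderOf τ = ℓ ^ n) {I : ℕ → ℤ}
  (hI : ∀ j, j < n → ∀ i, τ ^ ℓ ^ j ∈ lowerGroup R K F i ↔ i ≤ I j)

include hℓ hτ hord hI

theorem lowerGroup_eq_zpowers {j : ℕ} (hj : j ≤ n) {i : ℤ} (h1 : shiftJump I j < i)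
    (h2 : j < n → i ≤ shiftJump I (j + 1)) :
    lowerGroup R K F i = Subgroup.zpowers (τ ^ ℓ ^ j) := by
  have hord' : τ ^ ℓ ^ n = 1 := by rw [← hord, pow_orderOf_eq_one]
  refine subgroup_eq_zpowers_pow hℓ hτ hord' ?_ ?_
  · rcases hj.lt_or_eq with hj | rfl
    · exact (hI j hj i).2 (h2 hj)
    · rw [hord']
      exact one_mem _
  · rintro k rfl hk
    exact absurd ((hI k (by omega) i).1 hk) (not_le.2 h1)

end LowerGroup

section UpperJumps

variable {ℓ n : ℕ} {e : ℤ} {I μ : ℕ → ℤ} (hℓ : 2 ≤ ℓ) (he : 0 < e) (hμ : IsUpperJumps ℓ n e I μ)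

include hℓ he hμ

theorem IsUpperJumps.one_le_and_lt {j : ℕ} (hj : j + 1 < n) : 1 ≤ μ j ∧ μ j < μ (j + 1) := by
  have hℓ' : (2 : ℤ) ≤ ℓ := by exact_mod_cast hℓ
  have step : ∀ j, j + 1 < n → 1 ≤ μ j → μ j < μ (j + 1) := by
    intro j hj h1
    rcases le_or_gt e ((ℓ - 1) * μ j) with h | h
    · have := hμ.stable j hj h
      omega
    · have := (hμ.unstable j hj h).1
      nlinarith
  induction j with
  | zero => exact ⟨hμ.pos, step 0 hj hμ.pos⟩
  | succ j ih =>
    have h1 := ih (by omega)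
    have h2 : 1 ≤ μ (j + 1) := by omega
    exact ⟨h2, step _ hj h2⟩

theorem IsUpperJumps.shiftJump_lt {j : ℕ} (hj : j < n) :
    shiftJump μ j < shiftJump μ (j + 1) := by
  cases j with
  | zero =>
    have := hμ.pos
    change -1 < μ 0
    omega
  | succ j => exact (hμ.one_le_and_lt hℓ he hj).2

theorem IsUpperJumps.shiftJump_lower_lt {j : ℕ} (hj : j < n) :
    shiftJump I j < shiftJump I (j + 1) := by
  cases j with
  | zero =>
    have := hμ.pos
    have := hμ.zero
    change -1 < I 0
    omega
  | succ j =>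
    have h1 := hμ.succ j hj
    have h2 := (hμ.one_le_and_lt hℓ he hj).2
    have h3 : (0 : ℤ) < ℓ ^ (j + 1) := by positivity
    change I j < I (j + 1)
    nlinarith [mul_pos h3 (sub_pos.2 h2)]

theorem IsUpperJumps.neg_one_le_shiftJump_lower {j : ℕ} (hj : j ≤ n) : -1 ≤ shiftJump I j := by
  induction j with
  | zero => exact le_rfl
  | succ j ih => exact (ih (by omega)).trans (hμ.shiftJump_lower_lt hℓ he hj).le

omit hℓ he in
theorem IsUpperJumps.shiftJump_lower_sub {j : ℕ} (hj : j < n) :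
    shiftJump I (j + 1) - shiftJump I j = ℓ ^ j * (shiftJump μ (j + 1) - shiftJump μ j) := by
  cases j with
  | zero =>
    change I 0 - -1 = ℓ ^ 0 * (μ 0 - -1)
    rw [hμ.zero]
    ring
  | succ j => exact hμ.succ j hj

end UpperJumps

section Herbrand

open MeasureTheory

variable {R K F : Type*} [CommRing R] [Field K] [Field F]
  [Algebra R K] [Algebra K F] [Algebra R F] [IsScalarTower R K F] [FiniteDimensional K F]

theorem antitone_herbrandIntegrand : Antitone fun t : ℝ =>
    (Nat.card (lowerGroup R K F ⌈t⌉) : ℝ) / (Nat.card (lowerGroup R K F 0) : ℝ) := by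
  intro s t hst
  refine div_le_div_of_nonneg_right ?_ (Nat.cast_nonneg _)
  exact_mod_cast Subgroup.card_le_of_le (lowerGroup_antitone (Int.ceil_mono hst))

theorem herbrandPhi_sub (u v : ℝ) : herbrandPhi R K F v - herbrandPhi R K F u =
    ∫ t in u..v,
      (Nat.card (lowerGroup R K F ⌈t⌉) : ℝ) / (Nat.card (lowerGroup R K F 0) : ℝ) :=
  intervalIntegral.integral_interval_sub_left antitone_herbrandIntegrand.intervalIntegrable
    antitone_herbrandIntegrand.intervalIntegrable

theorem herbrandPhi_strictMono : StrictMono (herbrandPhi R K F) := by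
  intro u v huv
  rw [← sub_pos, herbrandPhi_sub]
  refine intervalIntegral.intervalIntegral_pos_of_pos
    antitone_herbrandIntegrand.intervalIntegrable (fun t => ?_) huv
  have h1 : 0 < Nat.card (lowerGroup R K F ⌈t⌉) := Nat.card_pos
  have h2 : 0 < Nat.card (lowerGroup R K F 0) := Nat.card_pos
  positivity

/-- On an interval where the ramification groups have constant order, `φ` is affine. -/
theorem herbrandPhi_sub_of_card {u v : ℝ} (huv : u ≤ v) {c : ℝ}
    (hc : ∀ t, u < t → t ≤ v → (Nat.card (lowerGroup R K F ⌈t⌉) : ℝ) /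
      (Nat.card (lowerGroup R K F 0) : ℝ) = c) :
    herbrandPhi R K F v - herbrandPhi R K F u = (v - u) * c := by
  rw [herbrandPhi_sub, intervalIntegral.integral_congr_ae (g := fun _ => c),
    intervalIntegral.integral_const, smul_eq_mul]
  refine Filter.Eventually.of_forall fun t ht => ?_
  rw [Set.uIoc_of_le huv] at ht
  exact hc t ht.1 ht.2

theorem herbrandPhi_neg_one : herbrandPhi R K F (-1) = -1 := by
  have h0 : herbrandPhi R K F 0 = 0 := intervalIntegral.integral_same
  have h1 := herbrandPhi_sub_of_card (R := R) (K := K) (F := F) (u := -1) (v := 0) (by norm_num)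
    (c := 1) (fun t ht ht' => by
      have h2 : ⌈t⌉ = 0 := by
        rw [Int.ceil_eq_iff]
        constructor
        · push_cast; linarith
        · exact_mod_cast ht'
      have h3 : 0 < Nat.card (lowerGroup R K F 0) := Nat.card_pos
      rw [h2]
      exact div_self (by positivity))
  linarith

theorem herbrandPsi_eq {u x : ℝ} (hu : -1 ≤ u) (hx : herbrandPhi R K F u = x) :
    herbrandPsi R K F x = u := by
  rw [← hx]
  exact (herbrandPhi_strictMono.injective.injOn).leftInvOn_invFunOn hu

variable {ℓ n : ℕ} (hℓ : ℓ.Prime) {τ : Gal(F/K)}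
  (hτ : ∀ g, g ∈ Subgroup.zpowers τ) (hord : orderOf τ = ℓ ^ n) {e : ℤ} {I μ : ℕ → ℤ}
  (he : 0 < e) (hμ : IsUpperJumps ℓ n e I μ)
  (hI : ∀ j, j < n → ∀ i, τ ^ ℓ ^ j ∈ lowerGroup R K F i ↔ i ≤ I j)

include hℓ hτ hord he hμ hI

/-- Herbrand's function is piecewise linear; it maps the lower jumps to the upper jumps. -/
theorem herbrandPhi_eq {j : ℕ} (hj : j ≤ n) {u : ℝ} (h1 : shiftJump I j ≤ u)
    (h2 : j < n → u ≤ shiftJump I (j + 1)) :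
    herbrandPhi R K F u = shiftJump μ j + (u - shiftJump I j) / ℓ ^ j := by
  have hℓ0 : (ℓ : ℝ) ≠ 0 := by exact_mod_cast hℓ.ne_zero
  have hG0 : Nat.card (lowerGroup R K F 0) = ℓ ^ n := by
    have h3 : lowerGroup R K F 0 = Subgroup.zpowers (τ ^ ℓ ^ 0) := by
      refine lowerGroup_eq_zpowers hℓ hτ hord hI (Nat.zero_le n)
        (show (-1 : ℤ) < 0 by norm_num) fun _ => ?_
      change 0 ≤ I 0
      have := hμ.zero
      have := hμ.pos
      omega
    rw [h3, card_zpowers_pow hℓ hord (Nat.zero_le n), Nat.sub_zero]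
  have hslope : ∀ j, j ≤ n → ∀ u : ℝ, shiftJump I j ≤ u → (j < n → u ≤ shiftJump I (j + 1)) →
      herbrandPhi R K F u - herbrandPhi R K F (shiftJump I j) =
        (u - shiftJump I j) / ℓ ^ j := by
    intro j hj u h1 h2
    rw [herbrandPhi_sub_of_card h1 (c := (ℓ ^ j)⁻¹), div_eq_mul_inv]
    intro t ht ht'
    have h3 : lowerGroup R K F ⌈t⌉ = Subgroup.zpowers (τ ^ ℓ ^ j) := by
      refine lowerGroup_eq_zpowers hℓ hτ hord hI hj (Int.lt_ceil.2 ht) fun hjn => ?_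
      exact Int.ceil_le.2 (ht'.trans (h2 hjn))
    rw [h3, card_zpowers_pow hℓ hord hj, hG0]
    push_cast
    rw [div_eq_iff (pow_ne_zero _ hℓ0), eq_comm, inv_mul_eq_iff_eq_mul₀ (pow_ne_zero _ hℓ0),
      ← pow_add, Nat.add_sub_cancel' hj]
  have hjump : ∀ j, j ≤ n → herbrandPhi R K F (shiftJump I j) = shiftJump μ j := by
    intro j
    induction j with
    | zero =>
      intro _
      have h3 : ((shiftJump I 0 : ℤ) : ℝ) = -1 := by norm_num [shiftJump]
      have h4 : ((shiftJump μ 0 : ℤ) : ℝ) = -1 := by norm_num [shiftJump]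
      rw [h3, h4, herbrandPhi_neg_one]
    | succ j ih =>
      intro hj
      have h3 := hslope j (by omega) (shiftJump I (j + 1))
        (by exact_mod_cast (hμ.shiftJump_lower_lt hℓ.two_le he hj).le) (fun _ => le_rfl)
      rw [ih (by omega)] at h3
      have h4 : ((shiftJump I (j + 1) : ℤ) : ℝ) - shiftJump I j =
          ℓ ^ j * (shiftJump μ (j + 1) - shiftJump μ j) := by
        exact_mod_cast hμ.shiftJump_lower_sub hj
      rw [h4, mul_div_cancel_left₀ _ (pow_ne_zero _ hℓ0)] at h3
      linarith
  have := hslope j hj u h1 h2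
  rw [hjump j hj] at this
  linarith

/-- The upper ramification groups of a cyclic extension of degree `ℓ ^ n`. -/
theorem upperGroup_eq_zpowers {j : ℕ} (hj : j ≤ n) {x : ℝ} (h1 : shiftJump μ j < x)
    (h2 : j < n → x ≤ shiftJump μ (j + 1)) :
    upperGroup R K F x = Subgroup.zpowers (τ ^ ℓ ^ j) := by
  have hℓ0 : (0 : ℝ) < ℓ ^ j := by
    have : (0 : ℝ) < ℓ := by exact_mod_cast hℓ.pos
    positivity
  set u : ℝ := shiftJump I j + ℓ ^ j * (x - shiftJump μ j) with hu
  have hu1 : shiftJump I j < u := by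
    have := mul_pos hℓ0 (sub_pos.2 h1)
    linarith
  have hu2 : j < n → u ≤ shiftJump I (j + 1) := by
    intro hjn
    have h4 : ((shiftJump I (j + 1) : ℤ) : ℝ) - shiftJump I j =
        ℓ ^ j * (shiftJump μ (j + 1) - shiftJump μ j) := by
      exact_mod_cast hμ.shiftJump_lower_sub hjn
    have := mul_le_mul_of_nonneg_left (sub_le_sub_right (h2 hjn) (shiftJump μ j : ℝ)) hℓ0.le
    linarith
  have hφ := herbrandPhi_eq hℓ hτ hord he hμ hI hj hu1.le hu2
  have hux : herbrandPhi R K F u = x := by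
    rw [hφ, hu]
    field_simp
    ring
  have hun : -1 ≤ u := by
    have : (-1 : ℝ) ≤ shiftJump I j := by
      exact_mod_cast hμ.neg_one_le_shiftJump_lower hℓ.two_le he hj
    linarith
  rw [upperGroup, herbrandPsi_eq hun hux]
  exact lowerGroup_eq_zpowers hℓ hτ hord hI hj (Int.lt_ceil.2 hu1)
    fun hjn => Int.ceil_le.2 (hu2 hjn)

end Herbrand


/-! ### Finite layers of a `ℤ_ℓ`-extension -/

section Layers

variable {K L : Type*} [Field K] [Field L] [Algebra K L] {ℓ : ℕ} [hℓ : Fact ℓ.Prime]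
  (Φ : Multiplicative ℤ_[ℓ] ≃ₜ* Gal(L/K))

theorem mem_levelSubgroup_iff (n : ℕ) (a : ℤ_[ℓ]) :
    Φ (Multiplicative.ofAdd a) ∈ levelSubgroup Φ n ↔ (ℓ : ℤ_[ℓ]) ^ n ∣ a := by
  rw [← Ideal.mem_span_singleton]
  constructor
  · rintro ⟨b, hb, hab⟩
    have : b = Multiplicative.ofAdd a := Φ.injective hab
    subst this
    exact hb
  · exact fun h => ⟨_, h, rfl⟩

theorem le_levelSubgroup_iff {n : ℕ} {H : Subgroup Gal(L/K)} :
    H ≤ levelSubgroup Φ n ↔ ∀ a, Φ (Multiplicative.ofAdd a) ∈ H → (ℓ : ℤ_[ℓ]) ^ n ∣ a := by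
  constructor
  · exact fun h a ha => (mem_levelSubgroup_iff Φ n a).1 (h ha)
  · intro h g hg
    obtain ⟨a, rfl⟩ := Φ.surjective g
    exact (mem_levelSubgroup_iff Φ n a.toAdd).2 (h _ hg)

theorem levelSubgroup_le_iff {n m : ℕ} : levelSubgroup Φ n ≤ levelSubgroup Φ m ↔ m ≤ n := by
  rw [le_levelSubgroup_iff]
  constructor
  · intro h
    have h1 := h (ℓ ^ n) ((mem_levelSubgroup_iff Φ n _).2 dvd_rfl)
    by_contra! hlt
    have h2 := (pow_dvd_pow_iff PadicInt.prime_p.ne_zero PadicInt.prime_p.not_isUnit).1 h1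
    omega
  · exact fun h a ha => (pow_dvd_pow _ h).trans ((mem_levelSubgroup_iff Φ n a).1 ha)

/-- The topological generator `Φ 1`, restricted to a finite layer. -/
noncomputable def layerGenerator (F : FiniteGaloisIntermediateField K L) : Gal(F/K) :=
  AlgEquiv.restrictNormalHom F (Φ (Multiplicative.ofAdd 1))

theorem restrict_natCast (F : FiniteGaloisIntermediateField K L) (s : ℕ) :
    AlgEquiv.restrictNormalHom F (Φ (Multiplicative.ofAdd (s : ℤ_[ℓ]))) =
      layerGenerator Φ F ^ s := by
  rw [layerGenerator, ← map_pow, ← map_pow, ← ofAdd_nsmul, nsmul_one]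

theorem coe_layerGenerator_apply (F : FiniteGaloisIntermediateField K L) (x : F) :
    (layerGenerator Φ F x : L) = Φ (Multiplicative.ofAdd 1) x :=
  AlgEquiv.restrictNormal_commutes _ _ x

/-- The elements of `ℤ_ℓ` that act trivially on a finite layer. They form an ideal, as a multiple
of every power of `ℓ` by the degree acts trivially. -/
theorem exists_ker_restrict_eq (F : FiniteGaloisIntermediateField K L) :
    ∃ n, (AlgEquiv.restrictNormalHom F : Gal(L/K) →* Gal(F/K)).ker = levelSubgroup Φ n := by
  set ρ : Gal(L/K) →* Gal(F/K) := AlgEquiv.restrictNormalHom F with hρ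
  set N := Nat.card Gal(F/K) with hN
  have hN0 : (N : ℤ_[ℓ]) ≠ 0 := by
    have : N ≠ 0 := Nat.card_pos.ne'
    exact_mod_cast this
  have hNmul : ∀ a : ℤ_[ℓ], ρ (Φ (Multiplicative.ofAdd (N * a))) = 1 := by
    intro a
    rw [← nsmul_eq_mul, ofAdd_nsmul, map_pow, map_pow, hN, pow_card_eq_one']
  let J : Ideal ℤ_[ℓ] :=
    { carrier := {a | ρ (Φ (Multiplicative.ofAdd a)) = 1}
      add_mem' := by
        intro a b ha hb
        rw [Set.mem_ofPred_eq, ofAdd_add, map_mul, map_mul, ha, hb, one_mul]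
      zero_mem' := by
        rw [Set.mem_ofPred_eq, ofAdd_zero, map_one, map_one]
      smul_mem' := by
        intro r a ha
        obtain ⟨u, v, huv⟩ : ∃ (u : ℤ_[ℓ]ˣ) (v : ℕ), (N : ℤ_[ℓ]) = u * (ℓ : ℤ_[ℓ]) ^ v :=
          ⟨_, _, PadicInt.unitCoeff_spec hN0⟩
        obtain ⟨t, ht⟩ := Ideal.mem_span_singleton.1 (PadicInt.appr_spec v r)
        have h1 : r • a = (r.appr v) • a + N * (↑u⁻¹ * t * a) := by
          have h2 : (N : ℤ_[ℓ]) * (↑u⁻¹ * t * a) = (ℓ : ℤ_[ℓ]) ^ v * t * a := by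
            rw [huv]
            calc _ = (↑u * ↑u⁻¹ : ℤ_[ℓ]) * ((ℓ : ℤ_[ℓ]) ^ v * t * a) := by ring
              _ = _ := by rw [Units.mul_inv, one_mul]
          rw [h2, ← ht, nsmul_eq_mul, smul_eq_mul]
          ring
        rw [Set.mem_ofPred_eq] at ha ⊢
        rw [h1, ofAdd_add, map_mul, map_mul, hNmul, mul_one, ofAdd_nsmul, map_pow, map_pow, ha,
          one_pow] }
  have hJ : J ≠ ⊥ := by
    intro h0
    have h1 : (N : ℤ_[ℓ]) ∈ J := by
      have := hNmul 1
      rwa [mul_one] at this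
    rw [h0] at h1
    exact hN0 h1
  obtain ⟨n, hn⟩ := PadicInt.ideal_eq_span_pow_p hJ
  refine ⟨n, ?_⟩
  ext g
  obtain ⟨a, rfl⟩ := Φ.surjective g
  have h1 : ρ (Φ a) = 1 ↔ a.toAdd ∈ J := Iff.rfl
  rw [MonoidHom.mem_ker, h1, hn, Ideal.mem_span_singleton]
  exact (mem_levelSubgroup_iff Φ n a.toAdd).symm

variable {Φ} {F : FiniteGaloisIntermediateField K L} {n : ℕ}
  (hker : (AlgEquiv.restrictNormalHom F : Gal(L/K) →* Gal(F/K)).ker = levelSubgroup Φ n)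

include hker

theorem restrict_eq_one_iff (a : ℤ_[ℓ]) :
    AlgEquiv.restrictNormalHom F (Φ (Multiplicative.ofAdd a)) = 1 ↔ (ℓ : ℤ_[ℓ]) ^ n ∣ a := by
  rw [← mem_levelSubgroup_iff Φ, ← hker, MonoidHom.mem_ker]

/-- On a layer of degree `ℓ ^ n`, an element of `ℤ_ℓ` acts through its residue modulo `ℓ ^ n`. -/
theorem restrict_eq_pow (a : ℤ_[ℓ]) :
    AlgEquiv.restrictNormalHom F (Φ (Multiplicative.ofAdd a)) =
      layerGenerator Φ F ^ a.appr n := by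
  rw [← restrict_natCast]
  have h1 := (restrict_eq_one_iff hker (a - a.appr n)).2
    (Ideal.mem_span_singleton.1 (PadicInt.appr_spec n a))
  rw [ofAdd_sub, map_div, map_div, div_eq_one] at h1
  exact h1

theorem mem_zpowers_layerGenerator [IsGalois K L] (g : Gal(F/K)) :
    g ∈ Subgroup.zpowers (layerGenerator Φ F) := by
  obtain ⟨γ, rfl⟩ := AlgEquiv.restrictNormalHom_surjective (F := K) (K₁ := F) L g
  obtain ⟨a, rfl⟩ := Φ.surjective γ
  have h1 := restrict_eq_pow hker a.toAdd
  change AlgEquiv.restrictNormalHom F (Φ a) = _ at h1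
  rw [h1]
  exact Subgroup.npow_mem_zpowers _ _

theorem orderOf_layerGenerator : orderOf (layerGenerator Φ F) = ℓ ^ n := by
  have h1 : ∀ s : ℕ, layerGenerator Φ F ^ s = 1 ↔ ℓ ^ n ∣ s := by
    intro s
    rw [← restrict_natCast, restrict_eq_one_iff hker]
    have := PadicInt.pow_p_dvd_int_iff (p := ℓ) n (s : ℤ)
    rw [Int.cast_natCast] at this
    rw [this]
    exact_mod_cast Iff.rfl
  exact Nat.dvd_antisymm (orderOf_dvd_of_pow_eq_one ((h1 _).2 dvd_rfl))
    ((h1 _).1 (pow_orderOf_eq_one _))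

theorem finrank_layer [IsGalois K L] : Module.finrank K F = ℓ ^ n := by
  rw [← IsGalois.card_aut_eq_finrank, ← orderOf_layerGenerator hker,
    orderOf_eq_card_of_forall_mem_zpowers (mem_zpowers_layerGenerator hker)]

theorem restrict_mem_zpowers_iff {j : ℕ} (hj : j ≤ n) (a : ℤ_[ℓ]) :
    AlgEquiv.restrictNormalHom F (Φ (Multiplicative.ofAdd a)) ∈
      Subgroup.zpowers (layerGenerator Φ F ^ ℓ ^ j) ↔ (ℓ : ℤ_[ℓ]) ^ j ∣ a := by
  constructor
  · intro h
    obtain ⟨s, hs⟩ := (isOfFinOrder_of_finite _).mem_powers_iff_mem_zpowers.2 h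
    change (layerGenerator Φ F ^ ℓ ^ j) ^ s = _ at hs
    rw [← pow_mul, ← restrict_natCast, eq_comm, ← div_eq_one, ← map_div, ← map_div, ← ofAdd_sub,
      restrict_eq_one_iff hker] at hs
    have h1 := (pow_dvd_pow (ℓ : ℤ_[ℓ]) hj).trans hs
    have h2 : (ℓ : ℤ_[ℓ]) ^ j ∣ ((ℓ ^ j * s : ℕ) : ℤ_[ℓ]) := by
      push_cast
      exact Dvd.intro _ rfl
    simpa using dvd_add h1 h2
  · rintro ⟨b, rfl⟩
    have h1 : (ℓ : ℤ_[ℓ]) ^ j * b = (ℓ ^ j) • b := by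
      rw [nsmul_eq_mul]
      push_cast
      rfl
    rw [h1, ofAdd_nsmul, map_pow, map_pow, restrict_eq_pow hker, ← pow_mul, mul_comm, pow_mul]
    exact Subgroup.npow_mem_zpowers _ _

end Layers

section Existence

variable {K L : Type*} [Field K] [Field L] [Algebra K L] {ℓ : ℕ} [hℓ : Fact ℓ.Prime]
  (Φ : Multiplicative ℤ_[ℓ] ≃ₜ* Gal(L/K))

theorem isOpen_levelSubgroup (n : ℕ) : IsOpen (levelSubgroup Φ n : Set Gal(L/K)) := by
  have h1 : (levelSubgroup Φ n : Set Gal(L/K)) =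
      Φ.toHomeomorph.symm ⁻¹' (Multiplicative.toAdd ⁻¹'
        (Metric.closedBall (0 : ℤ_[ℓ]) ((ℓ : ℝ) ^ (-(n : ℤ))))) := by
    ext g
    obtain ⟨a, rfl⟩ := Φ.surjective g
    have h2 := mem_levelSubgroup_iff Φ n a.toAdd
    have h3 : Φ.toHomeomorph.symm (Φ a) = a := Φ.toHomeomorph.symm_apply_apply a
    rw [Set.mem_preimage, Set.mem_preimage, h3, mem_closedBall_zero_iff,
      PadicInt.norm_le_pow_iff_mem_span_pow, Ideal.mem_span_singleton, ← h2]
    rfl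
  rw [h1]
  refine IsOpen.preimage Φ.toHomeomorph.symm.continuous (IsOpen.preimage continuous_toAdd ?_)
  refine IsUltrametricDist.isOpen_closedBall _ ?_
  have : (0 : ℝ) < ℓ := by exact_mod_cast hℓ.out.pos
  positivity

variable [IsGalois K L]

/-- Every level of the group is cut out by a finite layer. -/
theorem exists_layer (n : ℕ) : ∃ F : FiniteGaloisIntermediateField K L,
    (AlgEquiv.restrictNormalHom F : Gal(L/K) →* Gal(F/K)).ker = levelSubgroup Φ n := by
  let H : ClosedSubgroup Gal(L/K) :=
    ⟨levelSubgroup Φ n, Subgroup.isClosed_of_isOpen _ (isOpen_levelSubgroup Φ n)⟩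
  have hfix := InfiniteGalois.fixingSubgroup_fixedField H
  have hfin : FiniteDimensional K (IntermediateField.fixedField (H : Subgroup Gal(L/K))) := by
    rw [← InfiniteGalois.isOpen_iff_finite]
    change IsOpen ((IntermediateField.fixedField (H : Subgroup Gal(L/K))).fixingSubgroup :
      Set Gal(L/K))
    rw [hfix]
    exact isOpen_levelSubgroup Φ n
  have hcomm : ∀ g h : Gal(L/K), g * h = h * g := by
    intro g h
    obtain ⟨a, rfl⟩ := Φ.surjective g
    obtain ⟨b, rfl⟩ := Φ.surjective h
    rw [← map_mul, mul_comm, map_mul]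
  have hgal : IsGalois K (IntermediateField.fixedField (H : Subgroup Gal(L/K))) := by
    rw [← InfiniteGalois.normal_iff_isGalois]
    exact ⟨fun a ha g => by rwa [hcomm g a, mul_assoc, mul_inv_cancel, mul_one]⟩
  refine ⟨⟨IntermediateField.fixedField (H : Subgroup Gal(L/K))⟩, ?_⟩
  exact (IntermediateField.restrictNormalHom_ker _).trans hfix

theorem le_of_ker_le {F F' : FiniteGaloisIntermediateField K L}
    (h : (AlgEquiv.restrictNormalHom F' : Gal(L/K) →* Gal(F'/K)).ker ≤
      (AlgEquiv.restrictNormalHom F : Gal(L/K) →* Gal(F/K)).ker) :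
    F.toIntermediateField ≤ F'.toIntermediateField := by
  have h1 := (IntermediateField.restrictNormalHom_ker F.toIntermediateField)
  have h2 := (IntermediateField.restrictNormalHom_ker F'.toIntermediateField)
  rw [← InfiniteGalois.fixedField_fixingSubgroup F.toIntermediateField,
    ← InfiniteGalois.fixedField_fixingSubgroup F'.toIntermediateField]
  refine IntermediateField.fixedField_antitone ?_
  rw [← h1, ← h2]
  exact h

end Existence


/-! ### The ramification of a `ℤ_ℓ`-extension -/

section Congr

variable {ℓ m n : ℕ} {e : ℤ} {I I' μ μ' : ℕ → ℤ}

theorem IsUpperJumps.eq_of_eq (hℓ : 0 < ℓ) (h : IsUpperJumps ℓ m e I μ)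
    (h' : IsUpperJumps ℓ n e I' μ') (hI : ∀ j, j < m → j < n → I j = I' j) {j : ℕ} (hm : j < m)
    (hn : j < n) : μ j = μ' j := by
  induction j with
  | zero => rw [h.zero, h'.zero, hI 0 hm hn]
  | succ j ih =>
    have h1 := h.succ j hm
    have h2 := h'.succ j hn
    rw [hI _ hm hn, hI j (by omega) (by omega), h2, ih (by omega) (by omega)] at h1
    have h3 : (ℓ : ℤ) ^ (j + 1) ≠ 0 := by positivity
    have := mul_left_cancel₀ h3 h1
    omega

theorem IsUpperJumps.congr (hn : 0 < n) (h : IsUpperJumps ℓ n e I μ)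
    (hI : ∀ j, j < n → I j = I' j) (hμ : ∀ j, j < n → μ j = μ' j) :
    IsUpperJumps ℓ n e I' μ' where
  zero := by rw [← hI 0 hn, ← hμ 0 hn, h.zero]
  succ j hj := by
    rw [← hI _ hj, ← hI j (by omega), ← hμ _ hj, ← hμ j (by omega), h.succ j hj]
  pos := by rw [← hμ 0 hn]; exact h.pos
  zero_le := by rw [← hμ 0 hn]; exact h.zero_le
  stable j hj := by rw [← hμ _ hj, ← hμ j (by omega)]; exact h.stable j hj
  unstable j hj := by rw [← hμ _ hj, ← hμ j (by omega)]; exact h.unstable j hj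

theorem IsUpperJumps.of_le (h : IsUpperJumps ℓ n e I μ) (hmn : m ≤ n) :
    IsUpperJumps ℓ m e I μ where
  zero := h.zero
  succ j hj := h.succ j (hj.trans_le hmn)
  pos := h.pos
  zero_le := h.zero_le
  stable j hj := h.stable j (hj.trans_le hmn)
  unstable j hj := h.unstable j (hj.trans_le hmn)

end Congr

section GlobalJumps

variable {R K L : Type*} [CommRing R] [IsDomain R] [IsDiscreteValuationRing R]
  [Field K] [Algebra R K] [IsFractionRing R K]
  [Field L] [Algebra K L] [IsGalois K L] [Algebra R L] [IsScalarTower R K L]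
  {ℓ e : ℕ} [hℓ : Fact ℓ.Prime] [CharP (ResidueField R) ℓ] [PerfectField (ResidueField R)]
  (he : IsDiscreteValuationRing.addVal R (ℓ : R) = e)
  (htot : IsTotallyRamified R K L) (Φ : Multiplicative ℤ_[ℓ] ≃ₜ* Gal(L/K))

include he htot

omit [PerfectField (ResidueField R)] in
theorem mem_lowerGroup_layer_iff {F F' : FiniteGaloisIntermediateField K L} {m n : ℕ}
    (hF : (AlgEquiv.restrictNormalHom F : Gal(L/K) →* Gal(F/K)).ker = levelSubgroup Φ m)
    (hF' : (AlgEquiv.restrictNormalHom F' : Gal(L/K) →* Gal(F'/K)).ker = levelSubgroup Φ n)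
    (hmn : m ≤ n) {j : ℕ} (hj : j < m) (i : ℤ) :
    layerGenerator Φ F ^ ℓ ^ j ∈ lowerGroup R K F i ↔
      layerGenerator Φ F' ^ ℓ ^ j ∈ lowerGroup R K F' i := by
  have hle : F.toIntermediateField ≤ F'.toIntermediateField :=
    le_of_ker_le (by rw [hF, hF']; exact (levelSubgroup_le_iff Φ).2 hmn)
  refine mem_lowerGroup_algHom_iff he (htot F.toIntermediateField inferInstance)
    (htot F'.toIntermediateField inferInstance) (mem_zpowers_layerGenerator hF) (finrank_layer hF)
    (mem_zpowers_layerGenerator hF') (finrank_layer hF') (IntermediateField.inclusion hle) ?_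
    hmn hj i
  intro x
  apply Subtype.ext
  rw [coe_layerGenerator_apply]
  exact (coe_layerGenerator_apply Φ F x).symm

/-- The jumps of all finite layers fit together to two infinite sequences. -/
theorem exists_jumps_layers : ∃ I μ : ℕ → ℤ, (∀ n, IsUpperJumps ℓ n e I μ) ∧
    ∀ (n : ℕ) (F : FiniteGaloisIntermediateField K L),
      (AlgEquiv.restrictNormalHom F : Gal(L/K) →* Gal(F/K)).ker = levelSubgroup Φ n →
      ∀ j, j < n → ∀ i, layerGenerator Φ F ^ ℓ ^ j ∈ lowerGroup R K F i ↔ i ≤ I j := by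
  choose E hE using exists_layer Φ
  have hex := fun k => exists_jumps he (htot (E (k + 1)).toIntermediateField inferInstance)
    (mem_zpowers_layerGenerator (hE (k + 1))) (finrank_layer (hE (k + 1))) (Nat.succ_pos k)
  choose I μ hμ hI using hex
  have hmem : ∀ (n : ℕ) (F : FiniteGaloisIntermediateField K L),
      (AlgEquiv.restrictNormalHom F : Gal(L/K) →* Gal(F/K)).ker = levelSubgroup Φ n →
      ∀ j, j < n → ∀ i, layerGenerator Φ F ^ ℓ ^ j ∈ lowerGroup R K F i ↔ i ≤ I j j :=
    fun n F hF j hj i => (mem_lowerGroup_layer_iff he htot Φ (hE (j + 1)) hF hj j.lt_succ_self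
      i).symm.trans (hI j j j.lt_succ_self i)
  have hIeq : ∀ k j, j < k + 1 → I k j = I j j := fun k j hj =>
    eq_of_forall_le_iff fun i => (hI k j hj i).symm.trans (hmem (k + 1) _ (hE _) j hj i)
  have hμeq : ∀ k j, j < k + 1 → μ k j = μ j j := fun k j hj =>
    (hμ k).eq_of_eq hℓ.out.pos (hμ j)
      (fun i hi hi' => (hIeq k i hi).trans (hIeq j i hi').symm) hj j.lt_succ_self
  exact ⟨fun j => I j j, fun j => μ j j,
    fun n => ((hμ n).congr n.succ_pos (hIeq n) (hμeq n)).of_le n.le_succ, hmem⟩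

end GlobalJumps

section ShiftJump

variable {ℓ : ℕ} {e : ℤ} {I μ : ℕ → ℤ} (hℓ : 2 ≤ ℓ) (he : 0 < e)
  (hμ : ∀ n, IsUpperJumps ℓ n e I μ)

include hℓ he hμ

theorem shiftJump_strictMono : StrictMono (shiftJump μ) :=
  strictMono_nat_of_lt_succ fun j => (hμ (j + 1)).shiftJump_lt hℓ he j.lt_succ_self

theorem le_shiftJump (j : ℕ) : (j : ℤ) - 1 ≤ shiftJump μ j := by
  induction j with
  | zero => exact le_rfl
  | succ j ih =>
    have := shiftJump_strictMono hℓ he hμ (Nat.lt_add_one j)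
    push_cast
    omega

/-- The intervals between consecutive jumps cover the half-line above any of them. -/
theorem exists_shiftJump_lt_le {i : ℕ} {x : ℝ} (hx : shiftJump μ i < x) :
    ∃ k, i ≤ k ∧ shiftJump μ k < x ∧ x ≤ shiftJump μ (k + 1) := by
  have hex : ∃ k, x ≤ shiftJump μ (k + 1) := by
    obtain ⟨k, hk⟩ := exists_nat_ge x
    refine ⟨k, hk.trans ?_⟩
    have := le_shiftJump hℓ he hμ (k + 1)
    exact_mod_cast (by push_cast at this; omega : (k : ℤ) ≤ shiftJump μ (k + 1))
  classical
  refine ⟨Nat.find hex, ?_, ?_, Nat.find_spec hex⟩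
  · by_contra! hlt
    have h1 := (shiftJump_strictMono hℓ he hμ).monotone (Nat.succ_le_of_lt hlt)
    have h2 : ((shiftJump μ (Nat.find hex + 1) : ℤ) : ℝ) ≤ shiftJump μ i := by exact_mod_cast h1
    exact absurd (hx.trans_le ((Nat.find_spec hex).trans h2)) (lt_irrefl _)
  · rcases h : Nat.find hex with _ | k
    · have h1 := (shiftJump_strictMono hℓ he hμ).monotone (Nat.zero_le i)
      exact lt_of_le_of_lt (by exact_mod_cast h1) hx
    · exact not_le.1 (Nat.find_min hex (by omega))

end ShiftJump

section Profinite

variable {R K L : Type*} [CommRing R]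
  [Field K] [Algebra R K]
  [Field L] [Algebra K L] [IsGalois K L] [Algebra R L] [IsScalarTower R K L]
  {ℓ : ℕ} [hℓ : Fact ℓ.Prime] {Φ : Multiplicative ℤ_[ℓ] ≃ₜ* Gal(L/K)} {e : ℤ} {I μ : ℕ → ℤ}
  (he : 0 < e) (hμ : ∀ n, IsUpperJumps ℓ n e I μ)
  (hI : ∀ (n : ℕ) (F : FiniteGaloisIntermediateField K L),
      (AlgEquiv.restrictNormalHom F : Gal(L/K) →* Gal(F/K)).ker = levelSubgroup Φ n →
      ∀ j, j < n → ∀ i, layerGenerator Φ F ^ ℓ ^ j ∈ lowerGroup R K F i ↔ i ≤ I j)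

include he hμ hI

theorem profiniteUpperGroup_eq_levelSubgroup {j : ℕ} {x : ℝ} (h1 : shiftJump μ j < x)
    (h2 : x ≤ shiftJump μ (j + 1)) : profiniteUpperGroup R K L x = levelSubgroup Φ j := by
  have key : ∀ {n : ℕ} {F : FiniteGaloisIntermediateField K L},
      (AlgEquiv.restrictNormalHom F : Gal(L/K) →* Gal(F/K)).ker = levelSubgroup Φ n →
      ∀ {k : ℕ}, k ≤ n → shiftJump μ k < x → (k < n → x ≤ shiftJump μ (k + 1)) →
      ∀ a : ℤ_[ℓ], Φ (Multiplicative.ofAdd a) ∈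
        (upperGroup R K F x).comap (AlgEquiv.restrictNormalHom F) ↔ (ℓ : ℤ_[ℓ]) ^ k ∣ a := by
    intro n F hF k hk h1 h2 a
    rw [Subgroup.mem_comap, upperGroup_eq_zpowers hℓ.out (mem_zpowers_layerGenerator hF)
      (orderOf_layerGenerator hF) he (hμ n) (hI n F hF) hk h1 h2, restrict_mem_zpowers_iff hF hk]
  refine le_antisymm ?_ (le_iInf fun F => ?_)
  · obtain ⟨F, hF⟩ := exists_layer Φ j
    rw [le_levelSubgroup_iff]
    exact fun a ha => (key hF le_rfl h1 (fun h => absurd h (lt_irrefl _)) a).1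
      (iInf_le (fun F : FiniteGaloisIntermediateField K L =>
        (upperGroup R K F x).comap (AlgEquiv.restrictNormalHom F)) F ha)
  · obtain ⟨n, hF⟩ := exists_ker_restrict_eq Φ F
    intro g hg
    obtain ⟨a, rfl⟩ := Φ.surjective g
    have ha := (mem_levelSubgroup_iff Φ j a.toAdd).1 hg
    rcases le_total j n with hjn | hnj
    · exact (key hF hjn h1 (fun _ => h2) a.toAdd).2 ha
    · have h3 := (shiftJump_strictMono hℓ.out.two_le he hμ).monotone hnj
      have h4 : ((shiftJump μ n : ℤ) : ℝ) < x := lt_of_le_of_lt (by exact_mod_cast h3) h1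
      exact (key hF le_rfl h4 (fun h => absurd h (lt_irrefl _)) a.toAdd).2
        ((pow_dvd_pow _ hnj).trans ha)

theorem upperJump_eq_shiftJump (i : ℕ) : upperJump R Φ i = shiftJump μ i := by
  have hmono := shiftJump_strictMono hℓ.out.two_le he hμ
  cases i with
  | zero => norm_num [upperJump, shiftJump]
  | succ i =>
    refine IsGreatest.csSup_eq ⟨⟨?_, ?_⟩, ?_⟩
    · have := hmono.monotone (Nat.zero_le (i + 1))
      exact_mod_cast this
    · have h1 : ((shiftJump μ i : ℤ) : ℝ) < shiftJump μ (i + 1) := by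
        exact_mod_cast hmono i.lt_succ_self
      exact (profiniteUpperGroup_eq_levelSubgroup he hμ hI h1 le_rfl).ge
    · rintro x ⟨-, hx⟩
      by_contra! hlt
      obtain ⟨k, hik, hk1, hk2⟩ := exists_shiftJump_lt_le hℓ.out.two_le he hμ hlt
      rw [profiniteUpperGroup_eq_levelSubgroup he hμ hI hk1 hk2, levelSubgroup_le_iff] at hx
      omega

end Profinite

section Numerics

variable {ℓ : ℕ} {e : ℤ} {I μ : ℕ → ℤ} (hℓ : 2 ≤ ℓ) (he : 0 < e)
  (hμ : ∀ n, IsUpperJumps ℓ n e I μ)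

include hℓ he hμ

/-- The upper jumps grow at least by the factor `ℓ` until they reach `e / (ℓ - 1)`, and by `e`
from there on. -/
theorem exists_stable_index : ∃ κ : ℕ, (∀ j, κ ≤ j → μ (j + 1) = μ j + e) ∧
    (ℓ - 1) * μ κ ≤ ℓ * e ∧ (κ ≠ 0 → (ℓ - 1) * (ℓ : ℤ) ^ κ + ℓ ≤ ℓ * e) := by
  have hℓ' : (2 : ℤ) ≤ ℓ := by exact_mod_cast hℓ
  have hex : ∃ k, e ≤ (ℓ - 1) * μ k := by
    refine ⟨e.toNat, ?_⟩
    have h1 := le_shiftJump hℓ he hμ (e.toNat + 1)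
    have h2 : e ≤ μ e.toNat := by
      change _ ≤ μ e.toNat at h1
      omega
    nlinarith
  classical
  have hmin : ∀ j, j < Nat.find hex → (ℓ - 1) * μ j < e := fun j hj =>
    not_le.1 (Nat.find_min hex hj)
  have hpow : ∀ j, j ≤ Nat.find hex → (ℓ : ℤ) ^ j ≤ μ j := by
    intro j
    induction j with
    | zero => exact fun _ => by simpa using (hμ 0).pos
    | succ j ih =>
      intro hj
      have h1 := ((hμ (j + 2)).unstable j (by omega) (hmin j hj)).1
      have h2 := ih (by omega)
      rw [pow_succ]
      nlinarith
  have hmono : ∀ j, μ j ≤ μ (j + 1) := fun j =>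
    ((hμ (j + 2)).one_le_and_lt hℓ he (by omega)).2.le
  refine ⟨Nat.find hex, fun j hj => ?_, ?_, fun h0 => ?_⟩
  · refine (hμ (j + 2)).stable j (by omega) ((Nat.find_spec hex).trans ?_)
    exact mul_le_mul_of_nonneg_left (monotone_nat_of_le_succ hmono hj) (by omega)
  · rcases h : Nat.find hex with _ | k
    · exact (hμ 0).zero_le
    · exact ((hμ (k + 2)).unstable k (by omega) (hmin k (by omega))).2
  · obtain ⟨k, hk⟩ := Nat.exists_eq_succ_of_ne_zero h0
    have h1 := hmin k (by omega)
    have h2 := hpow k (by omega)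
    have h3 : (ℓ - 1) * (ℓ : ℤ) ^ k + 1 ≤ e := by
      have : (ℓ - 1) * (ℓ : ℤ) ^ k ≤ (ℓ - 1) * μ k := mul_le_mul_of_nonneg_left h2 (by omega)
      omega
    rw [hk, Nat.succ_eq_add_one, pow_succ]
    nlinarith

end Numerics

end Ramification

theorem mainTheorem8 (ℓ : ℕ) [Fact ℓ.Prime]
    (R K L : Type*) [CommRing R] [IsDomain R] [IsDiscreteValuationRing R]
    [IsAdicComplete (IsLocalRing.maximalIdeal R) R]
    [CharP (IsLocalRing.ResidueField R) ℓ] [PerfectField (IsLocalRing.ResidueField R)]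
    [Field K] [Algebra R K] [IsFractionRing R K]
    (e : ℕ) (he : IsDiscreteValuationRing.addVal R (ℓ : R) = e)
    [Field L] [Algebra K L] [IsGalois K L] [Algebra R L] [IsScalarTower R K L]
    (Φ : Multiplicative ℤ_[ℓ] ≃ₜ* Gal(L/K))
    (htot : Ramification.IsTotallyRamified R K L)
    (ν : ℕ → ℝ) (hν : ν = Ramification.upperJump R Φ) :
    (ν 0 = -1 ∧ StrictMono ν ∧
      ∀ (i : ℕ) (x : ℝ), ν i < x → x ≤ ν (i + 1) →
        Ramification.profiniteUpperGroup R K L x = Ramification.levelSubgroup Φ i) ∧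
    ∃ κ : ℕ,
      (∀ i : ℕ, κ + 1 ≤ i → ν (i + 1) - ν i = e) ∧
      max (ν (κ + 1)) ((ℓ : ℝ) ^ κ) ≤ (e : ℝ) * ℓ / (ℓ - 1) ∧
      ((ℓ = 2 ∨ e ≠ 1) →
        max (ν (κ + 1)) ((ℓ : ℝ) ^ κ + 1) ≤ (e : ℝ) * ℓ / (ℓ - 1)) := by
  have hℓ : 2 ≤ ℓ := (Fact.out : ℓ.Prime).two_le
  have he0 : 0 < e := Ramification.ramificationIndex_pos he
  have he0' : (0 : ℤ) < e := by exact_mod_cast he0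
  obtain ⟨I, μ, hμ, hI⟩ := Ramification.exists_jumps_layers he htot Φ
  have hν' : ∀ i, ν i = Ramification.shiftJump μ i := fun i => by
    rw [hν, Ramification.upperJump_eq_shiftJump he0' hμ hI]
  have hmono := Ramification.shiftJump_strictMono hℓ he0' hμ
  refine ⟨⟨by rw [hν]; rfl, fun i j hij => ?_, fun i x h1 h2 => ?_⟩, ?_⟩
  · rw [hν', hν']
    exact_mod_cast hmono hij
  · rw [hν'] at h1 h2
    exact Ramification.profiniteUpperGroup_eq_levelSubgroup he0' hμ hI h1 h2
  obtain ⟨κ, hstable, hκ, hpow⟩ := Ramification.exists_stable_index hℓ he0' hμ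
  have hℓ1 : (0 : ℝ) < ℓ - 1 := by
    have : (2 : ℝ) ≤ ℓ := by exact_mod_cast hℓ
    linarith
  have hνκ : ν (κ + 1) ≤ (e : ℝ) * ℓ / (ℓ - 1) := by
    rw [le_div_iff₀ hℓ1, hν', mul_comm, mul_comm (e : ℝ)]
    exact_mod_cast hκ
  have hpow' : κ ≠ 0 → (ℓ : ℝ) ^ κ + 1 ≤ (e : ℝ) * ℓ / (ℓ - 1) := by
    intro h0
    rw [le_div_iff₀ hℓ1]
    have : ((ℓ : ℝ) - 1) * (ℓ : ℝ) ^ κ + ℓ ≤ ℓ * e := by exact_mod_cast hpow h0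
    linarith
  have hER : (1 : ℝ) ≤ e := by exact_mod_cast he0
  refine ⟨κ, fun i hi => ?_, max_le hνκ ?_, fun hcase => max_le hνκ ?_⟩
  · obtain ⟨j, rfl⟩ : ∃ j, i = j + 1 := ⟨i - 1, by omega⟩
    have h1 : Ramification.shiftJump μ (j + 1 + 1) = Ramification.shiftJump μ (j + 1) + e :=
      hstable j (by omega)
    rw [hν', hν', h1]
    push_cast
    ring
  · rcases eq_or_ne κ 0 with rfl | h0
    · rw [le_div_iff₀ hℓ1, pow_zero]
      nlinarith
    · linarith [hpow' h0]
  · rcases eq_or_ne κ 0 with rfl | h0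
    · rw [le_div_iff₀ hℓ1, pow_zero]
      -- The inequality `2 (ℓ - 1) ≤ e ℓ` fails exactly for `e = 1` and `ℓ > 2`.
      rcases hcase with rfl | he1
      · push_cast
        linarith
      · have : (2 : ℝ) ≤ e := by exact_mod_cast (by omega : 2 ≤ e)
        nlinarith
    · exact hpow' h0
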